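/- Manifolds are smooth ($C^\infty$), finite dimensional, Hausdorff, second countable and without boundary. A \emph{Lie 2-category} $C$ is a small (strict) 2-category whose sets $C_0,C_1,C_2$ of objects, arrows and 2-cells are manifolds, such that the source and target maps $C_1\to C_0$ and $C_2\to C_1$ are surjective submersions and the units and the compositions (horizontal $\circ$ of arrows and of 2-cells, vertical $\bullet$ of 2-cells) are smooth. Its nerve $NC$ is the simplicial set whose $n$-simplices are the normal lax functors $u:[n]\dashrightarrow C$: objects $u_i$, arrows $u_{j,i}:u_i\to u_j$ ($i\le j$), and 2-cells $u_{k,j,i}:u_{k,i}\Rightarrow u_{k,j}\circ u_{j,i}$ ($i\le j\le k$), subject to normality and to the coherence equation for every $i\le j\le k\le l$. The set $N_nC$ is given the manifold structure, if there is one, for which the canonical injection $N_nC\to\prod_{a:[2]\to[n]}C_2$, $u\mapsto (u_{a(2),a(1),a(0)})_a$, is a smooth embedding. A \emph{2-groupoid} is a small 2-category in which every 2-cell is invertible and every arrow is invertible up to invertible 2-cells. A \emph{Lie 2-groupoid} is a Lie 2-category $C$ that is a 2-groupoid, such that the inversion of 2-cells $C_2\to C_2$ is smooth and the maps $$N_2C\to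 C_1\times_{s,C_0,s}C_1,\quad (\alpha:h\Rightarrow g\circ f)\mapsto (f,h),\qquad N_2C\to C_1\times_{t,C_0,t}C_1,\quad (\alpha:h\Rightarrow g\circ f)\mapsto (g,h)$$ are surjective submersions, where $N_2C=\{(\alpha,g,f): t(\alpha)=g\circ f\}\subset C_2\times C_1\times C_1$ and both targets carry the fibre product structures. A simplicial manifold $X$ is a \emph{weak Lie $m$-category} if for all $0<k<n$ the space of horns $X_{n,k}=\mathrm{Hom}(\Lambda^n_k,X)$ is an embedded submanifold of $\prod_{i\ne k}X_{n-1}$ and the restriction map $X_n\to X_{n,k}$ is a surjective submersion, which is moreover injective (so a diffeomorphism) if $n>m$. It is a \emph{weak Lie $m$-groupoid} if the same holds for all $n\ge1$ and all $0\le k\le n$. \textbf{Proposition.} Let $C$ be a Lie 2-category in which every 2-cell is invertible. Then the sets $N_nC$ admit the manifold structures above, and with them $NC$ is a simplicial manifold and a weak Lie 2-category. Moreover, $NC$ is a weak Lie 2-groupoid if and only if $C$ is a Lie 2-groupoid. -/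

import Mathlib

open CategoryTheory Simplicial Opposite
open scoped Manifold ContDiff

universe u

/-! ### Manifolds: smooth structures on types, and maps between them -/

/-- A structure of smooth manifold on a type: Hausdorff, second countable, without boundary,
modelled on a finite dimensional real vector space. -/
structure SmoothStr (X : Type u) where
  E : Type
  [normedAddCommGroup : NormedAddCommGroup E]
  [normedSpace : NormedSpace ℝ E]
  [finiteDimensional : FiniteDimensional ℝ E]
  [top : TopologicalSpace X]
  [charted : ChartedSpace E X]
  [isManifold : IsManifold 𝓘(ℝ, E) ∞ X]
  [t2 : T2Space X]
  [secondCountable : SecondCountableTopology X]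

namespace SmoothStr

attribute [instance] SmoothStr.normedAddCommGroup SmoothStr.normedSpace
  SmoothStr.finiteDimensional

variable {X Y Z : Type u}

/-- `f` is a smooth map. -/
def IsSmooth (S : SmoothStr X) (T : SmoothStr Y) (f : X → Y) : Prop :=
  letI := S.top
  letI := S.charted
  letI := T.top
  letI := T.charted
  ContMDiff 𝓘(ℝ, S.E) 𝓘(ℝ, T.E) ∞ f

/-- `f` is a surjective submersion. -/
def IsSurjSubmersion (S : SmoothStr X) (T : SmoothStr Y) (f : X → Y) : Prop :=
  letI := S.top
  letI := S.charted
  letI := T.top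
  letI := T.charted
  Function.Surjective f ∧ Manifold.IsSubmersion 𝓘(ℝ, S.E) 𝓘(ℝ, T.E) ∞ f

/-- The differential of `f` at `x`, read in the model spaces. -/
noncomputable def diff (S : SmoothStr X) (T : SmoothStr Y) (f : X → Y) (x : X) : S.E →L[ℝ] T.E :=
  letI := S.top
  letI := S.charted
  letI := T.top
  letI := T.charted
  mfderiv 𝓘(ℝ, S.E) 𝓘(ℝ, T.E) f x

/-- A partially defined binary operation `op`, defined on the pairs satisfying `P`, is smooth as
a map on the subset `{(x, y) | P x y}` of the product manifold `X × Y`: around each point of this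
subset it extends to a smooth map on an open subset of `X × Y`. (On an embedded submanifold of
`X × Y`, such as a fibre product along a submersion, this is smoothness on the submanifold.) -/
def IsSmoothOp (S : SmoothStr X) (T : SmoothStr Y) (U : SmoothStr Z) (P : X → Y → Prop)
    (op : ∀ x y, P x y → Z) : Prop :=
  letI := S.top
  letI := S.charted
  letI := T.top
  letI := T.charted
  letI := U.top
  letI := U.charted
  ∀ x y, P x y → ∃ V : Set (X × Y), IsOpen V ∧ (x, y) ∈ V ∧ ∃ F : X × Y → Z,
    ContMDiffOn (𝓘(ℝ, S.E).prod 𝓘(ℝ, T.E)) 𝓘(ℝ, U.E) ∞ F V ∧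
      ∀ x' y' (h : P x' y'), (x', y') ∈ V → F (x', y') = op x' y' h

end SmoothStr

/-- A map from `X` to some manifold `Y`. -/
structure MapToManifold (X : Type u) where
  Y : Type u
  str : SmoothStr Y
  toFun : X → Y

/-- For a finite family of maps `φ i : X → Y i` into manifolds, the map
`X → ∏ i, Y i` with these components is a smooth embedding, that is, `S` is the structure of an
embedded submanifold of `∏ i, Y i` on `X`:
it is injective and smooth, the topology of `X` is the one induced from the product, and its
differential at each point is injective. -/
structure SmoothStr.IsEmbeddingInProduct {X : Type u} (S : SmoothStr X) {ι : Type} [Finite ι]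
    (φ : ι → MapToManifold X) : Prop where
  injective : ∀ x y : X, (∀ i, (φ i).toFun x = (φ i).toFun y) → x = y
  smooth : ∀ i, S.IsSmooth (φ i).str (φ i).toFun
  top_eq : S.top = ⨅ i, (φ i).str.top.induced (φ i).toFun
  immersion : ∀ (x : X) (v : S.E), (∀ i, S.diff (φ i).str (φ i).toFun x v = 0) → v = 0

/-! ### 2-categories -/

/-- A small 2-category, presented by its set of objects `Ob`, its set of arrows `Ar` and its set of
2-cells `Ce`. An arrow `f` goes from `src f` to `tgt f`; a 2-cell `α` goes from the arrow `dom α`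
to the parallel arrow `cod α`. Composition of arrows is `comp g f` (for `g ∘ f`), composition
of 2-cells in the hom-categories (the operation `β • α`) is `vcomp β α`,
and composition of 2-cells along an object (the operation `β ∘ α`) is `hcomp β α`. -/
structure TwoCat where
  Ob : Type u
  Ar : Type u
  Ce : Type u
  src : Ar → Ob
  tgt : Ar → Ob
  dom : Ce → Ar
  cod : Ce → Ar
  src_cod : ∀ α, src (cod α) = src (dom α)
  tgt_cod : ∀ α, tgt (cod α) = tgt (dom α)
  one : Ob → Ar
  src_one : ∀ x, src (one x) = x
  tgt_one : ∀ x, tgt (one x) = x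
  idc : Ar → Ce
  dom_idc : ∀ f, dom (idc f) = f
  cod_idc : ∀ f, cod (idc f) = f
  comp : ∀ g f : Ar, src g = tgt f → Ar
  src_comp : ∀ g f h, src (comp g f h) = src f
  tgt_comp : ∀ g f h, tgt (comp g f h) = tgt g
  vcomp : ∀ β α : Ce, dom β = cod α → Ce
  dom_vcomp : ∀ β α h, dom (vcomp β α h) = dom α
  cod_vcomp : ∀ β α h, cod (vcomp β α h) = cod β
  hcomp : ∀ β α : Ce, src (dom β) = tgt (dom α) → Ce
  dom_hcomp : ∀ β α h, dom (hcomp β α h) = comp (dom β) (dom α) h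
  cod_hcomp : ∀ β α h,
    cod (hcomp β α h) = comp (cod β) (cod α) (by rw [src_cod, tgt_cod, h])
  /- each hom-category is a category -/
  vcomp_assoc : ∀ γ β α (h : dom γ = cod β) (h' : dom β = cod α),
    vcomp (vcomp γ β h) α (by rw [dom_vcomp, h']) = vcomp γ (vcomp β α h') (by rw [cod_vcomp, h])
  idc_vcomp : ∀ α, vcomp (idc (cod α)) α (by rw [dom_idc]) = α
  vcomp_idc : ∀ α, vcomp α (idc (dom α)) (by rw [cod_idc]) = α
  /- horizontal composition is a functor -/
  hcomp_idc : ∀ g f (h : src g = tgt f),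
    hcomp (idc g) (idc f) (by rw [dom_idc, dom_idc, h]) = idc (comp g f h)
  interchange : ∀ β' β α' α (hβ : dom β' = cod β) (hα : dom α' = cod α)
    (h : src (dom β) = tgt (dom α)),
    hcomp (vcomp β' β hβ) (vcomp α' α hα) (by rw [dom_vcomp, dom_vcomp, h]) =
      vcomp (hcomp β' α' (by rw [hβ, hα, src_cod, tgt_cod, h])) (hcomp β α h)
        (by simp only [dom_hcomp, cod_hcomp, hβ, hα])
  /- horizontal composition is associative and unital, on arrows and on 2-cells -/
  comp_assoc : ∀ k g f (h : src k = tgt g) (h' : src g = tgt f),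
    comp (comp k g h) f (by rw [src_comp, h']) = comp k (comp g f h') (by rw [tgt_comp, h])
  one_comp : ∀ f, comp (one (tgt f)) f (by rw [src_one]) = f
  comp_one : ∀ f, comp f (one (src f)) (by rw [tgt_one]) = f
  hcomp_assoc : ∀ γ β α (h : src (dom γ) = tgt (dom β)) (h' : src (dom β) = tgt (dom α)),
    hcomp (hcomp γ β h) α (by rw [dom_hcomp, src_comp, h']) =
      hcomp γ (hcomp β α h') (by rw [dom_hcomp, tgt_comp, h])
  one_hcomp : ∀ α, hcomp (idc (one (tgt (dom α)))) α (by rw [dom_idc, src_one]) = α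
  hcomp_one : ∀ α, hcomp α (idc (one (src (dom α)))) (by rw [dom_idc, tgt_one]) = α

namespace TwoCat

/-- `β` is the inverse of the 2-cell `α` for the composition `•`. -/
def IsInverse (C : TwoCat.{u}) (α β : C.Ce) : Prop :=
  ∃ (h : C.dom β = C.cod α) (h' : C.dom α = C.cod β),
    C.vcomp β α h = C.idc (C.dom α) ∧ C.vcomp α β h' = C.idc (C.cod α)

/-- Every 2-cell is invertible. -/
def CellsInvertible (C : TwoCat.{u}) : Prop := ∀ α : C.Ce, ∃ β, C.IsInverse α β

/-- Two arrows are isomorphic: there is an invertible 2-cell between them. -/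
def Isomorphic (C : TwoCat.{u}) (f g : C.Ar) : Prop :=
  ∃ α β, C.dom α = f ∧ C.cod α = g ∧ C.IsInverse α β

/-- A 2-groupoid: a 2-category in which every 2-cell is invertible, and in which every arrow is
invertible up to invertible 2-cells. -/
def IsTwoGroupoid (C : TwoCat.{u}) : Prop :=
  C.CellsInvertible ∧ ∀ f : C.Ar, ∃ (g : C.Ar) (h : C.src f = C.tgt g) (h' : C.src g = C.tgt f),
    C.Isomorphic (C.comp f g h) (C.one (C.tgt f)) ∧ C.Isomorphic (C.comp g f h') (C.one (C.src f))

/-! ### The nerve of a 2-category -/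

/-- An `n`-simplex of the nerve of `C`: a normal lax functor from the ordinal
`[n] = {0 < ⋯ < n}`, viewed as a 2-category with only identity 2-cells, to `C`. It consists of
objects `ob i`, arrows `ar i j : ob i → ob j` for `i ≤ j`, and, for `i ≤ j ≤ k`,
structural 2-cells `ce i j k : ar i k ⇒ ar j k ∘ ar i j`,
such that units are preserved, the structural 2-cells are normal, and the coherence equation
of a lax functor holds for all `i ≤ j ≤ k ≤ l`. -/
@[ext]
structure Simplex (C : TwoCat.{u}) (n : ℕ) where
  ob : Fin (n + 1) → C.Ob
  ar : ∀ i j : Fin (n + 1), i ≤ j → C.Ar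
  ce : ∀ i j k : Fin (n + 1), i ≤ j → j ≤ k → C.Ce
  src_ar : ∀ i j hij, C.src (ar i j hij) = ob i
  tgt_ar : ∀ i j hij, C.tgt (ar i j hij) = ob j
  ar_self : ∀ i, ar i i le_rfl = C.one (ob i)
  dom_ce : ∀ i j k hij hjk, C.dom (ce i j k hij hjk) = ar i k (hij.trans hjk)
  cod_ce : ∀ i j k hij hjk, C.cod (ce i j k hij hjk) =
    C.comp (ar j k hjk) (ar i j hij) (by rw [src_ar, tgt_ar])
  ce_left : ∀ i k hik, ce i i k le_rfl hik = C.idc (ar i k hik)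
  ce_right : ∀ i k hik, ce i k k hik le_rfl = C.idc (ar i k hik)
  coherence : ∀ i j k l (hij : i ≤ j) (hjk : j ≤ k) (hkl : k ≤ l),
    C.vcomp
      (C.hcomp (ce j k l hjk hkl) (C.idc (ar i j hij)) (by rw [dom_ce, C.dom_idc, src_ar, tgt_ar]))
      (ce i j l hij (hjk.trans hkl))
      (by simp only [C.dom_hcomp, C.dom_idc, dom_ce, cod_ce]) =
    C.vcomp
      (C.hcomp (C.idc (ar k l hkl)) (ce i j k hij hjk) (by rw [dom_ce, C.dom_idc, src_ar, tgt_ar]))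
      (ce i k l (hij.trans hjk) hkl)
      (by simp only [C.dom_hcomp, C.dom_idc, dom_ce, cod_ce])

/-- Precomposition of a normal lax functor `[n] ⇢ C` with a monotone map `[m] → [n]`. -/
def Simplex.pullback {C : TwoCat.{u}} {m n : ℕ} (s : Simplex C n) (a : Fin (m + 1) →o Fin (n + 1)) :
    Simplex C m where
  ob i := s.ob (a i)
  ar i j h := s.ar (a i) (a j) (a.monotone h)
  ce i j k h h' := s.ce (a i) (a j) (a k) (a.monotone h) (a.monotone h')
  src_ar _ _ _ := s.src_ar _ _ _
  tgt_ar _ _ _ := s.tgt_ar _ _ _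
  ar_self _ := s.ar_self _
  dom_ce _ _ _ _ _ := s.dom_ce _ _ _ _ _
  cod_ce _ _ _ _ _ := s.cod_ce _ _ _ _ _
  ce_left _ _ _ := s.ce_left _ _ _
  ce_right _ _ _ := s.ce_right _ _ _
  coherence _ _ _ _ _ _ _ := s.coherence _ _ _ _ _ _ _

/-- The nerve `NC` of a 2-category, as a simplicial set. -/
def nerve (C : TwoCat.{u}) : SSet.{u} where
  obj n := Simplex C n.unop.len
  map f := TypeCat.ofHom fun s => s.pullback f.unop.toOrderHom
  map_id _ := rfl
  map_comp _ _ := rfl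

end TwoCat

/-! ### Lie 2-categories and Lie 2-groupoids -/

/-- A Lie 2-category: a small 2-category whose sets of objects, arrows and 2-cells are manifolds,
such that all source and target maps are surjective submersions, and units and
multiplications are smooth. -/
structure LieTwoCat extends TwoCat.{u} where
  obStr : SmoothStr Ob
  arStr : SmoothStr Ar
  ceStr : SmoothStr Ce
  src_submersion : arStr.IsSurjSubmersion obStr src
  tgt_submersion : arStr.IsSurjSubmersion obStr tgt
  dom_submersion : ceStr.IsSurjSubmersion arStr dom
  cod_submersion : ceStr.IsSurjSubmersion arStr cod
  one_smooth : obStr.IsSmooth arStr one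
  idc_smooth : arStr.IsSmooth ceStr idc
  comp_smooth : SmoothStr.IsSmoothOp arStr arStr arStr (fun g f => src g = tgt f) comp
  hcomp_smooth :
    SmoothStr.IsSmoothOp ceStr ceStr ceStr (fun β α => src (dom β) = tgt (dom α)) hcomp
  vcomp_smooth : SmoothStr.IsSmoothOp ceStr ceStr ceStr (fun β α => dom β = cod α) vcomp

namespace TwoCat

/-- `N₂C`: triangles `(α, g, f)` with `g`, `f` composable arrows and `α` a 2-cell
with target `g ∘ f`. -/
def Triangle (C : TwoCat.{u}) : Type u :=
  {p : C.Ce × C.Ar × C.Ar // ∃ h : C.src p.2.1 = C.tgt p.2.2, C.cod p.1 = C.comp p.2.1 p.2.2 h}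

/-- `N_{2,0}C`: pairs `(f, h)` of arrows with the same source. -/
def LeftHorn (C : TwoCat.{u}) : Type u := {p : C.Ar × C.Ar // C.src p.1 = C.src p.2}

/-- `N_{2,2}C`: pairs `(g, h)` of arrows with the same target. -/
def RightHorn (C : TwoCat.{u}) : Type u := {p : C.Ar × C.Ar // C.tgt p.1 = C.tgt p.2}

/-- The restriction map `d_{2,0} : N₂C → N_{2,0}C`, sending `α : h ⇒ g ∘ f` to `(f, h)`. -/
def toLeftHorn (C : TwoCat.{u}) (p : C.Triangle) : C.LeftHorn :=
  ⟨(p.1.2.2, C.dom p.1.1), by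
    obtain ⟨⟨α, g, f⟩, h, h'⟩ := p
    dsimp only at h h' ⊢
    rw [← C.src_cod, h', C.src_comp]⟩

/-- The restriction map `d_{2,2} : N₂C → N_{2,2}C`, sending `α : h ⇒ g ∘ f` to `(g, h)`. -/
def toRightHorn (C : TwoCat.{u}) (p : C.Triangle) : C.RightHorn :=
  ⟨(p.1.2.1, C.dom p.1.1), by
    obtain ⟨⟨α, g, f⟩, h, h'⟩ := p
    dsimp only at h h' ⊢
    rw [← C.tgt_cod, h', C.tgt_comp]⟩

end TwoCat

namespace LieTwoCat

/-- `S` is the manifold structure of the fibre product `N₂C ⊆ C₂ × C₁ × C₁`. -/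
def IsTriangleStr (C : LieTwoCat.{u}) (S : SmoothStr C.Triangle) : Prop :=
  S.IsEmbeddingInProduct (ι := Fin 3)
    ![⟨C.Ce, C.ceStr, fun p => p.1.1⟩, ⟨C.Ar, C.arStr, fun p => p.1.2.1⟩,
      ⟨C.Ar, C.arStr, fun p => p.1.2.2⟩]

/-- `S` is the manifold structure of the fibre product `N_{2,0}C ⊆ C₁ × C₁`. -/
def IsLeftHornStr (C : LieTwoCat.{u}) (S : SmoothStr C.LeftHorn) : Prop :=
  S.IsEmbeddingInProduct (ι := Fin 2)
    ![⟨C.Ar, C.arStr, fun p => p.1.1⟩, ⟨C.Ar, C.arStr, fun p => p.1.2⟩]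

/-- `S` is the manifold structure of the fibre product `N_{2,2}C ⊆ C₁ × C₁`. -/
def IsRightHornStr (C : LieTwoCat.{u}) (S : SmoothStr C.RightHorn) : Prop :=
  S.IsEmbeddingInProduct (ι := Fin 2)
    ![⟨C.Ar, C.arStr, fun p => p.1.1⟩, ⟨C.Ar, C.arStr, fun p => p.1.2⟩]

/-- A Lie 2-groupoid: a Lie 2-category that is a 2-groupoid, such that the inversion of 2-cells is
smooth, and such that the restriction maps `N₂C → N_{2,0}C` and `N₂C → N_{2,2}C` are
surjective submersions. -/
structure IsLieTwoGroupoid (C : LieTwoCat.{u}) : Prop where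
  isTwoGroupoid : C.IsTwoGroupoid
  inv_smooth : ∃ inv : C.Ce → C.Ce, (∀ α, C.IsInverse α (inv α)) ∧ C.ceStr.IsSmooth C.ceStr inv
  horn_submersion : ∃ (S : SmoothStr C.Triangle) (L : SmoothStr C.LeftHorn)
    (R : SmoothStr C.RightHorn), C.IsTriangleStr S ∧ C.IsLeftHornStr L ∧ C.IsRightHornStr R ∧
      S.IsSurjSubmersion L C.toLeftHorn ∧ S.IsSurjSubmersion R C.toRightHorn

instance (m n : ℕ) : Finite (Fin m →o Fin n) := DFunLike.finite _

/-- A family `S` of manifold structures on the sets `N_n C` is the natural one: for each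
`n`, the canonical map `N_n C → A_n C = ∏_{a : [2] → [n]} C₂` into the ambient manifold, whose
component at `a` sends a simplex `u` to its 2-cell `u_{a 2, a 1, a 0}`, is a smooth embedding. -/
def IsNerveStr (C : LieTwoCat.{u}) (S : ∀ n : ℕ, SmoothStr (C.nerve _⦋n⦌)) : Prop :=
  ∀ n : ℕ, (S n).IsEmbeddingInProduct (ι := Fin 3 →o Fin (n + 1)) fun a =>
    ⟨C.Ce, C.ceStr, fun u : TwoCat.Simplex C.toTwoCat n =>
      u.ce (a 0) (a 1) (a 2) (a.monotone (by decide)) (a.monotone (by decide))⟩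

end LieTwoCat

/-! ### Simplicial manifolds, weak Lie `m`-categories and weak Lie `m`-groupoids -/

namespace SSet

/-- The simplicial set `X` with the manifold structures `S n` on its sets of simplices is a
simplicial manifold. -/
def IsSimplicialManifold (X : SSet.{u}) (S : ∀ n : ℕ, SmoothStr (X _⦋n⦌)) : Prop :=
  ∀ (m n : ℕ) (a : ⦋m⦌ ⟶ ⦋n⦌), (S n).IsSmooth (S m) (X.map a.op)

/-- The restriction map `X_n → X_{n,k} = Hom(Λ[n,k], X)`. -/
noncomputable def hornRestriction (X : SSet.{u}) (n : ℕ) (k : Fin (n + 1)) (x : X _⦋n⦌) :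
    (Λ[n, k] : SSet.{u}) ⟶ X :=
  (Λ[n, k]).ι ≫ yonedaEquiv.symm x

/-- The space of horns `X_{n+1,k}` is an embedded submanifold of `∏_{i ≠ k} X_n`, via the faces of a
horn, and the restriction map `X_{n+1} → X_{n+1,k}` is a surjective submersion. -/
def HornSubmersion (X : SSet.{u}) (S : ∀ n : ℕ, SmoothStr (X _⦋n⦌)) (n : ℕ) (k : Fin (n + 2)) :
    Prop :=
  ∃ T : SmoothStr ((Λ[n + 1, k] : SSet.{u}) ⟶ X),
    T.IsEmbeddingInProduct (ι := {i : Fin (n + 2) // i ≠ k})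
      (fun i => ⟨X _⦋n⦌, S n, fun h => yonedaEquiv (horn.ι k i.1 i.2 ≫ h)⟩) ∧
    (S (n + 1)).IsSurjSubmersion T (X.hornRestriction (n + 1) k)

/-- Weak Lie `m`-category: a simplicial manifold whose restriction maps to the spaces of inner horns
are surjective submersions, with unique fillings (hence diffeomorphisms) in
dimensions above `m`. -/
structure IsWeakLieCategory (m : ℕ) (X : SSet.{u}) (S : ∀ n : ℕ, SmoothStr (X _⦋n⦌)) : Prop where
  simplicialManifold : X.IsSimplicialManifold S
  submersion : ∀ (n : ℕ) (k : Fin (n + 2)), 0 < k → k < Fin.last (n + 1) → X.HornSubmersion S n k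
  unique : ∀ (n : ℕ) (k : Fin (n + 2)), 0 < k → k < Fin.last (n + 1) → m < n + 1 →
    Function.Injective (X.hornRestriction (n + 1) k)

/-- Weak Lie `m`-groupoid: a simplicial manifold whose restriction maps to the spaces of horns, inner
or outer, are surjective submersions, with unique fillings (hence diffeomorphisms) in
dimensions above `m`. -/
structure IsWeakLieGroupoid (m : ℕ) (X : SSet.{u}) (S : ∀ n : ℕ, SmoothStr (X _⦋n⦌)) : Prop where
  simplicialManifold : X.IsSimplicialManifold S
  submersion : ∀ (n : ℕ) (k : Fin (n + 2)), X.HornSubmersion S n k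
  unique : ∀ (n : ℕ) (k : Fin (n + 2)), m < n + 1 →
    Function.Injective (X.hornRestriction (n + 1) k)

end SSet

/-!
Differential geometry enters through germs. `SmoothNear` is smoothness near a point, and
`SmoothAlong` is smoothness of a map on a set that sits in an ambient manifold: locally, the map
extends to the ambient manifold. An embedding into a product of manifolds is a smooth injection that
has smooth local retractions (`EmbedsIn`), so smoothness into an embedded submanifold can be tested
in the ambient manifold; a surjective submersion is a surjective smooth map with smooth local
sections (`isSurjSubmersion_iff`); and the fibre product of a map and a submersion is an embedded
submanifold (`exists_fibreProduct`). These three facts rest on the inverse function theorem. The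
same theorem shows that in a Lie 2-category with invertible 2-cells the inversion of 2-cells is
automatically smooth (`smoothNear_iv`), since `(β, α) ↦ (β • α, α)` is a diffeomorphism. In what
follows, "smooth" thus means "given by a formula in the operations of `C`".

An `(n + 1)`-simplex of the nerve is a cone: it is determined by its face on the vertices
`0, …, n`, its last edge `n → n + 1`, and the 2-cells `u_{n+1,n,i}` for `i < n`. The other 2-cells
are computed from the coherence equations that involve the last two vertices, and the remaining
coherence equations follow from the pentagon: if four of the five tetrahedra of a 4-simplex are
coherent, so is the fifth (`coh_face₁`, `coh_face₂`, `coh_face₃`), except that for the tetrahedron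
opposite the first or the last vertex the pentagon yields the coherence equation whiskered by the
first or the last edge, which may be cancelled if this edge is invertible up to 2-cells (`coh_face₀`,
`coh_face₄`).
Since the codomain of the 2-cells is the only constraint on these data, `N_{n+1} C` is an
iterated fibre product along submersions (`exists_simplexStr_succ`).

The horn conditions depend on the dimension.

* A horn of dimension at least four contains all edges and all triangles, so it determines its
  filler; a tetrahedron that it misses is coherent by the pentagon, where for outer horns arrows have
  to be invertible up to 2-cells (`exists_filler_of_four_le`).
* A horn of dimension three misses one 2-cell, which has to be found from the coherence equation.
  For inner horns the missing 2-cell is not whiskered there, and inverses of 2-cells suffice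
  (`hornSubmersion_three_one`, `hornSubmersion_three_two`). For outer horns it is whiskered by an
  edge `f` of the horn. The equation then has a unique solution if `f` is invertible up to 2-cells,
  and the solution is smooth if one-sided inverses of `f` can be chosen smoothly in `f`, locally
  (`hornSubmersion_three_zero`, `hornSubmersion_three_three`).
* Horns of dimension two are pairs of arrows with an end point in common, and the outer horn
  conditions are literally the two submersion conditions in the definition of a Lie 2-groupoid
  (`hornSubmersion_two_zero_iff`, `hornSubmersion_two_two_iff`). For the inner horn, the composition
  of arrows is a section up to the choice of a 2-cell with given codomain
  (`hornSubmersion_two_one`).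
* In dimension one, the conditions are that source and target are surjective submersions.

The submersion conditions on outer horns of dimension two, applied to the horns of which one edge is
a unit, give the local smooth one-sided inverses that are needed in dimension three
(`hasSmoothRightInv_of_toRightHorn`, `hasSmoothLeftInv_of_toLeftHorn`), and they imply that `C` is a
2-groupoid (`isTwoGroupoid_of_inverses`). So `NC` is a weak Lie 2-groupoid if and only if `C` is a
Lie 2-groupoid.
-/

open Filter Topology

namespace SmoothStr

/-! ### Germs of smooth maps -/

/-- The underlying type of a smooth structure, as a type synonym that carries the topology and the
charts of the structure as instances. -/
def Carrier {X : Type*} (_ : SmoothStr X) : Type _ := X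

section Carrier

variable {X : Type*} (S : SmoothStr X)

instance : TopologicalSpace S.Carrier := S.top
instance : ChartedSpace S.E S.Carrier := S.charted
instance : IsManifold 𝓘(ℝ, S.E) ∞ S.Carrier := S.isManifold
instance : T2Space S.Carrier := S.t2
instance : SecondCountableTopology S.Carrier := S.secondCountable

/-- The neighbourhood filter of a point of a manifold. -/
def nhd (x : X) : Filter X := @nhds S.Carrier _ x

lemma eventually_mem {x : X} {p : X → Prop} (h : ∀ᶠ y in S.nhd x, p y) : p x :=
  @Filter.Eventually.self_of_nhds S.Carrier _ x p h

lemma eventually_eventually {x : X} {p : X → Prop} (h : ∀ᶠ y in S.nhd x, p y) :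
    ∀ᶠ y in S.nhd x, ∀ᶠ z in S.nhd y, p z :=
  (@eventually_eventually_nhds S.Carrier _ x p).2 h

/-- The chart around a point, as a map into the model space. -/
noncomputable def ch (x : X) : X → S.E := chartAt (M := S.Carrier) S.E x

/-- The inverse of the chart around a point. -/
noncomputable def chInv (x : X) : S.E → X := (chartAt (M := S.Carrier) S.E x).symm

lemma eventually_chInv_ch (x : X) : ∀ᶠ y in S.nhd x, S.chInv x (S.ch x y) = y := by
  filter_upwards [(chartAt (M := S.Carrier) S.E x).open_source.mem_nhds
    (mem_chart_source (M := S.Carrier) S.E x)]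
    with y hy using (chartAt (M := S.Carrier) S.E x).left_inv hy

lemma chInv_ch_self (x : X) : S.chInv x (S.ch x x) = x :=
  S.eventually_mem (p := fun y => S.chInv x (S.ch x y) = y) (S.eventually_chInv_ch x)

lemma eventually_ch_chInv (x : X) : ∀ᶠ v in 𝓝 (S.ch x x), S.ch x (S.chInv x v) = v := by
  filter_upwards [(chartAt (M := S.Carrier) S.E x).open_target.mem_nhds
    (mem_chart_target (M := S.Carrier) S.E x)]
    with y hy using (chartAt (M := S.Carrier) S.E x).right_inv hy

end Carrier

/-- A finite dimensional normed space as a manifold. -/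
noncomputable def self (V : Type) [NormedAddCommGroup V] [NormedSpace ℝ V]
    [FiniteDimensional ℝ V] : SmoothStr V where
  E := V
  secondCountable := (FiniteDimensional.proper ℝ V : ProperSpace V) |> fun _ =>
    secondCountable_of_proper

/-- The product of two manifolds. -/
noncomputable def prod {X Y : Type*} (S : SmoothStr X) (T : SmoothStr Y) : SmoothStr (X × Y) where
  E := S.E × T.E
  top := inferInstanceAs (TopologicalSpace (S.Carrier × T.Carrier))
  charted := inferInstanceAs (ChartedSpace (ModelProd S.E T.E) (S.Carrier × T.Carrier))
  isManifold := by
    rw [modelWithCornersSelf_prod]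
    exact inferInstanceAs
      (IsManifold (𝓘(ℝ, S.E).prod 𝓘(ℝ, T.E)) ∞ (S.Carrier × T.Carrier))
  t2 := inferInstanceAs (T2Space (S.Carrier × T.Carrier))
  secondCountable := inferInstanceAs (SecondCountableTopology (S.Carrier × T.Carrier))

lemma isManifold_pi {ι : Type} [Fintype ι] {E : ι → Type} [∀ i, NormedAddCommGroup (E i)]
    [∀ i, NormedSpace ℝ (E i)] {M : ι → Type*} [∀ i, TopologicalSpace (M i)]
    [∀ i, ChartedSpace (E i) (M i)] [∀ i, IsManifold 𝓘(ℝ, E i) ∞ (M i)] :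
    letI : ChartedSpace (∀ i, E i) (∀ i, M i) := piChartedSpace E M
    IsManifold 𝓘(ℝ, ∀ i, E i) ∞ (∀ i, M i) := by
  let : ChartedSpace (∀ i, E i) (∀ i, M i) := piChartedSpace E M
  refine isManifold_of_contDiffOn _ _ _ ?_
  rintro _ _ ⟨e, he, rfl⟩ ⟨e', he', rfl⟩
  rw [contDiffOn_pi]
  intro i
  have h := (contDiffGroupoid ∞ 𝓘(ℝ, E i)).compatible (he i trivial) (he' i trivial)
  rw [contDiffGroupoid, mem_groupoid_of_pregroupoid] at h
  have h1 : ContDiffOn ℝ ∞ ((e i).symm ≫ₕ e' i) ((e i).symm ≫ₕ e' i).source := by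
    simpa [contDiffPregroupoid] using h.1
  refine h1.comp (f := fun x : ∀ i, E i => x i) (ContinuousLinearMap.proj (R := ℝ) (φ := E) i).contDiff.contDiffOn ?_
  rintro x ⟨⟨hx, hx'⟩, -⟩
  exact ⟨hx i trivial, hx' i trivial⟩

lemma contMDiffAt_pi_apply {ι : Type} [Fintype ι] {E : ι → Type} [∀ i, NormedAddCommGroup (E i)]
    [∀ i, NormedSpace ℝ (E i)] {M : ι → Type*} [∀ i, TopologicalSpace (M i)]
    [∀ i, ChartedSpace (E i) (M i)] (i : ι) (y : ∀ i, M i) :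
    letI : ChartedSpace (∀ i, E i) (∀ i, M i) := piChartedSpace E M
    ContMDiffAt 𝓘(ℝ, ∀ i, E i) 𝓘(ℝ, E i) ∞ (fun q : ∀ i, M i => q i) y := by
  let : ChartedSpace (∀ i, E i) (∀ i, M i) := piChartedSpace E M
  rw [contMDiffAt_iff]
  refine ⟨(continuous_apply i).continuousAt, ?_⟩
  refine ((ContinuousLinearMap.proj (R := ℝ) (φ := E) i).contDiff.contDiffAt (x := extChartAt 𝓘(ℝ, ∀ i, E i) y y)
    |>.congr_of_eventuallyEq ?_).contDiffWithinAt
  have hy := (chartAt (∀ i, E i) y).open_target.mem_nhds (mem_chart_target (∀ i, E i) y)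
  filter_upwards [hy] with v hv
  exact (chartAt (E i) (y i)).right_inv (hv i trivial)

lemma contMDiffAt_pi_of {ι : Type} [Fintype ι] {E : ι → Type} [∀ i, NormedAddCommGroup (E i)]
    [∀ i, NormedSpace ℝ (E i)] {M : ι → Type*} [∀ i, TopologicalSpace (M i)]
    [∀ i, ChartedSpace (E i) (M i)] {F N : Type*} [NormedAddCommGroup F] [NormedSpace ℝ F]
    [TopologicalSpace N] [ChartedSpace F N] {f : N → ∀ i, M i} {y : N}
    (hf : ∀ i, ContMDiffAt 𝓘(ℝ, F) 𝓘(ℝ, E i) ∞ (fun x => f x i) y) :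
    letI : ChartedSpace (∀ i, E i) (∀ i, M i) := piChartedSpace E M
    ContMDiffAt 𝓘(ℝ, F) 𝓘(ℝ, ∀ i, E i) ∞ f y := by
  let : ChartedSpace (∀ i, E i) (∀ i, M i) := piChartedSpace E M
  rw [contMDiffAt_iff]
  refine ⟨continuousAt_pi.2 fun i => (hf i).continuousAt, ?_⟩
  rw [contDiffWithinAt_pi]
  intro i
  exact (contMDiffAt_iff.1 (hf i)).2

/-- The product of a finite family of manifolds. -/
noncomputable def pi {ι : Type} [Fintype ι] {Y : ι → Type*} (S : ∀ i, SmoothStr (Y i)) :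
    SmoothStr (∀ i, Y i) where
  E := ∀ i, (S i).E
  top := inferInstanceAs (TopologicalSpace (∀ i, (S i).Carrier))
  charted := piChartedSpace (fun i => (S i).E) (fun i => (S i).Carrier)
  isManifold := isManifold_pi (E := fun i => (S i).E) (M := fun i => (S i).Carrier)
  t2 := inferInstanceAs (T2Space (∀ i, (S i).Carrier))
  secondCountable := inferInstanceAs (SecondCountableTopology (∀ i, (S i).Carrier))

/-- `f` is smooth on a neighbourhood of `x`. -/
def SmoothNear {X Y : Type*} (S : SmoothStr X) (T : SmoothStr Y) (f : X → Y) (x : X) : Prop :=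
  ∀ᶠ y in S.nhd x, ContMDiffAt (M := S.Carrier) (M' := T.Carrier) 𝓘(ℝ, S.E) 𝓘(ℝ, T.E) ∞ f y

section SmoothNear

variable {X Y Z W : Type*} {R : SmoothStr W} {S : SmoothStr X} {T : SmoothStr Y} {U : SmoothStr Z}

lemma isSmooth_iff {X Y : Type u} {S : SmoothStr X} {T : SmoothStr Y} {f : X → Y} :
    S.IsSmooth T f ↔ ∀ x, SmoothNear S T f x :=
  ⟨fun h _ => Eventually.of_forall fun y => h y, fun h x =>
    S.eventually_mem (p := fun y => ContMDiffAt (M := S.Carrier) (M' := T.Carrier)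
      𝓘(ℝ, S.E) 𝓘(ℝ, T.E) ∞ f y) (h x)⟩

lemma SmoothNear.contMDiffAt {f : X → Y} {x : X} (h : SmoothNear S T f x) :
    ContMDiffAt (M := S.Carrier) (M' := T.Carrier) 𝓘(ℝ, S.E) 𝓘(ℝ, T.E) ∞ f x :=
  S.eventually_mem (p := fun y => ContMDiffAt (M := S.Carrier) (M' := T.Carrier)
      𝓘(ℝ, S.E) 𝓘(ℝ, T.E) ∞ f y) h

lemma SmoothNear.tendsto {f : X → Y} {x : X} (h : SmoothNear S T f x) :
    Tendsto f (S.nhd x) (T.nhd (f x)) :=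
  h.contMDiffAt.continuousAt

lemma SmoothNear.eventually {f : X → Y} {x : X} (h : SmoothNear S T f x) :
    ∀ᶠ y in S.nhd x, SmoothNear S T f y :=
  S.eventually_eventually h

lemma SmoothNear.comp {g : Y → Z} {f : X → Y} {x : X} (hg : SmoothNear T U g (f x))
    (hf : SmoothNear S T f x) : SmoothNear S U (fun x => g (f x)) x := by
  filter_upwards [hf, hf.tendsto.eventually hg] with y h1 h2
  exact ContMDiffAt.comp (M := S.Carrier) (M' := T.Carrier) (M'' := U.Carrier) y h2 h1

lemma SmoothNear.congr {f g : X → Y} {x : X} (hf : SmoothNear S T f x)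
    (h : ∀ᶠ y in S.nhd x, f y = g y) : SmoothNear S T g x := by
  filter_upwards [hf, S.eventually_eventually h] with y h1 h2
  exact h1.congr_of_eventuallyEq (h2.mono fun z hz => hz.symm)

lemma smoothNear_id (x : X) : SmoothNear S S (fun x => x) x :=
  Eventually.of_forall fun _ => contMDiffAt_id

lemma smoothNear_const (y : Y) (x : X) : SmoothNear S T (fun _ => y) x :=
  Eventually.of_forall fun _ => contMDiffAt_const

lemma smoothNear_ch (x : X) : SmoothNear S (self S.E) (S.ch x) x := by
  filter_upwards [(chartAt (M := S.Carrier) S.E x).open_source.mem_nhds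
    (mem_chart_source (M := S.Carrier) S.E x)] with y hy
  have := (contMDiffOn_chart (I := 𝓘(ℝ, S.E)) (n := ∞) (M := S.Carrier) (x := x)).contMDiffAt
    ((chartAt (M := S.Carrier) S.E x).open_source.mem_nhds hy)
  exact this

lemma smoothNear_chInv (x : X) : SmoothNear (self S.E) S (S.chInv x) (S.ch x x) := by
  filter_upwards [(chartAt (M := S.Carrier) S.E x).open_target.mem_nhds
    (mem_chart_target (M := S.Carrier) S.E x)] with y hy
  have := (contMDiffOn_chart_symm (I := 𝓘(ℝ, S.E)) (n := ∞) (M := S.Carrier)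
    (x := x)).contMDiffAt ((chartAt (M := S.Carrier) S.E x).open_target.mem_nhds hy)
  exact this

/-- Between normed spaces, smoothness of a germ is smoothness in the sense of calculus. -/
lemma smoothNear_self_iff {V V' : Type} [NormedAddCommGroup V] [NormedSpace ℝ V]
    [FiniteDimensional ℝ V] [NormedAddCommGroup V'] [NormedSpace ℝ V'] [FiniteDimensional ℝ V']
    {f : V → V'} {x : V} :
    SmoothNear (self V) (self V') f x ↔ ∀ᶠ y in 𝓝 x, ContDiffAt ℝ ∞ f y :=
  Filter.eventually_congr (Eventually.of_forall fun _ => contMDiffAt_iff_contDiffAt)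

lemma _root_.ContDiff.smoothNear {V V' : Type} [NormedAddCommGroup V] [NormedSpace ℝ V]
    [FiniteDimensional ℝ V] [NormedAddCommGroup V'] [NormedSpace ℝ V'] [FiniteDimensional ℝ V']
    {f : V → V'} (hf : ContDiff ℝ ∞ f) (x : V) : SmoothNear (self V) (self V') f x :=
  smoothNear_self_iff.2 (Eventually.of_forall fun _ => hf.contDiffAt)

lemma nhd_prod (p : X × Y) : (S.prod T).nhd p = S.nhd p.1 ×ˢ T.nhd p.2 :=
  nhds_prod_eq (X := S.Carrier) (Y := T.Carrier)

lemma smoothNear_fst (p : X × Y) : SmoothNear (S.prod T) S Prod.fst p :=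
  Eventually.of_forall fun y => by
    have := contMDiffAt_fst (I := 𝓘(ℝ, S.E)) (J := 𝓘(ℝ, T.E)) (M := S.Carrier) (N := T.Carrier)
      (n := ∞) (p := y)
    rw [← modelWithCornersSelf_prod] at this
    exact this

lemma smoothNear_snd (p : X × Y) : SmoothNear (S.prod T) T Prod.snd p :=
  Eventually.of_forall fun y => by
    have := contMDiffAt_snd (I := 𝓘(ℝ, S.E)) (J := 𝓘(ℝ, T.E)) (M := S.Carrier) (N := T.Carrier)
      (n := ∞) (p := y)
    rw [← modelWithCornersSelf_prod] at this
    exact this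

lemma SmoothNear.prodMk {f : W → X} {g : W → Y} {w : W} (hf : SmoothNear R S f w)
    (hg : SmoothNear R T g w) : SmoothNear R (S.prod T) (fun w => (f w, g w)) w := by
  filter_upwards [hf, hg] with y h1 h2
  have := ContMDiffAt.prodMk (M := R.Carrier) (M' := S.Carrier) (N' := T.Carrier) h1 h2
  rw [← modelWithCornersSelf_prod] at this
  exact this

section pi

variable {ι : Type} [Fintype ι] {Y : ι → Type*} {T : ∀ i, SmoothStr (Y i)}

lemma nhd_pi (p : ∀ i, Y i) : (pi T).nhd p = Filter.pi fun i => (T i).nhd (p i) :=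
  nhds_pi (A := fun i => (T i).Carrier)

lemma smoothNear_apply (i : ι) (p : ∀ i, Y i) : SmoothNear (pi T) (T i) (fun q => q i) p := by
  refine Eventually.of_forall fun y => ?_
  exact contMDiffAt_pi_apply (E := fun i => (T i).E) (M := fun i => (T i).Carrier) i y

lemma SmoothNear.pi {f : X → ∀ i, Y i} {x : X} (hf : ∀ i, SmoothNear S (T i) (fun x => f x i) x) :
    SmoothNear S (pi T) f x := by
  filter_upwards [eventually_all.2 hf] with y h1
  exact contMDiffAt_pi_of (E := fun i => (T i).E) (M := fun i => (T i).Carrier)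
    (N := S.Carrier) h1

end pi

end SmoothNear

end SmoothStr

namespace SmoothStr

/-! ### Smoothness along a map into an ambient manifold -/

section SmoothAlong

variable {M X Y Z W : Type*}

/-- The map `g` on the set `X` is smooth near `x` when `X` is regarded as a subset of the manifold
`M` by means of `ι`: near `ι x` it extends to a smooth map on `M`. -/
def SmoothAlong (T : SmoothStr M) (ι : X → M) (U : SmoothStr Y) (g : X → Y) (x : X) : Prop :=
  ∃ h : M → Y, SmoothNear T U h (ι x) ∧ ∀ᶠ z in comap ι (T.nhd (ι x)), h (ι z) = g z

variable {R : SmoothStr M} {ι : X → M} {S : SmoothStr X} {T : SmoothStr Y} {U : SmoothStr Z}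

lemma eventually_comap_self {x : X} {p : X → Prop} (h : ∀ᶠ z in comap ι (R.nhd (ι x)), p z) :
    p x := by
  rw [eventually_comap] at h
  exact R.eventually_mem h x rfl

lemma SmoothAlong.tendsto {g : X → Y} {x : X} (hg : SmoothAlong R ι T g x) :
    Tendsto g (comap ι (R.nhd (ι x))) (T.nhd (g x)) := by
  obtain ⟨h, hh, e⟩ := hg
  have e0 : h (ι x) = g x := eventually_comap_self (p := fun z => h (ι z) = g z) e
  rw [← e0]
  exact (hh.tendsto.comp tendsto_comap).congr' e

lemma SmoothAlong.congr {g g' : X → Y} {x : X} (hg : SmoothAlong R ι T g x)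
    (e : ∀ᶠ z in comap ι (R.nhd (ι x)), g z = g' z) : SmoothAlong R ι T g' x := by
  obtain ⟨h, hh, e'⟩ := hg
  exact ⟨h, hh, by filter_upwards [e, e'] with z h1 h2 using h2.trans h1⟩

lemma SmoothNear.comp_along {k : Y → Z} {g : X → Y} {x : X} (hk : SmoothNear T U k (g x))
    (hg : SmoothAlong R ι T g x) : SmoothAlong R ι U (fun x => k (g x)) x := by
  obtain ⟨h, hh, e⟩ := hg
  have e0 : h (ι x) = g x := eventually_comap_self (p := fun z => h (ι z) = g z) e
  rw [← e0] at hk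
  exact ⟨fun m => k (h m), hk.comp hh, e.mono fun z hz => congrArg k hz⟩

lemma smoothAlong_self (x : X) : SmoothAlong R ι R ι x :=
  ⟨fun m => m, smoothNear_id _, Eventually.of_forall fun _ => rfl⟩

lemma SmoothAlong.prodMk {f : X → Y} {g : X → Z} {x : X} (hf : SmoothAlong R ι T f x)
    (hg : SmoothAlong R ι U g x) : SmoothAlong R ι (T.prod U) (fun x => (f x, g x)) x := by
  obtain ⟨h, hh, e⟩ := hf
  obtain ⟨h', hh', e'⟩ := hg
  exact ⟨fun m => (h m, h' m), hh.prodMk hh', by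
    filter_upwards [e, e'] with z h1 h2 using Prod.ext h1 h2⟩

lemma SmoothAlong.pi {κ : Type} [Fintype κ] {Y : κ → Type*} {T : ∀ i, SmoothStr (Y i)}
    {f : X → ∀ i, Y i} {x : X} (hf : ∀ i, SmoothAlong R ι (T i) (fun x => f x i) x) :
    SmoothAlong R ι (SmoothStr.pi T) f x := by
  choose h hh e using hf
  exact ⟨fun m i => h i m, SmoothNear.pi hh, by
    filter_upwards [eventually_all.2 e] with z h1 using funext h1⟩

/-- A smooth map is smooth along the identity, and conversely. -/
lemma smoothAlong_id_iff {g : X → Y} {x : X} :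
    SmoothAlong S (fun x => x) T g x ↔ SmoothNear S T g x := by
  constructor
  · rintro ⟨h, hh, e⟩
    rw [show (fun x : X => x) = id from rfl, comap_id] at e
    exact hh.congr e
  · exact fun h => ⟨g, h, Eventually.of_forall fun _ => rfl⟩

/-- A map that is smooth along `ι`, composed with a smooth plot of `X`, is smooth. -/
lemma SmoothAlong.comp_plot {g : X → Y} {Q : SmoothStr W} {c : W → X} {w : W}
    (hg : SmoothAlong R ι T g (c w)) (hc : SmoothNear Q R (fun w => ι (c w)) w) :
    SmoothNear Q T (fun w => g (c w)) w := by
  obtain ⟨h, hh, e⟩ := hg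
  refine (SmoothNear.comp (f := fun w => ι (c w)) hh hc).congr ?_
  rw [eventually_comap] at e
  filter_upwards [hc.tendsto.eventually e] with z hz using hz _ rfl

/-- A partially defined smooth operation is the restriction of a germ of a smooth map. -/
lemma IsSmoothOp.exists_extension {A B D : Type u} {SA : SmoothStr A} {SB : SmoothStr B}
    {SD : SmoothStr D} {P : A → B → Prop} {op : ∀ x y, P x y → D} (hop : IsSmoothOp SA SB SD P op)
    {a : A} {b : B} (h : P a b) : ∃ F : A × B → D, SmoothNear (SA.prod SB) SD F (a, b) ∧
      ∀ᶠ p in (SA.prod SB).nhd (a, b), ∀ h : P p.1 p.2, F p = op p.1 p.2 h := by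
  obtain ⟨V, hV, hm, F, hF, e⟩ := hop _ _ h
  have hVn : V ∈ (SA.prod SB).nhd (a, b) :=
    IsOpen.mem_nhds (X := SA.Carrier × SB.Carrier) hV hm
  refine ⟨F, ?_, ?_⟩
  · filter_upwards [hVn] with p hp
    have := ContMDiffOn.contMDiffAt (M := SA.Carrier × SB.Carrier) (M' := SD.Carrier)
      (I := 𝓘(ℝ, SA.E).prod 𝓘(ℝ, SB.E)) (I' := 𝓘(ℝ, SD.E)) hF
      (IsOpen.mem_nhds (X := SA.Carrier × SB.Carrier) hV hp)
    rw [← modelWithCornersSelf_prod] at this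
    exact this
  · filter_upwards [hVn] with p hp h using e _ _ h hp

/-- Smoothness along a map is preserved by the partially defined smooth operations. -/
lemma IsSmoothOp.smoothAlong {A B D : Type u} {SA : SmoothStr A} {SB : SmoothStr B}
    {SD : SmoothStr D} {P : A → B → Prop} {op : ∀ x y, P x y → D} (hop : IsSmoothOp SA SB SD P op)
    {b : X → A} {a : X → B} {x : X} (hb : SmoothAlong R ι SA b x) (ha : SmoothAlong R ι SB a x)
    {g : X → D} (hg : ∀ᶠ z in comap ι (R.nhd (ι x)), ∃ h : P (b z) (a z), g z = op (b z) (a z) h) :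
    SmoothAlong R ι SD g x := by
  obtain ⟨h0, -⟩ := eventually_comap_self hg
  obtain ⟨F, hF, e⟩ := hop.exists_extension h0
  have hp := hb.prodMk ha
  refine (SmoothNear.comp_along (g := fun x => (b x, a x)) hF hp).congr ?_
  filter_upwards [hg, hp.tendsto.eventually e] with z ⟨h1, h2⟩ h3
  rw [h2]
  exact h3 h1

/-- The manifold `X` is embedded in the manifold `M` by `ι`; near each point there is a smooth
retraction of `M` onto `X`. -/
structure EmbedsIn (S : SmoothStr X) (R : SmoothStr M) (ι : X → M) : Prop where
  injective : Function.Injective ι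
  smooth : ∀ x, SmoothNear S R ι x
  retraction : ∀ x, SmoothAlong R ι S (fun x => x) x

lemma EmbedsIn.smoothNear (h : EmbedsIn S R ι) {Q : SmoothStr W} {c : W → X} {w : W}
    (hc : SmoothNear Q R (fun w => ι (c w)) w) : SmoothNear Q S c w :=
  (h.retraction (c w)).comp_plot hc

lemma EmbedsIn.smoothAlong (h : EmbedsIn S R ι) {M' : Type*} {R' : SmoothStr M'} {ι' : W → M'}
    {c : W → X} {w : W} (hc : SmoothAlong R' ι' R (fun w => ι (c w)) w) :
    SmoothAlong R' ι' S c w := by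
  obtain ⟨r, hr, e⟩ := h.retraction (c w)
  refine (SmoothNear.comp_along (g := fun w => ι (c w)) hr hc).congr ?_
  rw [eventually_comap] at e
  filter_upwards [hc.tendsto.eventually e] with z hz using hz _ rfl

lemma EmbedsIn.nhd_eq (h : EmbedsIn S R ι) (x : X) : S.nhd x = comap ι (R.nhd (ι x)) :=
  le_antisymm (h.smooth x).tendsto.le_comap (h.retraction x).tendsto

end SmoothAlong

/-! ### The inverse function theorem -/

/-- The inverse function theorem for smooth germs between finite dimensional spaces. -/
lemma exists_local_inverse_of_hasFDerivAt {V V' : Type} [NormedAddCommGroup V] [NormedSpace ℝ V]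
    [FiniteDimensional ℝ V] [NormedAddCommGroup V'] [NormedSpace ℝ V'] [FiniteDimensional ℝ V']
    {f : V → V'} {a : V} (hf : SmoothNear (self V) (self V') f a) (e : V ≃L[ℝ] V')
    (he : HasFDerivAt f (e : V →L[ℝ] V') a) :
    ∃ k : V' → V, SmoothNear (self V') (self V) k (f a) ∧ (∀ᶠ x in 𝓝 a, k (f x) = x) ∧
      ∀ᶠ y in 𝓝 (f a), f (k y) = y := by
  have hc : CompleteSpace V := FiniteDimensional.complete ℝ V
  rw [smoothNear_self_iff] at hf
  have h0 := hf.self_of_nhds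
  have hs := h0.mem_toOpenPartialHomeomorph_source he (by simp)
  have ht := h0.image_mem_toOpenPartialHomeomorph_target he (by simp)
  have hcoe := h0.toOpenPartialHomeomorph_coe he (by simp)
  generalize h0.toOpenPartialHomeomorph f he (by simp) = φ at hs ht hcoe
  subst hcoe
  refine ⟨φ.symm, ?_, ?_, ?_⟩
  · rw [smoothNear_self_iff]
    -- the derivative stays invertible near `a`, so that the inverse is smooth near `f a`
    have hinv : ∀ᶠ x in 𝓝 a, ∃ e' : V ≃L[ℝ] V', HasFDerivAt φ (e' : V →L[ℝ] V') x := by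
      have hcont : ContinuousAt (fderiv ℝ φ) a :=
        (h0.fderiv_right (m := 0) (by simp)).continuousAt
      have := hcont.eventually (by
        rw [he.fderiv]
        exact ContinuousLinearEquiv.nhds e)
      filter_upwards [this, hf] with x ⟨e', he'⟩ hx
      refine ⟨e', ?_⟩
      rw [he']
      exact (hx.differentiableAt (by simp)).hasFDerivAt
    have hcs : Tendsto φ.symm (𝓝 (φ a)) (𝓝 a) := by
      have := φ.continuousAt_symm ht
      rwa [ContinuousAt, φ.left_inv hs] at this
    filter_upwards [φ.open_target.mem_nhds ht, hcs.eventually hinv, hcs.eventually hf]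
      with y hy ⟨e', he'⟩ hy2
    exact φ.contDiffAt_symm hy he' hy2
  · filter_upwards [φ.open_source.mem_nhds hs] with x hx using φ.left_inv hx
  · filter_upwards [φ.open_target.mem_nhds ht] with x hx using φ.right_inv hx

section diff

variable {X Y Z W : Type u} {R : SmoothStr W} {S : SmoothStr X} {T : SmoothStr Y} {U : SmoothStr Z}

/-- The differential is the derivative in the charts. -/
lemma SmoothNear.hasFDerivAt_diff {f : X → Y} {x : X} (hf : SmoothNear S T f x) :
    HasFDerivAt (fun v => T.ch (f x) (f (S.chInv x v))) (S.diff T f x) (S.ch x x) := by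
  have h1 : HasFDerivWithinAt (fun v => T.ch (f x) (f (S.chInv x v))) (S.diff T f x)
      (Set.range 𝓘(ℝ, S.E)) (S.ch x x) :=
    (hf.contMDiffAt.mdifferentiableAt (by simp)).hasMFDerivAt.2
  rw [ModelWithCorners.range_eq_univ, hasFDerivWithinAt_univ] at h1
  exact h1

lemma diff_comp {g : Y → Z} {f : X → Y} {x : X} (hg : SmoothNear T U g (f x))
    (hf : SmoothNear S T f x) (v : S.E) :
    S.diff U (fun x => g (f x)) x v = T.diff U g (f x) (S.diff T f x v) := by
  have := mfderiv_comp (M := S.Carrier) (M' := T.Carrier) (M'' := U.Carrier) x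
    (hg.contMDiffAt.mdifferentiableAt (by simp)) (hf.contMDiffAt.mdifferentiableAt (by simp))
  exact DFunLike.congr_fun this v

lemma diff_congr {f g : X → Y} {x : X} (h : ∀ᶠ y in S.nhd x, f y = g y) :
    S.diff T f x = S.diff T g x :=
  Filter.EventuallyEq.mfderiv_eq (M := S.Carrier) (M' := T.Carrier) h

lemma diff_id (x : X) (v : S.E) : S.diff S (fun x => x) x v = v :=
  DFunLike.congr_fun (mfderiv_id (M := S.Carrier) (x := x) (I := 𝓘(ℝ, S.E))) v

lemma diff_prodMk {f : W → X} {g : W → Y} {w : W} (hf : SmoothNear R S f w)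
    (hg : SmoothNear R T g w) (v : R.E) :
    R.diff (S.prod T) (fun w => (f w, g w)) w v = (R.diff S f w v, R.diff T g w v) := by
  have h := (hf.prodMk hg).hasFDerivAt_diff
  have h' := hf.hasFDerivAt_diff.prodMk hg.hasFDerivAt_diff
  exact DFunLike.congr_fun (h.unique h') v

/-- A smooth map between manifolds of equal dimension whose differential at `x` is injective is
invertible near `x`. -/
lemma SmoothNear.exists_local_inverse {f : X → Y} {x : X} (hf : SmoothNear S T f x)
    (hinj : ∀ v, S.diff T f x v = 0 → v = 0)
    (hdim : Module.finrank ℝ S.E = Module.finrank ℝ T.E) :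
    ∃ k : Y → X, SmoothNear T S k (f x) ∧ (∀ᶠ z in S.nhd x, k (f z) = z) ∧
      ∀ᶠ y in T.nhd (f x), f (k y) = y := by
  have hd := hf.hasFDerivAt_diff
  let e : S.E ≃L[ℝ] T.E := (LinearEquiv.ofInjectiveOfFinrankEq (S.diff T f x : S.E →ₗ[ℝ] T.E)
    ((injective_iff_map_eq_zero _).2 hinj) hdim).toContinuousLinearEquiv
  have he : (e : S.E →L[ℝ] T.E) = S.diff T f x := by ext v; rfl
  rw [← he] at hd
  have hfx : f (S.chInv x (S.ch x x)) = f x := by rw [chInv_ch_self]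
  have hsm : SmoothNear (self S.E) (self T.E) (fun v => T.ch (f x) (f (S.chInv x v)))
      (S.ch x x) := by
    refine SmoothNear.comp (T := T) (g := T.ch (f x)) (f := fun v => f (S.chInv x v)) ?_ ?_
    · rw [hfx]; exact smoothNear_ch _
    · refine SmoothNear.comp (T := S) ?_ (smoothNear_chInv x)
      rwa [chInv_ch_self]
  obtain ⟨k, hk, hk1, hk2⟩ := exists_local_inverse_of_hasFDerivAt hsm e hd
  simp only [hfx] at hk hk2
  have hk0 : k (T.ch (f x) (f x)) = S.ch x x := by simpa only [hfx] using hk1.self_of_nhds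
  have hkc : SmoothNear T (self S.E) (fun y => k (T.ch (f x) y)) (f x) :=
    SmoothNear.comp (T := self T.E) hk (smoothNear_ch _)
  have hkk : SmoothNear T S (fun y => S.chInv x (k (T.ch (f x) y))) (f x) := by
    refine SmoothNear.comp (T := self S.E) ?_ hkc
    rw [hk0]
    exact smoothNear_chInv x
  have hkk0 : S.chInv x (k (T.ch (f x) (f x))) = x := by rw [hk0, chInv_ch_self]
  refine ⟨fun y => S.chInv x (k (T.ch (f x) y)), hkk, ?_, ?_⟩
  · filter_upwards [S.eventually_chInv_ch x, (smoothNear_ch x).tendsto.eventually hk1] with z h1 h2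
    rw [h1] at h2
    rw [h2, h1]
  · have hft : Tendsto (fun y => f (S.chInv x (k (T.ch (f x) y)))) (T.nhd (f x)) (T.nhd (f x)) := by
      have := (SmoothNear.comp (g := f) (by rwa [hkk0]) hkk).tendsto
      rwa [hkk0] at this
    filter_upwards [T.eventually_chInv_ch (f x), (smoothNear_ch (f x)).tendsto.eventually hk2,
      hft.eventually (T.eventually_chInv_ch (f x))] with y h1 h2 h3
    rw [h2, h1] at h3
    exact h3.symm

end diff

end SmoothStr

namespace SmoothStr

/-! ### Embeddings into finite products -/

section NormedSpace

variable {X : Type*} {S : SmoothStr X} {V V' : Type} [NormedAddCommGroup V] [NormedSpace ℝ V]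
  [FiniteDimensional ℝ V] [NormedAddCommGroup V'] [NormedSpace ℝ V'] [FiniteDimensional ℝ V']

lemma SmoothNear.prodMk_self {f : X → V} {g : X → V'} {x : X} (hf : SmoothNear S (self V) f x)
    (hg : SmoothNear S (self V') g x) :
    SmoothNear S (self (V × V')) (fun x => (f x, g x)) x := by
  filter_upwards [hf, hg] with y h1 h2
  exact ContMDiffAt.prodMk_space (M := S.Carrier) (E' := V) (F' := V') h1 h2

lemma SmoothNear.pi_self {ι : Type} [Fintype ι] {E : ι → Type} [∀ i, NormedAddCommGroup (E i)]
    [∀ i, NormedSpace ℝ (E i)] [∀ i, FiniteDimensional ℝ (E i)] {f : X → ∀ i, E i} {x : X}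
    (hf : ∀ i, SmoothNear S (self (E i)) (fun x => f x i) x) :
    SmoothNear S (self (∀ i, E i)) f x := by
  filter_upwards [eventually_all.2 hf] with y h1
  exact (contMDiffAt_pi_space (M := S.Carrier) (Fi := E)).2 h1

end NormedSpace

section Family

variable {X Y W : Type u} {S : SmoothStr X}

lemma diff_pi {ι : Type} [Fintype ι] {Y : ι → Type u} {T : ∀ i, SmoothStr (Y i)}
    {f : X → ∀ i, Y i} {x : X} (hf : ∀ i, SmoothNear S (T i) (fun x => f x i) x) (v : S.E) :
    S.diff (pi T) f x v = fun i => S.diff (T i) (fun x => f x i) x v := by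
  have h := (SmoothNear.pi hf).hasFDerivAt_diff
  have h' := hasFDerivAt_pi.2 fun i => (hf i).hasFDerivAt_diff
  exact DFunLike.congr_fun (h.unique h') v

/-- The map into the product of a family of manifolds. -/
def tuple {ι : Type} (φ : ι → MapToManifold X) (x : X) : ∀ i, (φ i).Y := fun i => (φ i).toFun x

variable {ι : Type} [Fintype ι] {φ : ι → MapToManifold X}

/-- An embedding into a finite product, as defined by injectivity, topology and differential, admits
local smooth retractions. By the inverse function theorem, a linear left inverse of the differential
of the tuple, read in charts, becomes such a retraction after a change of coordinates. -/
lemma IsEmbeddingInProduct.embedsIn (h : S.IsEmbeddingInProduct φ) :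
    EmbedsIn S (pi fun i => (φ i).str) (tuple φ) := by
  have hs (i : ι) (x : X) : SmoothNear S (φ i).str (φ i).toFun x := isSmooth_iff.1 (h.smooth i) x
  refine ⟨fun x y hxy => h.injective x y fun i => congrFun hxy i, fun x => SmoothNear.pi
    fun i => hs i x, fun x => ?_⟩
  let D : S.E →L[ℝ] ∀ i, (φ i).str.E :=
    ContinuousLinearMap.pi fun i => S.diff (φ i).str (φ i).toFun x
  have hD : LinearMap.ker (D : S.E →ₗ[ℝ] ∀ i, (φ i).str.E) = ⊥ := by
    refine (LinearMap.ker_eq_bot').2 fun v hv => h.immersion x v fun i => congrFun hv i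
  obtain ⟨L0, hL0⟩ := LinearMap.exists_leftInverse_of_injective _ hD
  -- `L` is a linear left inverse of the differential `D`, `κ` is the tuple read in charts, and `k` is
  -- the local inverse of `L ∘ κ`
  let L : (∀ i, (φ i).str.E) →L[ℝ] S.E := LinearMap.toContinuousLinearMap L0
  have hLD : L.comp D = ContinuousLinearMap.id ℝ S.E := by
    ext v
    exact LinearMap.congr_fun hL0 v
  let κ : X → ∀ i, (φ i).str.E := fun z i => (φ i).str.ch ((φ i).toFun x) ((φ i).toFun z)
  have hder : HasFDerivAt (fun v => L (κ (S.chInv x v)))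
      ((ContinuousLinearEquiv.refl ℝ S.E : S.E ≃L[ℝ] S.E) : S.E →L[ℝ] S.E) (S.ch x x) := by
    have h1 : HasFDerivAt (fun v => κ (S.chInv x v)) D (S.ch x x) :=
      hasFDerivAt_pi.2 fun i => (hs i x).hasFDerivAt_diff
    have h2 := L.hasFDerivAt.comp (S.ch x x) h1
    rw [hLD] at h2
    exact h2
  let K : (∀ i, (φ i).Y) → ∀ i, (φ i).str.E := fun m i => (φ i).str.ch ((φ i).toFun x) (m i)
  have hK : SmoothNear (pi fun i => (φ i).str) (self S.E) (fun m => L (K m)) (tuple φ x) := by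
    refine SmoothNear.comp (T := self (∀ i, (φ i).str.E)) (g := L) (f := K)
      (L.contDiff.smoothNear _) ?_
    exact SmoothNear.pi_self (S := pi fun i => (φ i).str) (E := fun i => (φ i).str.E) fun i =>
      SmoothNear.comp (T := (φ i).str) (g := (φ i).str.ch ((φ i).toFun x))
        (smoothNear_ch _) (smoothNear_apply i _)
  have hκ : SmoothNear (self S.E) (self S.E) (fun v => L (κ (S.chInv x v))) (S.ch x x) := by
    refine SmoothNear.comp (T := pi fun i => (φ i).str) (g := fun m => L (K m))
      (f := fun v => tuple φ (S.chInv x v)) ?_ ?_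
    · rwa [chInv_ch_self]
    · refine SmoothNear.pi fun i => SmoothNear.comp (g := (φ i).toFun) ?_ (smoothNear_chInv x)
      exact hs i _
  obtain ⟨k, hk, hk1, -⟩ := exists_local_inverse_of_hasFDerivAt hκ _ hder
  have hk0 := hk1.self_of_nhds
  simp only [chInv_ch_self] at hk hk0
  refine ⟨fun m => S.chInv x (k (L (K m))), ?_, ?_⟩
  · refine SmoothNear.comp (T := self S.E) (g := S.chInv x) (f := fun m => k (L (K m))) ?_ ?_
    · have : k (L (K (tuple φ x))) = S.ch x x := hk0
      rw [this]
      exact smoothNear_chInv x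
    · exact SmoothNear.comp (T := self S.E) (g := k) (f := fun m => L (K m)) hk hK
  · have hn : comap (tuple φ) ((pi fun i => (φ i).str).nhd (tuple φ x)) = S.nhd x := by
      have h1 : S.nhd x = @nhds X S.top x := rfl
      rw [h1, h.top_eq, nhds_iInf, nhd_pi, Filter.pi, comap_iInf]
      refine iInf_congr fun i => ?_
      rw [comap_comap, @nhds_induced _ _ (φ i).str.top]
      rfl
    rw [hn]
    filter_upwards [S.eventually_chInv_ch x, (smoothNear_ch x).tendsto.eventually hk1] with z h1 h2
    rw [h1] at h2
    have h3 : k (L (K (tuple φ z))) = S.ch x z := h2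
    rw [h3, h1]

/-- Conversely, local smooth retractions give an embedding into the product. -/
lemma EmbedsIn.isEmbeddingInProduct (h : EmbedsIn S (pi fun i => (φ i).str) (tuple φ)) :
    S.IsEmbeddingInProduct φ where
  injective x y hxy := h.injective (funext hxy)
  smooth i := isSmooth_iff.2 fun x =>
    SmoothNear.comp (T := pi fun i => (φ i).str) (smoothNear_apply i _) (h.smooth x)
  top_eq := by
    refine TopologicalSpace.ext_nhds fun x => ?_
    have h1 := h.nhd_eq x
    rw [nhds_iInf]
    rw [nhd_pi, Filter.pi, comap_iInf] at h1
    refine h1.trans (iInf_congr fun i => ?_)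
    rw [comap_comap, @nhds_induced _ _ (φ i).str.top]
    rfl
  immersion x v hv := by
    obtain ⟨r, hr, e⟩ := h.retraction x
    rw [← h.nhd_eq] at e
    have hs (i : ι) : SmoothNear S (φ i).str (fun x => tuple φ x i) x :=
      SmoothNear.comp (T := pi fun i => (φ i).str) (smoothNear_apply i _) (h.smooth x)
    have h1 := diff_comp (f := tuple φ) hr (h.smooth x) v
    rw [diff_congr e, diff_id, diff_pi hs] at h1
    have h2 : (fun i => S.diff (φ i).str (fun x => tuple φ x i) x v) = 0 := funext hv
    rw [h1, h2]
    exact map_zero _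

end Family

/-! ### Submersions and local sections -/

/-- The map `f` has a smooth local section through `x`. -/
def HasSection {X Y : Type*} (S : SmoothStr X) (T : SmoothStr Y) (f : X → Y) (x : X) : Prop :=
  ∃ s : Y → X, SmoothNear T S s (f x) ∧ s (f x) = x ∧ ∀ᶠ y in T.nhd (f x), f (s y) = y

/-- A homeomorphism between open sets, from two maps that are inverse to one another near a point
and its image. -/
lemma exists_openPartialHomeomorph {X Y : Type*} [TopologicalSpace X] [TopologicalSpace Y]
    {f : X → Y} {k : Y → X} {x : X} {A : Set X} {B : Set Y} (hA : IsOpen A) (hB : IsOpen B)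
    (hx : x ∈ A) (hfx : f x ∈ B) (hf : ContinuousOn f A) (hk : ContinuousOn k B)
    (hkf : ∀ z ∈ A, f z ∈ B → k (f z) = z) (hfk : ∀ y ∈ B, f (k y) = y) :
    ∃ e : OpenPartialHomeomorph X Y, x ∈ e.source ∧ e.source ⊆ A ∧ e.target ⊆ B ∧
      (e : X → Y) = f ∧ (e.symm : Y → X) = k :=
  ⟨{ toFun := f
     invFun := k
     source := A ∩ f ⁻¹' B
     target := B ∩ k ⁻¹' A
     map_source' := fun z hz => ⟨hz.2, by
       simpa only [Set.mem_preimage, hkf z hz.1 hz.2] using hz.1⟩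
     map_target' := fun y hy => ⟨hy.2, by simpa only [Set.mem_preimage, hfk y hy.1] using hy.1⟩
     left_inv' := fun z hz => hkf z hz.1 hz.2
     right_inv' := fun y hy => hfk y hy.1
     open_source := hf.isOpen_inter_preimage hA hB
     open_target := hk.isOpen_inter_preimage hB hA
     continuousOn_toFun := hf.mono Set.inter_subset_left
     continuousOn_invFun := hk.mono Set.inter_subset_left }, ⟨hx, hfx⟩, Set.inter_subset_left,
    Set.inter_subset_left, rfl, rfl⟩

section Submersion

variable {X Y Z : Type u} {S : SmoothStr X} {T : SmoothStr Y} {U : SmoothStr Z}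

/-- The differential of a map with a smooth local section has a linear right inverse, the
differential of the section. -/
lemma exists_diff_rightInverse_of_hasSection {f : X → Y} {x : X} (hf : SmoothNear S T f x)
    (hs : HasSection S T f x) : ∃ B : T.E →ₗ[ℝ] S.E, ∀ v, S.diff T f x (B v) = v := by
  obtain ⟨s, hs, hs0, e⟩ := hs
  refine ⟨(T.diff S s (f x) : T.E →ₗ[ℝ] S.E), fun v => ?_⟩
  have h1 := diff_comp (f := s) (g := f) (by rwa [hs0]) hs v
  rw [diff_congr e, diff_id, hs0] at h1
  exact h1.symm

/-- The local normal form of a smooth map with a local section: near `x` it is the first projection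
of a product of the target with a vector space. -/
lemma exists_normal_form {f : X → Y} {x : X} (hf : SmoothNear S T f x)
    (hs : HasSection S T f x) :
    Module.finrank ℝ T.E ≤ Module.finrank ℝ S.E ∧
    ∃ (π : X → (Fin (Module.finrank ℝ S.E - Module.finrank ℝ T.E) → ℝ))
      (σ : Y × (Fin (Module.finrank ℝ S.E - Module.finrank ℝ T.E) → ℝ) → X),
      SmoothNear S (self _) π x ∧ SmoothNear (T.prod (self _)) S σ (f x, π x) ∧
      (∀ᶠ z in S.nhd x, σ (f z, π z) = z) ∧
      ∀ᶠ p in (T.prod (self _)).nhd (f x, π x), f (σ p) = p.1 ∧ π (σ p) = p.2 := by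
  obtain ⟨B, hB⟩ := exists_diff_rightInverse_of_hasSection hf hs
  let A : S.E →ₗ[ℝ] T.E := (S.diff T f x : S.E →ₗ[ℝ] T.E)
  have hAB : ∀ v, A (B v) = v := hB
  have hAs : Function.Surjective A := fun v => ⟨B v, hAB v⟩
  have hle : Module.finrank ℝ T.E ≤ Module.finrank ℝ S.E :=
    LinearMap.finrank_le_finrank_of_surjective hAs
  refine ⟨hle, ?_⟩
  have hker : Module.finrank ℝ (LinearMap.ker A) =
      Module.finrank ℝ (Fin (Module.finrank ℝ S.E - Module.finrank ℝ T.E) → ℝ) := by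
    have h1 := A.finrank_range_add_finrank_ker
    rw [LinearMap.range_eq_top.2 hAs, finrank_top] at h1
    rw [Module.finrank_fin_fun]
    omega
  generalize Module.finrank ℝ S.E - Module.finrank ℝ T.E = d at hker
  -- `L v = (A v, v - B (A v))` is an isomorphism of the source with the product of the target and the
  -- kernel of the differential `A`; it is the derivative of `z ↦ (f z, π z)` read in charts
  let κ := LinearEquiv.ofFinrankEq _ _ hker
  let q : S.E →ₗ[ℝ] LinearMap.ker A :=
    LinearMap.codRestrict (LinearMap.ker A) (LinearMap.id - B.comp A) fun v => by
      simp [hAB]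
  let L0 : S.E →ₗ[ℝ] T.E × (Fin d → ℝ) := A.prod (κ.toLinearMap.comp q)
  have hinj : Function.Injective L0 := by
    rw [injective_iff_map_eq_zero]
    intro v hv
    have h1 : A v = 0 := congrArg Prod.fst hv
    have h2 : κ (q v) = 0 := congrArg Prod.snd hv
    rw [LinearEquiv.map_eq_zero_iff] at h2
    have h3 : v - B (A v) = 0 := congrArg Subtype.val h2
    rwa [h1, map_zero, sub_zero] at h3
  have hdim : Module.finrank ℝ S.E = Module.finrank ℝ (T.E × (Fin d → ℝ)) := by
    have h1 := A.finrank_range_add_finrank_ker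
    rw [LinearMap.range_eq_top.2 hAs, finrank_top, hker] at h1
    rw [Module.finrank_prod, h1]
  let L : S.E ≃L[ℝ] T.E × (Fin d → ℝ) :=
    (LinearEquiv.ofInjectiveOfFinrankEq L0 hinj hdim).toContinuousLinearEquiv
  let π0 : S.E →L[ℝ] (Fin d → ℝ) := LinearMap.toContinuousLinearMap (κ.toLinearMap.comp q)
  let f' : S.E → T.E := fun v => T.ch (f x) (f (S.chInv x v))
  have hder : HasFDerivAt (fun v => (f' v, π0 v)) (L : S.E →L[ℝ] T.E × (Fin d → ℝ))
      (S.ch x x) := hf.hasFDerivAt_diff.prodMk π0.hasFDerivAt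
  have hfx : f (S.chInv x (S.ch x x)) = f x := by rw [chInv_ch_self]
  have hf' : SmoothNear (self S.E) (self T.E) f' (S.ch x x) := by
    refine SmoothNear.comp (T := T) (g := T.ch (f x)) (f := fun v => f (S.chInv x v)) ?_ ?_
    · rw [hfx]; exact smoothNear_ch _
    · refine SmoothNear.comp (T := S) ?_ (smoothNear_chInv x)
      rwa [chInv_ch_self]
  have hH : SmoothNear (self S.E) (self (T.E × (Fin d → ℝ))) (fun v => (f' v, π0 v))
      (S.ch x x) := by
    rw [smoothNear_self_iff] at hf' ⊢
    exact hf'.mono fun v hv => hv.prodMk π0.contDiff.contDiffAt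
  obtain ⟨k, hk, hk1, hk2⟩ := exists_local_inverse_of_hasFDerivAt hH L hder
  have hk0 := hk1.self_of_nhds
  simp only [f', hfx] at hk hk0 hk2
  let π : X → (Fin d → ℝ) := fun z => π0 (S.ch x z)
  let σ : Y × (Fin d → ℝ) → X := fun p => S.chInv x (k (T.ch (f x) p.1, p.2))
  have hch : SmoothNear (T.prod (self (Fin d → ℝ))) (self (T.E × (Fin d → ℝ)))
      (fun p => (T.ch (f x) p.1, p.2)) (f x, π x) := by
    have h1 : SmoothNear (T.prod (self (Fin d → ℝ))) (self T.E) (fun p => T.ch (f x) p.1)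
        (f x, π x) := SmoothNear.comp (g := T.ch (f x)) (smoothNear_ch _) (smoothNear_fst _)
    have h2 : SmoothNear (T.prod (self (Fin d → ℝ))) (self (Fin d → ℝ)) (fun p => p.2)
        (f x, π x) := smoothNear_snd _
    exact h1.prodMk_self h2
  have hσ : SmoothNear (T.prod (self (Fin d → ℝ))) S σ (f x, π x) := by
    refine SmoothNear.comp (T := self S.E) (g := S.chInv x)
      (f := fun p : Y × (Fin d → ℝ) => k (T.ch (f x) p.1, p.2)) ?_ ?_
    · have : k (T.ch (f x) (f x), π x) = S.ch x x := hk0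
      rw [this]
      exact smoothNear_chInv x
    · exact SmoothNear.comp (T := self (T.E × (Fin d → ℝ))) (g := k) hk hch
  have hσ0 : σ (f x, π x) = x := by
    have : k (T.ch (f x) (f x), π x) = S.ch x x := hk0
    change S.chInv x (k (T.ch (f x) (f x), π x)) = x
    rw [this, chInv_ch_self]
  refine ⟨π, σ, ?_, hσ, ?_, ?_⟩
  · exact SmoothNear.comp (T := self S.E) (g := π0) (π0.contDiff.smoothNear _) (smoothNear_ch x)
  · filter_upwards [S.eventually_chInv_ch x, (smoothNear_ch x).tendsto.eventually hk1] with z h1 h2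
    simp only [f', h1] at h2
    change S.chInv x (k (T.ch (f x) (f z), π0 (S.ch x z))) = z
    rw [h2, h1]
  · have h1 : Tendsto (fun p => f (σ p)) ((T.prod (self (Fin d → ℝ))).nhd (f x, π x))
        (T.nhd (f x)) := by
      have h2 : SmoothNear (T.prod (self (Fin d → ℝ))) T (fun p => f (σ p)) (f x, π x) :=
        SmoothNear.comp (by rwa [hσ0]) hσ
      have h3 := h2.tendsto
      rwa [hσ0] at h3
    have h2 : Tendsto (fun p : Y × (Fin d → ℝ) => p.1)
        ((T.prod (self (Fin d → ℝ))).nhd (f x, π x)) (T.nhd (f x)) := (smoothNear_fst _).tendsto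
    have h3 : SmoothNear (T.prod (self (Fin d → ℝ))) (self S.E)
        (fun p => k (T.ch (f x) p.1, p.2)) (f x, π x) :=
      SmoothNear.comp (T := self (T.E × (Fin d → ℝ))) (g := k) hk hch
    have h4 := h3.tendsto
    have h5 : k (T.ch (f x) (f x), π x) = S.ch x x := hk0
    simp only [h5] at h4
    filter_upwards [h1.eventually (T.eventually_chInv_ch (f x)),
      h2.eventually (T.eventually_chInv_ch (f x)), hch.tendsto.eventually hk2,
      h4.eventually (S.eventually_ch_chInv x)] with p e1 e2 e3 e4
    have e5 : T.ch (f x) (f (σ p)) = T.ch (f x) p.1 := congrArg Prod.fst e3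
    have e6 : π0 (k (T.ch (f x) p.1, p.2)) = p.2 := congrArg Prod.snd e3
    refine ⟨by rw [← e1, e5, e2], ?_⟩
    change π0 (S.ch x (S.chInv x (k (T.ch (f x) p.1, p.2)))) = p.2
    rw [e4, e6]

end Submersion

end SmoothStr

namespace SmoothStr

section Submersion

variable {X Y Z : Type u} {S : SmoothStr X} {T : SmoothStr Y} {U : SmoothStr Z}

/-- A submersion in normal form has the slices of its charts as local sections. -/
lemma hasSection_of_isSubmersionAt {f : X → Y} {x : X}
    (h : Manifold.IsSubmersionAt (M := S.Carrier) (N := T.Carrier) 𝓘(ℝ, S.E) 𝓘(ℝ, T.E) ∞ f x) :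
    HasSection S T f x := by
  obtain ⟨F, _, _, h⟩ := h
  let φ := h.domChart
  let ψ := h.codChart
  let e := h.equiv
  have hx : x ∈ φ.source := h.mem_domChart_source
  have hfx : f x ∈ ψ.source := h.mem_codChart_source
  have hφ := h.domChart_mem_maximalAtlas
  have hψ := h.codChart_mem_maximalAtlas
  have hw : ∀ v ∈ φ.target, ψ (f (φ.symm v)) = (e v).1 := fun v hv =>
    h.writtenInCharts (by simpa using hv)
  have hsrc : ∀ z ∈ φ.source, f z ∈ ψ.source := fun z hz => h.source_subset_preimage_source hz
  let t : T.Carrier → S.E := fun y => e.symm (ψ y, (e (φ x)).2)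
  have ht0 : t (f x) = φ x := by
    have h1 := hw (φ x) (φ.map_source hx)
    rw [φ.left_inv hx] at h1
    change e.symm (ψ (f x), (e (φ x)).2) = φ x
    rw [h1]
    exact e.symm_apply_apply _
  have ht (y : T.Carrier) (hy : y ∈ ψ.source) :
      ContMDiffAt 𝓘(ℝ, T.E) 𝓘(ℝ, S.E) ∞ t y := by
    have h1 : ContMDiffAt 𝓘(ℝ, T.E) 𝓘(ℝ, T.E) ∞ ψ y :=
      contMDiffAt_of_mem_maximalAtlas hψ hy
    have h2 : ContDiff ℝ ∞ (fun v : T.E => e.symm (v, (e (φ x)).2)) :=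
      e.symm.contDiff.comp (contDiff_prodMk_left _)
    exact h2.contMDiff.contMDiffAt.comp y h1
  have hts : ContinuousAt t (f x) := (ht _ hfx).continuousAt
  have hmem : ∀ᶠ y in @nhds T.Carrier _ (f x), y ∈ ψ.source ∧ t y ∈ φ.target := by
    refine Filter.Eventually.and (ψ.open_source.mem_nhds hfx) (hts.eventually ?_)
    have h3 : φ.target ∈ 𝓝 (t (f x)) := by
      rw [ht0]
      exact φ.open_target.mem_nhds (φ.map_source hx)
    exact h3
  refine ⟨fun y => φ.symm (t y), ?_, ?_, ?_⟩
  · filter_upwards [hmem] with y ⟨h1, h2⟩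
    exact ContMDiffAt.comp (M := T.Carrier) (M'' := S.Carrier) y
      (contMDiffAt_symm_of_mem_maximalAtlas hφ h2) (ht y h1)
  · change φ.symm (t (f x)) = x
    rw [ht0, φ.left_inv hx]
  · filter_upwards [hmem] with y ⟨h1, h2⟩
    have h3 := hw _ h2
    refine ψ.injOn (hsrc _ (φ.map_target h2)) h1 (h3.trans ?_)
    exact congrArg Prod.fst (e.apply_symm_apply _)

/-- A smooth map with local sections through all points is a submersion. -/
lemma isSubmersionAtOfComplement_of_hasSection {f : X → Y} {x : X} (hf : SmoothNear S T f x)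
    (hs : HasSection S T f x) : Manifold.IsSubmersionAtOfComplement (M := S.Carrier)
      (N := T.Carrier) (Fin (Module.finrank ℝ S.E - Module.finrank ℝ T.E) → ℝ)
      𝓘(ℝ, S.E) 𝓘(ℝ, T.E) ∞ f x := by
  obtain ⟨hle, π, σ, hπ, hσ, h1, h2⟩ := exists_normal_form hf hs
  have hdim : Module.finrank ℝ (T.E × (Fin (Module.finrank ℝ S.E - Module.finrank ℝ T.E) → ℝ)) =
      Module.finrank ℝ S.E := by
    rw [Module.finrank_prod, Module.finrank_fin_fun]
    omega
  generalize Module.finrank ℝ S.E - Module.finrank ℝ T.E = d at *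
  let e : S.E ≃L[ℝ] T.E × (Fin d → ℝ) :=
    (LinearEquiv.ofFinrankEq _ _ hdim.symm).toContinuousLinearEquiv
  -- the chart of the normal form, and its inverse
  let F : X → S.E := fun z => e.symm (T.ch (f x) (f z), π z)
  let K : S.E → X := fun v => σ (T.chInv (f x) (e v).1, (e v).2)
  have hF : SmoothNear S (self S.E) F x := by
    refine SmoothNear.comp (T := self (T.E × (Fin d → ℝ))) (g := e.symm)
      (f := fun z => (T.ch (f x) (f z), π z)) (e.symm.contDiff.smoothNear _) ?_
    exact SmoothNear.prodMk_self (SmoothNear.comp (smoothNear_ch _) hf) hπ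
  have hF0 : e (F x) = (T.ch (f x) (f x), π x) := e.apply_symm_apply _
  have hK1 : SmoothNear (self S.E) (T.prod (self (Fin d → ℝ)))
      (fun v => (T.chInv (f x) (e v).1, (e v).2)) (F x) := by
    refine SmoothNear.prodMk ?_ ?_
    · refine SmoothNear.comp (T := self T.E) (g := T.chInv (f x)) (f := fun v => (e v).1) ?_
        (ContDiff.smoothNear (contDiff_fst.comp e.contDiff) _)
      rw [hF0]
      exact smoothNear_chInv _
    · exact ContDiff.smoothNear (contDiff_snd.comp e.contDiff) _
  have hK0 : (T.chInv (f x) (e (F x)).1, (e (F x)).2) = (f x, π x) := by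
    rw [hF0, chInv_ch_self]
  have hK : SmoothNear (self S.E) S K (F x) :=
    SmoothNear.comp (g := σ) (by rwa [hK0]) hK1
  have hKF : ∀ᶠ z in S.nhd x, K (F z) = z := by
    filter_upwards [h1, hf.tendsto.eventually (T.eventually_chInv_ch (f x))] with z e1 e2
    have : e (F z) = (T.ch (f x) (f z), π z) := e.apply_symm_apply _
    change σ (T.chInv (f x) (e (F z)).1, (e (F z)).2) = z
    rw [this, e2, e1]
  have hFK : ∀ᶠ v in 𝓝 (F x), F (K v) = v := by
    have h3 := hK1.tendsto
    rw [hK0] at h3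
    have h4 : Tendsto (fun v => (e v).1) (𝓝 (F x)) (𝓝 (T.ch (f x) (f x))) := by
      have : Continuous fun v => (e v).1 := continuous_fst.comp e.continuous
      have h5 := this.tendsto (F x)
      rwa [hF0] at h5
    filter_upwards [h3.eventually h2, h4.eventually (T.eventually_ch_chInv (f x))] with v e1 e2
    change e.symm (T.ch (f x) (f (K v)), π (K v)) = v
    have e3 : f (K v) = T.chInv (f x) (e v).1 := e1.1
    have e4 : π (K v) = (e v).2 := e1.2
    rw [e3, e4, e2]
    exact e.symm_apply_apply v
  have hAev : ∀ᶠ z in @nhds S.Carrier _ x, K (F z) = z ∧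
      ContMDiffAt (M := S.Carrier) 𝓘(ℝ, S.E) 𝓘(ℝ, S.E) ∞ F z := hKF.and hF
  have hBev : ∀ᶠ v in 𝓝 (F x), F (K v) = v ∧
      ContMDiffAt (M' := S.Carrier) 𝓘(ℝ, S.E) 𝓘(ℝ, S.E) ∞ K v := hFK.and hK
  obtain ⟨A, hA, hAo, hxA⟩ := (eventually_nhds_iff (X := S.Carrier)).1 hAev
  obtain ⟨B, hB, hBo, hxB⟩ := eventually_nhds_iff.1 hBev
  obtain ⟨φ, hxφ, hφA, hφB, hφF, hφK⟩ := exists_openPartialHomeomorph (X := S.Carrier) hAo hBo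
    hxA hxB (fun z hz => (hA z hz).2.continuousAt.continuousWithinAt)
    (fun v hv => (hB v hv).2.continuousAt.continuousWithinAt) (fun z hz _ => (hA z hz).1)
    (fun v hv => (hB v hv).1)
  refine Manifold.IsSubmersionAtOfComplement.mk_of_continuousAt (hf.contMDiffAt.continuousAt) e φ
    (chartAt (M := T.Carrier) T.E (f x)) hxφ (mem_chart_source (M := T.Carrier) T.E (f x)) ?_
    (IsManifold.chart_mem_maximalAtlas (M := T.Carrier) (f x)) ?_
  · refine OpenPartialHomeomorph.mem_maximalAtlas_of_contMDiffOn φ ?_ ?_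
    · rw [hφF]
      exact fun z hz => (hA z (hφA hz)).2.contMDiffWithinAt
    · rw [hφK]
      exact fun v hv => (hB v (hφB hv)).2.contMDiffWithinAt
  · intro v hv
    have hv' : v ∈ φ.target := by simpa using hv
    have h3 := φ.right_inv hv'
    rw [hφF] at h3
    have h4 : e (F (φ.symm v)) = (T.ch (f x) (f (φ.symm v)), π (φ.symm v)) :=
      e.apply_symm_apply _
    rw [h3] at h4
    exact (congrArg Prod.fst h4).symm

/-- For finite dimensional manifolds, surjective submersions are the surjective smooth maps with
local sections through all points. -/
lemma isSurjSubmersion_iff {f : X → Y} : S.IsSurjSubmersion T f ↔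
    Function.Surjective f ∧ ∀ x, SmoothNear S T f x ∧ HasSection S T f x := by
  constructor
  · rintro ⟨h1, h2⟩
    have h3 : Manifold.IsSubmersion (M := S.Carrier) (N := T.Carrier)
      𝓘(ℝ, S.E) 𝓘(ℝ, T.E) ∞ f := h2
    exact ⟨h1, fun x => ⟨Eventually.of_forall fun y => h3.contMDiff y,
      hasSection_of_isSubmersionAt (h3.isSubmersionAt x)⟩⟩
  · rintro ⟨h1, h2⟩
    refine ⟨h1, ?_⟩
    have h3 : Manifold.IsSubmersion (M := S.Carrier) (N := T.Carrier)
      𝓘(ℝ, S.E) 𝓘(ℝ, T.E) ∞ f := ⟨_, _, _, fun x =>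
        isSubmersionAtOfComplement_of_hasSection (h2 x).1 (h2 x).2⟩
    exact h3

end Submersion

/-! ### Embedded submanifolds and fibre products -/

section Existence

variable {M P : Type u} (R : SmoothStr M) (ι : P → M)

/-- Local charts for a subset `P` of a manifold `M`: near each of its points, `P` is parametrized by
an open subset of `V`, and the inverse of the parametrization extends to a smooth map on `M`. -/
def HasLocalCharts (V : Type) [NormedAddCommGroup V] [NormedSpace ℝ V]
    [FiniteDimensional ℝ V] : Prop :=
  ∀ p, ∃ (e : M → V) (i : V → M), SmoothNear R (self V) e (ι p) ∧
    SmoothNear (self V) R i (e (ι p)) ∧ (∀ᶠ v in 𝓝 (e (ι p)), i v ∈ Set.range ι ∧ e (i v) = v) ∧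
    ∀ᶠ m in R.nhd (ι p), m ∈ Set.range ι → i (e m) = m

variable {R ι}

lemma HasLocalCharts.exists_chart {V : Type} [NormedAddCommGroup V] [NormedSpace ℝ V]
    [FiniteDimensional ℝ V] [TopologicalSpace P] (h : HasLocalCharts R ι V)
    (hι : Function.Injective ι)
    (hind : Topology.IsInducing (Y := R.Carrier) ι) (p : P) :
    ∃ (φ : OpenPartialHomeomorph P V) (e : M → V) (i : V → M), p ∈ φ.source ∧
      (∀ z, φ z = e (ι z)) ∧ (∀ v ∈ φ.target, ι (φ.symm v) = i v) ∧
      (∀ z ∈ φ.source, SmoothNear R (self V) e (ι z)) ∧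
      ∀ v ∈ φ.target, SmoothNear (self V) R i v := by
  obtain ⟨e, i, he, hi, h1, h2⟩ := h p
  have hAev : ∀ᶠ m in @nhds R.Carrier _ (ι p), (m ∈ Set.range ι → i (e m) = m) ∧
      SmoothNear R (self V) e m := h2.and he.eventually
  have hBev : ∀ᶠ v in 𝓝 (e (ι p)), (i v ∈ Set.range ι ∧ e (i v) = v) ∧
      SmoothNear (self V) R i v := h1.and hi.eventually
  obtain ⟨A, hA, hAo, hpA⟩ := (eventually_nhds_iff (X := R.Carrier)).1 hAev
  obtain ⟨B, hB, hBo, hpB⟩ := eventually_nhds_iff.1 hBev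
  have : Nonempty P := ⟨p⟩
  let k : V → P := fun v => Function.invFun ι (i v)
  have hk : ∀ v ∈ B, ι (k v) = i v := fun v hv => Function.invFun_eq (hB v hv).1.1
  have hAo' : IsOpen (X := P) (ι ⁻¹' A) := IsOpen.preimage (Y := R.Carrier) hind.continuous hAo
  obtain ⟨φ, hpφ, hφA, hφB, hφF, hφK⟩ := exists_openPartialHomeomorph (X := P) (Y := V)
    (f := fun z => e (ι z)) (k := k) (x := p) (A := ι ⁻¹' A) (B := B)
    hAo' hBo hpA hpB
    (fun z hz => by
      have hz' : SmoothNear R (self V) e (ι z) := (hA _ hz).2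
      have h4 : ContinuousAt (X := R.Carrier) e (ι z) := hz'.tendsto
      have h5 : ContinuousAt (Y := R.Carrier) ι z := hind.continuous.continuousAt
      have h6 : ContinuousAt (fun z => e (ι z)) z := ContinuousAt.comp (Y := R.Carrier) h4 h5
      exact h6.continuousWithinAt)
    (by
      have h3 : ContinuousOn (Y := R.Carrier) (fun v => ι (k v)) B := by
        refine ContinuousOn.congr (β := R.Carrier) (f := i) (fun v hv => ?_) hk
        have h4 : ContinuousAt (Y := R.Carrier) i v := (hB v hv).2.tendsto
        exact h4.continuousWithinAt
      exact (Topology.IsInducing.continuousOn_iff (β := P) (γ := R.Carrier) hind).2 h3)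
    (fun z hz hz' => hι (by rw [hk _ hz', (hA _ hz).1 ⟨z, rfl⟩])) (fun v hv => by
      rw [hk v hv, (hB v hv).1.2])
  refine ⟨φ, e, i, hpφ, fun z => by rw [hφF], fun v hv => ?_, fun z hz => (hA _ (hφA hz)).2,
    fun v hv => (hB v (hφB hv)).2⟩
  rw [hφK, hk v (hφB hv)]

/-- A subset with local charts is an embedded submanifold. -/
lemma HasLocalCharts.exists_embedsIn {V : Type} [NormedAddCommGroup V] [NormedSpace ℝ V]
    [FiniteDimensional ℝ V] (h : HasLocalCharts R ι V) (hι : Function.Injective ι) :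
    ∃ S : SmoothStr P, EmbedsIn S R ι ∧ Module.finrank ℝ S.E = Module.finrank ℝ V := by
  let top : TopologicalSpace P := R.top.induced ι
  have hind : Topology.IsInducing (Y := R.Carrier) ι := ⟨rfl⟩
  choose φ e i hp hφ hφs he hi using h.exists_chart hι hind
  let charted : ChartedSpace V P :=
    { atlas := Set.range φ
      chartAt := φ
      mem_chart_source := hp
      chart_mem_atlas := fun p => ⟨p, rfl⟩ }
  have hman : IsManifold 𝓘(ℝ, V) ∞ P := by
    refine isManifold_of_contDiffOn _ _ _ ?_
    rintro _ _ ⟨p, rfl⟩ ⟨q, rfl⟩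
    rintro v ⟨⟨hv1, hv2⟩, -⟩
    have hv1' : v ∈ (φ p).target := hv1
    have hv2' : (φ p).symm v ∈ (φ q).source := hv2
    have h1 : SmoothNear (self V) (self V) (fun v => e q (i p v)) v :=
      SmoothNear.comp (T := R) (by rw [← hφs p v hv1']; exact he q _ hv2') (hi p v hv1')
    have h2 := smoothNear_self_iff.1 h1
    have h3 : ContDiffAt ℝ ∞ (fun v => (φ q) ((φ p).symm v)) v := by
      refine h2.self_of_nhds.congr_of_eventuallyEq ?_
      filter_upwards [(φ p).open_target.mem_nhds hv1'] with w hw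
      rw [hφ, hφs p w hw]
    exact h3.contDiffWithinAt
  have ht2 : T2Space P := T2Space.of_injective_continuous (Y := R.Carrier) hι hind.continuous
  have hsc : SecondCountableTopology P :=
    TopologicalSpace.secondCountableTopology_induced P R.Carrier ι
  let S : SmoothStr P := { E := V, top := top, charted := charted, isManifold := hman }
  refine ⟨S, ⟨hι, fun p => ?_, fun p => ?_⟩, rfl⟩
  · have h1 : SmoothNear S R (fun z => i p (S.ch p z)) p :=
      SmoothNear.comp (T := self V) (hi p _ ((φ p).map_source (hp p))) (smoothNear_ch (S := S) p)
    refine h1.congr ?_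
    have h2 : ∀ᶠ z in 𝓝 p, z ∈ (φ p).source := (φ p).open_source.mem_nhds (hp p)
    filter_upwards [h2] with z hz
    have h3 : ι ((φ p).symm (φ p z)) = i p (φ p z) := hφs p _ ((φ p).map_source hz)
    rw [(φ p).left_inv hz] at h3
    exact h3.symm
  · refine ⟨fun m => S.chInv p (e p m), ?_, ?_⟩
    · refine SmoothNear.comp (T := self V) ?_ (he p _ (hp p))
      rw [← hφ]
      exact smoothNear_chInv (S := S) p
    · have h1 : S.nhd p = comap ι (R.nhd (ι p)) := hind.nhds_eq_comap p
      rw [← h1]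
      filter_upwards [S.eventually_chInv_ch p] with z hz
      rw [← hφ]
      exact hz

/-- A smooth structure can be transported along a bijection. -/
lemma exists_embedsIn_of_bijective (hι : Function.Bijective ι) :
    ∃ S : SmoothStr P, EmbedsIn S R ι := by
  have h : HasLocalCharts R ι R.E := fun p => ⟨R.ch (ι p), R.chInv (ι p), smoothNear_ch _,
    smoothNear_chInv _, (R.eventually_ch_chInv (ι p)).mono fun v hv => ⟨hι.2 _, hv⟩,
    (R.eventually_chInv_ch (ι p)).mono fun m hm _ => hm⟩
  obtain ⟨S, hS, -⟩ := h.exists_embedsIn hι.1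
  exact ⟨S, hS⟩

end Existence

section FibreProduct

variable {X Y Z P : Type u} {S : SmoothStr X} {T : SmoothStr Y} {U : SmoothStr Z}

/-- The fibre product of a smooth map `f` and a submersion `g` is an embedded submanifold of the
product, of dimension `dim X + (dim Y - dim Z)`. -/
lemma exists_fibreProduct {f : X → Z} {g : Y → Z} (hf : ∀ x, SmoothNear S U f x)
    (hg : ∀ y, SmoothNear T U g y) (hgs : ∀ y, HasSection T U g y) (ι : P → X × Y)
    (hι : Function.Injective ι) (hrange : ∀ p, p ∈ Set.range ι ↔ f p.1 = g p.2) :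
    ∃ Q : SmoothStr P, EmbedsIn Q (S.prod T) ι ∧ Module.finrank ℝ Q.E =
      Module.finrank ℝ S.E + (Module.finrank ℝ T.E - Module.finrank ℝ U.E) := by
  let d := Module.finrank ℝ T.E - Module.finrank ℝ U.E
  have h : HasLocalCharts (S.prod T) ι (S.E × (Fin d → ℝ)) := by
    intro p
    obtain ⟨x, y, hxy⟩ : ∃ x y, ι p = (x, y) := ⟨_, _, rfl⟩
    rw [hxy]
    have hfg : f x = g y := by
      have := (hrange (ι p)).1 ⟨p, rfl⟩
      rwa [hxy] at this
    -- in the normal form of `g` near `y`, with fibre coordinates `π`, the fibre product is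
    -- parametrized by `X` and the fibre coordinates
    obtain ⟨-, π, σ, hπ, hσ, h1, h2⟩ := exists_normal_form (hg y) (hgs y)
    have hfx : SmoothNear (self S.E) U (fun v => f (S.chInv x v)) (S.ch x x) :=
      SmoothNear.comp (hf _) (smoothNear_chInv x)
    have hσ' : SmoothNear (self (S.E × (Fin d → ℝ))) (U.prod (self (Fin d → ℝ)))
        (fun v => (f (S.chInv x v.1), v.2)) (S.ch x x, π y) := by
      refine SmoothNear.prodMk ?_ (contDiff_snd.smoothNear _)
      exact SmoothNear.comp (T := self S.E) (g := fun v => f (S.chInv x v))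
        (f := fun v : S.E × (Fin d → ℝ) => v.1) (x := (S.ch x x, π y)) hfx
        (contDiff_fst.smoothNear _)
    have hbase : (f (S.chInv x (S.ch x x)), π y) = (g y, π y) := by rw [chInv_ch_self, hfg]
    have hσ0 : SmoothNear (self (S.E × (Fin d → ℝ))) T
        (fun v => σ (f (S.chInv x v.1), v.2)) (S.ch x x, π y) :=
      SmoothNear.comp (g := σ) (f := fun v : S.E × (Fin d → ℝ) => (f (S.chInv x v.1), v.2))
        (by rw [hbase]; exact hσ) hσ'
    have hcx : Tendsto (fun v : S.E × (Fin d → ℝ) => v.1) (𝓝 (S.ch x x, π y))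
        (𝓝 (S.ch x x)) := continuous_fst.tendsto _
    refine ⟨fun m => (S.ch x m.1, π m.2), fun v => (S.chInv x v.1, σ (f (S.chInv x v.1), v.2)),
      ?_, ?_, ?_, ?_⟩
    · exact SmoothNear.prodMk_self (SmoothNear.comp (T := S) (smoothNear_ch x) (smoothNear_fst _))
        (SmoothNear.comp (T := T) hπ (smoothNear_snd _))
    · refine SmoothNear.prodMk ?_ hσ0
      exact SmoothNear.comp (T := self S.E) (f := fun v : S.E × (Fin d → ℝ) => v.1)
        (smoothNear_chInv x) (contDiff_fst.smoothNear _)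
    · have h3 := hσ'.tendsto
      rw [hbase] at h3
      filter_upwards [h3.eventually h2, hcx.eventually (S.eventually_ch_chInv x)] with v e1 e2
      refine ⟨(hrange _).2 e1.1.symm, ?_⟩
      change (S.ch x (S.chInv x v.1), π (σ (f (S.chInv x v.1), v.2))) = v
      rw [e2, e1.2]
    · rw [nhd_prod]
      filter_upwards [tendsto_fst.eventually (S.eventually_chInv_ch x),
        tendsto_snd.eventually h1] with m e1 e2 hm
      rw [e1, (hrange m).1 hm, e2]
  obtain ⟨Q, hQ, hd⟩ := h.exists_embedsIn hι
  exact ⟨Q, hQ, by rw [hd, Module.finrank_prod, Module.finrank_fin_fun]⟩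

end FibreProduct

end SmoothStr

namespace TwoCat

/-! ### The operations of a 2-category as total functions -/

section Total

variable (C : TwoCat.{u})

open Classical in
/-- Composition of arrows, extended by the junk value `g` to pairs that are not composable. -/
noncomputable def cm (g f : C.Ar) : C.Ar := if h : C.src g = C.tgt f then C.comp g f h else g

open Classical in
/-- Vertical composition of 2-cells, extended by the junk value `β` to all pairs. -/
noncomputable def vc (β α : C.Ce) : C.Ce := if h : C.dom β = C.cod α then C.vcomp β α h else β

open Classical in
/-- Horizontal composition of 2-cells, extended by the junk value `β` to all pairs. -/
noncomputable def hc (β α : C.Ce) : C.Ce :=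
  if h : C.src (C.dom β) = C.tgt (C.dom α) then C.hcomp β α h else β

/-- Left whiskering of the 2-cell `α` by the arrow `g`. -/
noncomputable def wl (g : C.Ar) (α : C.Ce) : C.Ce := C.hc (C.idc g) α

/-- Right whiskering of the 2-cell `α` by the arrow `f`. -/
noncomputable def wr (α : C.Ce) (f : C.Ar) : C.Ce := C.hc α (C.idc f)

open Classical in
/-- The inverse of a 2-cell for vertical composition; the 2-cell itself if there is none. -/
noncomputable def iv (α : C.Ce) : C.Ce := if h : ∃ β, C.IsInverse α β then h.choose else α

variable {C} {f g k : C.Ar} {α β γ α' β' : C.Ce}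

lemma cm_eq (h : C.src g = C.tgt f) : C.cm g f = C.comp g f h := dif_pos h
lemma vc_eq (h : C.dom β = C.cod α) : C.vc β α = C.vcomp β α h := dif_pos h
lemma hc_eq (h : C.src (C.dom β) = C.tgt (C.dom α)) : C.hc β α = C.hcomp β α h := dif_pos h

lemma src_cm (h : C.src g = C.tgt f) : C.src (C.cm g f) = C.src f := by
  rw [cm_eq h, src_comp]
lemma tgt_cm (h : C.src g = C.tgt f) : C.tgt (C.cm g f) = C.tgt g := by
  rw [cm_eq h, tgt_comp]
lemma dom_vc (h : C.dom β = C.cod α) : C.dom (C.vc β α) = C.dom α := by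
  rw [vc_eq h, dom_vcomp]
lemma cod_vc (h : C.dom β = C.cod α) : C.cod (C.vc β α) = C.cod β := by
  rw [vc_eq h, cod_vcomp]
lemma dom_hc (h : C.src (C.dom β) = C.tgt (C.dom α)) :
    C.dom (C.hc β α) = C.cm (C.dom β) (C.dom α) := by
  rw [hc_eq h, dom_hcomp, cm_eq h]
lemma cod_hc (h : C.src (C.dom β) = C.tgt (C.dom α)) :
    C.cod (C.hc β α) = C.cm (C.cod β) (C.cod α) := by
  rw [hc_eq h, cod_hcomp, cm_eq]

lemma cm_assoc (h : C.src k = C.tgt g) (h' : C.src g = C.tgt f) :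
    C.cm (C.cm k g) f = C.cm k (C.cm g f) := by
  simp only [cm_eq h, cm_eq h']
  rw [cm_eq (by rw [src_comp, h']), cm_eq (by rw [tgt_comp, h]), comp_assoc]

lemma one_cm {x : C.Ob} (h : x = C.tgt f) : C.cm (C.one x) f = f := by
  subst h
  rw [cm_eq (by rw [src_one]), one_comp]

lemma cm_one {x : C.Ob} (h : x = C.src f) : C.cm f (C.one x) = f := by
  subst h
  rw [cm_eq (by rw [tgt_one]), comp_one]

lemma vc_assoc (h : C.dom γ = C.cod β) (h' : C.dom β = C.cod α) :
    C.vc (C.vc γ β) α = C.vc γ (C.vc β α) := by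
  simp only [vc_eq h, vc_eq h']
  rw [vc_eq (by rw [dom_vcomp, h']), vc_eq (by rw [cod_vcomp, h]), vcomp_assoc]

lemma idc_vc (h : f = C.cod α) : C.vc (C.idc f) α = α := by
  subst h
  rw [vc_eq (by rw [dom_idc]), idc_vcomp]

lemma vc_idc (h : f = C.dom α) : C.vc α (C.idc f) = α := by
  subst h
  rw [vc_eq (by rw [cod_idc]), vcomp_idc]

lemma hc_idc (h : C.src g = C.tgt f) : C.hc (C.idc g) (C.idc f) = C.idc (C.cm g f) := by
  rw [hc_eq (by rw [dom_idc, dom_idc, h]), hcomp_idc, cm_eq h]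

lemma hc_vc (hβ : C.dom β' = C.cod β) (hα : C.dom α' = C.cod α)
    (h : C.src (C.dom β) = C.tgt (C.dom α)) :
    C.hc (C.vc β' β) (C.vc α' α) = C.vc (C.hc β' α') (C.hc β α) := by
  simp only [vc_eq hβ, vc_eq hα, hc_eq h]
  rw [hc_eq (by rw [dom_vcomp, dom_vcomp, h]), hc_eq (by rw [hβ, hα, src_cod, tgt_cod, h]),
    vc_eq (by simp only [dom_hcomp, cod_hcomp, hβ, hα]), C.interchange β' β α' α hβ hα h]

lemma hc_assoc (h : C.src (C.dom γ) = C.tgt (C.dom β))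
    (h' : C.src (C.dom β) = C.tgt (C.dom α)) :
    C.hc (C.hc γ β) α = C.hc γ (C.hc β α) := by
  simp only [hc_eq h, hc_eq h']
  rw [hc_eq (by rw [dom_hcomp, src_comp, h']), hc_eq (by rw [dom_hcomp, tgt_comp, h]),
    hcomp_assoc]

lemma dom_wl (h : C.src g = C.tgt (C.dom α)) : C.dom (C.wl g α) = C.cm g (C.dom α) := by
  rw [wl, dom_hc (by rw [dom_idc, h]), dom_idc]
lemma cod_wl (h : C.src g = C.tgt (C.dom α)) : C.cod (C.wl g α) = C.cm g (C.cod α) := by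
  rw [wl, cod_hc (by rw [dom_idc, h]), cod_idc]
lemma dom_wr (h : C.src (C.dom α) = C.tgt f) : C.dom (C.wr α f) = C.cm (C.dom α) f := by
  rw [wr, dom_hc (by rw [dom_idc, h]), dom_idc]
lemma cod_wr (h : C.src (C.dom α) = C.tgt f) : C.cod (C.wr α f) = C.cm (C.cod α) f := by
  rw [wr, cod_hc (by rw [dom_idc, h]), cod_idc]

lemma wl_idc (h : C.src g = C.tgt f) : C.wl g (C.idc f) = C.idc (C.cm g f) := hc_idc h
lemma wr_idc (h : C.src g = C.tgt f) : C.wr (C.idc g) f = C.idc (C.cm g f) := hc_idc h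

lemma wl_one {x : C.Ob} (h : x = C.tgt (C.dom α)) : C.wl (C.one x) α = α := by
  subst h
  rw [wl, hc_eq (by rw [dom_idc, src_one]), one_hcomp]

lemma wr_one {x : C.Ob} (h : x = C.src (C.dom α)) : C.wr α (C.one x) = α := by
  subst h
  rw [wr, hc_eq (by rw [dom_idc, tgt_one]), hcomp_one]

lemma wl_vc (h : C.dom β = C.cod α) (h' : C.src g = C.tgt (C.dom α)) :
    C.wl g (C.vc β α) = C.vc (C.wl g β) (C.wl g α) := by
  have := hc_vc (C := C) (β' := C.idc g) (β := C.idc g) (α' := β) (α := α)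
    (by rw [dom_idc, cod_idc]) h (by rw [dom_idc, h'])
  rwa [idc_vc (by rw [cod_idc])] at this

lemma wr_vc (h : C.dom β = C.cod α) (h' : C.src (C.dom α) = C.tgt f) :
    C.wr (C.vc β α) f = C.vc (C.wr β f) (C.wr α f) := by
  have := hc_vc (C := C) (β' := β) (β := α) (α' := C.idc f) (α := C.idc f) h
    (by rw [dom_idc, cod_idc]) (by rw [dom_idc, h'])
  rwa [idc_vc (by rw [cod_idc])] at this

lemma wl_wl (h : C.src k = C.tgt g) (h' : C.src g = C.tgt (C.dom α)) :
    C.wl k (C.wl g α) = C.wl (C.cm k g) α := by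
  rw [wl, wl, wl, ← hc_idc h, hc_assoc (by rw [dom_idc, dom_idc, h]) (by rw [dom_idc, h'])]

lemma wr_wr (h : C.src (C.dom α) = C.tgt g) (h' : C.src g = C.tgt f) :
    C.wr (C.wr α g) f = C.wr α (C.cm g f) := by
  rw [wr, wr, wr, ← hc_idc h', hc_assoc (by rw [dom_idc, h]) (by rw [dom_idc, dom_idc, h'])]

lemma wr_wl (h : C.src g = C.tgt (C.dom α)) (h' : C.src (C.dom α) = C.tgt f) :
    C.wr (C.wl g α) f = C.wl g (C.wr α f) := by
  rw [wr, wl, wl, wr, hc_assoc (by rw [dom_idc, h]) (by rw [dom_idc, h'])]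

/-- The interchange law for whiskerings. -/
lemma vc_wl_wr (h : C.src (C.dom β) = C.tgt (C.dom α)) :
    C.vc (C.wl (C.cod β) α) (C.wr β (C.dom α)) = C.vc (C.wr β (C.cod α)) (C.wl (C.dom β) α) := by
  have h1 := hc_vc (C := C) (β' := C.idc (C.cod β)) (β := β) (α' := α) (α := C.idc (C.dom α))
    (by rw [dom_idc]) (by rw [cod_idc]) (by rw [dom_idc, h])
  have h2 := hc_vc (C := C) (β' := β) (β := C.idc (C.dom β)) (α' := C.idc (C.cod α)) (α := α)
    (by rw [cod_idc]) (by rw [dom_idc]) (by rw [dom_idc, h])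
  rw [idc_vc rfl, vc_idc rfl] at h1 h2
  exact h1.symm.trans h2

section Invertible

variable (hC : C.CellsInvertible)
include hC

lemma isInverse_iv (α : C.Ce) : C.IsInverse α (C.iv α) := by
  rw [iv, dif_pos (hC α)]
  exact (hC α).choose_spec

lemma dom_iv (α : C.Ce) : C.dom (C.iv α) = C.cod α := (isInverse_iv hC α).choose
lemma cod_iv (α : C.Ce) : C.cod (C.iv α) = C.dom α := (isInverse_iv hC α).choose_spec.choose.symm

lemma iv_vc (α : C.Ce) : C.vc (C.iv α) α = C.idc (C.dom α) := by
  obtain ⟨h, h', h1, h2⟩ := isInverse_iv hC α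
  rw [vc_eq h, h1]

lemma vc_iv (α : C.Ce) : C.vc α (C.iv α) = C.idc (C.cod α) := by
  obtain ⟨h, h', h1, h2⟩ := isInverse_iv hC α
  rw [vc_eq h', h2]

lemma iv_vc_cancel (h : C.dom α = C.cod β) : C.vc (C.iv α) (C.vc α β) = β := by
  rw [← vc_assoc (dom_iv hC α) h, iv_vc hC, idc_vc h]

lemma vc_iv_cancel (h : C.cod α = C.cod β) : C.vc α (C.vc (C.iv α) β) = β := by
  rw [← vc_assoc (cod_iv hC α).symm ((dom_iv hC α).trans h), vc_iv hC, idc_vc h]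

lemma vc_vc_iv_cancel (h : C.dom β = C.cod α) : C.vc (C.vc β α) (C.iv α) = β := by
  rw [vc_assoc h (cod_iv hC α).symm, vc_iv hC, vc_idc h.symm]

lemma vc_iv_vc_cancel (h : C.dom β = C.dom α) : C.vc (C.vc β (C.iv α)) α = β := by
  rw [vc_assoc (h.trans (cod_iv hC α).symm) (dom_iv hC α), iv_vc hC, vc_idc h.symm]

lemma vc_left_cancel (h : C.dom γ = C.cod α) (h' : C.dom γ = C.cod β) :
    C.vc γ α = C.vc γ β ↔ α = β :=
  ⟨fun e => by rw [← iv_vc_cancel hC h, e, iv_vc_cancel hC h'], fun e => by rw [e]⟩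

lemma vc_right_cancel (h : C.dom α = C.cod γ) (h' : C.dom β = C.cod γ) :
    C.vc α γ = C.vc β γ ↔ α = β :=
  ⟨fun e => by rw [← vc_vc_iv_cancel hC h, e, vc_vc_iv_cancel hC h'], fun e => by rw [e]⟩

/-- Solving `γ • α = β` for `γ`. -/
lemma eq_vc_iv_iff (h : C.dom γ = C.cod α) (h' : C.dom β = C.dom α) :
    γ = C.vc β (C.iv α) ↔ C.vc γ α = β := by
  constructor
  · rintro rfl
    exact vc_iv_vc_cancel hC h'
  · rintro rfl
    exact (vc_vc_iv_cancel hC h).symm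

/-- Solving `γ • α = β` for `α`. -/
lemma eq_iv_vc_iff (h : C.dom γ = C.cod α) (h' : C.cod β = C.cod γ) :
    α = C.vc (C.iv γ) β ↔ C.vc γ α = β := by
  constructor
  · rintro rfl
    exact vc_iv_cancel hC h'.symm
  · rintro rfl
    exact (iv_vc_cancel hC h).symm

lemma iv_eq_of_vc_eq (h : C.dom β = C.cod α) (e : C.vc β α = C.idc (C.dom α)) :
    C.iv α = β := by
  rw [← vc_right_cancel hC (dom_iv hC α) h, e, iv_vc hC]

end Invertible

end Total

end TwoCat

namespace TwoCat

/-! ### Simplices of the nerve and the pentagon -/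

/-- The data of an `n`-simplex of the nerve with total functions of the vertices, and without the
coherence equation. -/
structure PreSimplex (C : TwoCat.{u}) (n : ℕ) where
  ob : Fin (n + 1) → C.Ob
  ar : Fin (n + 1) → Fin (n + 1) → C.Ar
  ce : Fin (n + 1) → Fin (n + 1) → Fin (n + 1) → C.Ce
  src_ar : ∀ {i j}, i ≤ j → C.src (ar i j) = ob i
  tgt_ar : ∀ {i j}, i ≤ j → C.tgt (ar i j) = ob j
  ar_self : ∀ i, ar i i = C.one (ob i)
  dom_ce : ∀ {i j k}, i ≤ j → j ≤ k → C.dom (ce i j k) = ar i k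
  cod_ce : ∀ {i j k}, i ≤ j → j ≤ k → C.cod (ce i j k) = C.cm (ar j k) (ar i j)
  ce_left : ∀ {i k}, i ≤ k → ce i i k = C.idc (ar i k)
  ce_right : ∀ {i k}, i ≤ k → ce i k k = C.idc (ar i k)

variable {C : TwoCat.{u}} {n : ℕ}

namespace PreSimplex

/-- The coherence equation of a lax functor for the vertices `i ≤ j ≤ k ≤ l`. -/
def Coh (p : PreSimplex C n) (i j k l : Fin (n + 1)) : Prop :=
  C.vc (C.wr (p.ce j k l) (p.ar i j)) (p.ce i j l) =
    C.vc (C.wl (p.ar k l) (p.ce i j k)) (p.ce i k l)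

variable (p : PreSimplex C n) {i j k l m : Fin (n + 1)}

/-- The coherence equation is automatic for degenerate tetrahedra. -/
lemma coh_of_degenerate (hij : i ≤ j) (hjk : j ≤ k) (hkl : k ≤ l) (h : i = j ∨ j = k ∨ k = l) :
    p.Coh i j k l := by
  have hik := hij.trans hjk
  have hjl := hjk.trans hkl
  have hil := hij.trans hjl
  have e1 : C.src (p.ar k l) = C.tgt (p.ar j k) := by rw [p.src_ar hkl, p.tgt_ar hjk]
  have e2 : C.src (p.ar j l) = C.tgt (p.ar i j) := by rw [p.src_ar hjl, p.tgt_ar hij]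
  unfold Coh
  rcases h with rfl | rfl | rfl
  · rw [p.ar_self, wr_one (by rw [p.dom_ce hjk hkl, p.src_ar hjl]), p.ce_left hjl,
      p.ce_left hjk, wl_idc e1, idc_vc (p.cod_ce hjk hkl).symm,
      vc_idc (p.dom_ce hjk hkl).symm]
  · rw [p.ce_left hkl, p.ce_right hij, wl_idc e2, wr_idc e2]
  · rw [p.ar_self, wl_one (by rw [p.dom_ce hij hjk, p.tgt_ar hil]), p.ce_right hjk, p.ce_right hil,
      wr_idc e2, idc_vc (p.cod_ce hij hjl).symm, vc_idc (p.dom_ce hij hjl).symm]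

/-- A simplex of the nerve, from total data that satisfy the coherence equation for
nondegenerate tetrahedra. -/
def toSimplex (h : ∀ i j k l, i < j → j < k → k < l → p.Coh i j k l) : Simplex C n where
  ob := p.ob
  ar i j _ := p.ar i j
  ce i j k _ _ := p.ce i j k
  src_ar _ _ hij := p.src_ar hij
  tgt_ar _ _ hij := p.tgt_ar hij
  ar_self := p.ar_self
  dom_ce _ _ _ hij hjk := p.dom_ce hij hjk
  cod_ce _ _ _ hij hjk := by
    rw [p.cod_ce hij hjk, cm_eq]
  ce_left _ _ h := p.ce_left h
  ce_right _ _ h := p.ce_right h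
  coherence i j k l hij hjk hkl := by
    have h1 : p.Coh i j k l := by
      by_cases hd : i = j ∨ j = k ∨ k = l
      · exact p.coh_of_degenerate hij hjk hkl hd
      · push Not at hd
        exact h i j k l (lt_of_le_of_ne hij hd.1) (lt_of_le_of_ne hjk hd.2.1)
          (lt_of_le_of_ne hkl hd.2.2)
    have e2 : C.src (p.ar j l) = C.tgt (p.ar i j) := by
      rw [p.src_ar (hjk.trans hkl), p.tgt_ar hij]
    have e3 : C.src (p.ar k l) = C.tgt (p.ar i k) := by
      rw [p.src_ar hkl, p.tgt_ar (hij.trans hjk)]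
    unfold Coh at h1
    rw [wr, wl, hc_eq (by rw [p.dom_ce hjk hkl, C.dom_idc, e2]),
      hc_eq (by rw [p.dom_ce hij hjk, C.dom_idc, e3]), vc_eq, vc_eq] at h1
    exact h1

section Pentagon

variable (hij : i ≤ j) (hjk : j ≤ k) (hkl : k ≤ l) (hlm : l ≤ m)
include hij hjk hkl hlm

/-- The pentagon of a 4-simplex consists of five composites of whiskered 2-cells. Each of its five
edges, an equality of two composites, amounts to the coherence of one face; for the first and the
last face, to this coherence whiskered by the opposite edge. Here, the face is the one opposite the
second vertex. -/
lemma pentagon_coh_face₁ (hC : C.CellsInvertible) :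
    C.vc (C.wl (p.ar l m) (C.wl (p.ar k l) (p.ce i j k)))
      (C.vc (C.wl (p.ar l m) (p.ce i k l)) (p.ce i l m)) =
    C.vc (C.wr (C.wr (p.ce k l m) (p.ar j k)) (p.ar i j))
      (C.vc (C.wl (p.ar k m) (p.ce i j k)) (p.ce i k m)) ↔ p.Coh i k l m := by
  have hik := hij.trans hjk
  have hil := hik.trans hkl
  have him := hil.trans hlm
  have hjl := hjk.trans hkl
  have hjm := hjl.trans hlm
  have hkm := hkl.trans hlm
  have hx := vc_wl_wr (C := C) (β := p.ce k l m) (α := p.ce i j k)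
    (by rw [p.dom_ce hkl hlm, p.dom_ce hij hjk, p.src_ar hkm, p.tgt_ar hik])
  rw [p.cod_ce hkl hlm, p.cod_ce hij hjk, p.dom_ce hij hjk, p.dom_ce hkl hlm] at hx
  rw [wr_wr, ← vc_assoc (γ := C.wr (p.ce k l m) _), ← hx, vc_assoc (γ := C.wl (C.cm _ _) _),
    wl_wl, vc_left_cancel hC, Coh, eq_comm]
  all_goals simp (maxDischargeDepth := 8) only [p.src_ar, p.tgt_ar, p.dom_ce, p.cod_ce, dom_wl,
    cod_wl, dom_wr, cod_wr, dom_vc, cod_vc, src_cm, tgt_cm, cm_assoc, hij, hjk, hkl, hlm, hik,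
    hil, him, hjl, hjm, hkm]

lemma pentagon_coh_face₃ (hC : C.CellsInvertible) :
    C.vc (C.wr (C.wr (p.ce k l m) (p.ar j k)) (p.ar i j))
      (C.vc (C.wl (p.ar k m) (p.ce i j k)) (p.ce i k m)) =
    C.vc (C.wr (C.wr (p.ce k l m) (p.ar j k)) (p.ar i j))
      (C.vc (C.wr (p.ce j k m) (p.ar i j)) (p.ce i j m)) ↔ p.Coh i j k m := by
  have hik := hij.trans hjk
  have hil := hik.trans hkl
  have him := hil.trans hlm
  have hjl := hjk.trans hkl
  have hjm := hjl.trans hlm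
  have hkm := hkl.trans hlm
  rw [vc_left_cancel hC, Coh, eq_comm]
  all_goals simp (maxDischargeDepth := 8) only [p.src_ar, p.tgt_ar, p.dom_ce, p.cod_ce, dom_wl,
    cod_wl, dom_wr, cod_wr, dom_vc, cod_vc, src_cm, tgt_cm, cm_assoc, hij, hjk, hkl, hlm, hik,
    hil, him, hjl, hjm, hkm]

lemma pentagon_coh_face₀ (hC : C.CellsInvertible) :
    C.vc (C.wr (C.wr (p.ce k l m) (p.ar j k)) (p.ar i j))
      (C.vc (C.wr (p.ce j k m) (p.ar i j)) (p.ce i j m)) =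
    C.vc (C.wr (C.wl (p.ar l m) (p.ce j k l)) (p.ar i j))
      (C.vc (C.wr (p.ce j l m) (p.ar i j)) (p.ce i j m)) ↔
    C.wr (C.vc (C.wr (p.ce k l m) (p.ar j k)) (p.ce j k m)) (p.ar i j) =
      C.wr (C.vc (C.wl (p.ar l m) (p.ce j k l)) (p.ce j l m)) (p.ar i j) := by
  have hik := hij.trans hjk
  have hil := hik.trans hkl
  have him := hil.trans hlm
  have hjl := hjk.trans hkl
  have hjm := hjl.trans hlm
  have hkm := hkl.trans hlm
  rw [wr_vc, wr_vc, ← vc_assoc, ← vc_assoc, vc_right_cancel hC]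
  all_goals simp (maxDischargeDepth := 8) only [p.src_ar, p.tgt_ar, p.dom_ce, p.cod_ce, dom_wl,
    cod_wl, dom_wr, cod_wr, dom_vc, cod_vc, src_cm, tgt_cm, cm_assoc, hij, hjk, hkl, hlm, hik,
    hil, him, hjl, hjm, hkm]

lemma pentagon_coh_face₂ (hC : C.CellsInvertible) :
    C.vc (C.wr (C.wl (p.ar l m) (p.ce j k l)) (p.ar i j))
      (C.vc (C.wr (p.ce j l m) (p.ar i j)) (p.ce i j m)) =
    C.vc (C.wr (C.wl (p.ar l m) (p.ce j k l)) (p.ar i j))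
      (C.vc (C.wl (p.ar l m) (p.ce i j l)) (p.ce i l m)) ↔ p.Coh i j l m := by
  have hik := hij.trans hjk
  have hil := hik.trans hkl
  have him := hil.trans hlm
  have hjl := hjk.trans hkl
  have hjm := hjl.trans hlm
  have hkm := hkl.trans hlm
  rw [vc_left_cancel hC, Coh]
  all_goals simp (maxDischargeDepth := 8) only [p.src_ar, p.tgt_ar, p.dom_ce, p.cod_ce, dom_wl,
    cod_wl, dom_wr, cod_wr, dom_vc, cod_vc, src_cm, tgt_cm, cm_assoc, hij, hjk, hkl, hlm, hik,
    hil, him, hjl, hjm, hkm]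

lemma pentagon_coh_face₄ (hC : C.CellsInvertible) :
    C.vc (C.wr (C.wl (p.ar l m) (p.ce j k l)) (p.ar i j))
      (C.vc (C.wl (p.ar l m) (p.ce i j l)) (p.ce i l m)) =
    C.vc (C.wl (p.ar l m) (C.wl (p.ar k l) (p.ce i j k)))
      (C.vc (C.wl (p.ar l m) (p.ce i k l)) (p.ce i l m)) ↔
    C.wl (p.ar l m) (C.vc (C.wr (p.ce j k l) (p.ar i j)) (p.ce i j l)) =
      C.wl (p.ar l m) (C.vc (C.wl (p.ar k l) (p.ce i j k)) (p.ce i k l)) := by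
  have hik := hij.trans hjk
  have hil := hik.trans hkl
  have him := hil.trans hlm
  have hjl := hjk.trans hkl
  have hjm := hjl.trans hlm
  have hkm := hkl.trans hlm
  rw [wl_vc, wl_vc, wr_wl, ← vc_assoc, ← vc_assoc, vc_right_cancel hC]
  all_goals simp (maxDischargeDepth := 8) only [p.src_ar, p.tgt_ar, p.dom_ce, p.cod_ce, dom_wl,
    cod_wl, dom_wr, cod_wr, dom_vc, cod_vc, src_cm, tgt_cm, cm_assoc, hij, hjk, hkl, hlm, hik,
    hil, him, hjl, hjm, hkm]

/-- In a 4-simplex, the coherence of the face opposite the second vertex follows from that of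
the other four faces. -/
lemma coh_face₁ (hC : C.CellsInvertible) (h0 : p.Coh j k l m) (h2 : p.Coh i j l m)
    (h3 : p.Coh i j k m) (h4 : p.Coh i j k l) : p.Coh i k l m := by
  rw [← p.pentagon_coh_face₁ hij hjk hkl hlm hC, (p.pentagon_coh_face₃ hij hjk hkl hlm hC).2 h3,
    (p.pentagon_coh_face₀ hij hjk hkl hlm hC).2 (congrArg (fun a => C.wr a (p.ar i j)) h0),
    (p.pentagon_coh_face₂ hij hjk hkl hlm hC).2 h2,
    (p.pentagon_coh_face₄ hij hjk hkl hlm hC).2 (congrArg (C.wl (p.ar l m)) h4)]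

/-- The coherence of the face opposite the third vertex. -/
lemma coh_face₂ (hC : C.CellsInvertible) (h0 : p.Coh j k l m) (h1 : p.Coh i k l m)
    (h3 : p.Coh i j k m) (h4 : p.Coh i j k l) : p.Coh i j l m := by
  rw [← p.pentagon_coh_face₂ hij hjk hkl hlm hC,
    (p.pentagon_coh_face₄ hij hjk hkl hlm hC).2 (congrArg (C.wl (p.ar l m)) h4),
    (p.pentagon_coh_face₁ hij hjk hkl hlm hC).2 h1, (p.pentagon_coh_face₃ hij hjk hkl hlm hC).2 h3,
    (p.pentagon_coh_face₀ hij hjk hkl hlm hC).2 (congrArg (fun a => C.wr a (p.ar i j)) h0)]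

/-- The coherence of the face opposite the fourth vertex. -/
lemma coh_face₃ (hC : C.CellsInvertible) (h0 : p.Coh j k l m) (h1 : p.Coh i k l m)
    (h2 : p.Coh i j l m) (h4 : p.Coh i j k l) : p.Coh i j k m := by
  rw [← p.pentagon_coh_face₃ hij hjk hkl hlm hC,
    (p.pentagon_coh_face₀ hij hjk hkl hlm hC).2 (congrArg (fun a => C.wr a (p.ar i j)) h0),
    (p.pentagon_coh_face₂ hij hjk hkl hlm hC).2 h2,
    (p.pentagon_coh_face₄ hij hjk hkl hlm hC).2 (congrArg (C.wl (p.ar l m)) h4),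
    (p.pentagon_coh_face₁ hij hjk hkl hlm hC).2 h1]

/-- The coherence of the face opposite the first vertex, if whiskering by the first edge is
faithful. -/
lemma coh_face₀ (hC : C.CellsInvertible)
    (hf : ∀ α β : C.Ce, C.dom α = C.dom β → C.cod α = C.cod β →
      C.src (C.dom α) = C.tgt (p.ar i j) → C.wr α (p.ar i j) = C.wr β (p.ar i j) → α = β)
    (h1 : p.Coh i k l m) (h2 : p.Coh i j l m) (h3 : p.Coh i j k m) (h4 : p.Coh i j k l) :
    p.Coh j k l m := by
  have h := (p.pentagon_coh_face₀ hij hjk hkl hlm hC).1 (by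
    rw [← (p.pentagon_coh_face₃ hij hjk hkl hlm hC).2 h3, ← (p.pentagon_coh_face₁ hij hjk hkl hlm hC).2 h1,
      (p.pentagon_coh_face₂ hij hjk hkl hlm hC).2 h2,
      (p.pentagon_coh_face₄ hij hjk hkl hlm hC).2 (congrArg (C.wl (p.ar l m)) h4)])
  have hjl := hjk.trans hkl
  have hjm := hjl.trans hlm
  have hkm := hkl.trans hlm
  refine hf _ _ ?_ ?_ ?_ h
  all_goals simp (maxDischargeDepth := 8) only [p.src_ar, p.tgt_ar, p.dom_ce, p.cod_ce, dom_wl,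
    cod_wl, dom_wr, cod_wr, dom_vc, cod_vc, src_cm, tgt_cm, cm_assoc, hij, hjk, hkl, hlm, hjl,
    hjm, hkm]

/-- The coherence of the face opposite the last vertex, if whiskering by the last edge is
faithful. -/
lemma coh_face₄ (hC : C.CellsInvertible)
    (hf : ∀ α β : C.Ce, C.dom α = C.dom β → C.cod α = C.cod β →
      C.src (p.ar l m) = C.tgt (C.dom α) → C.wl (p.ar l m) α = C.wl (p.ar l m) β → α = β)
    (h0 : p.Coh j k l m) (h1 : p.Coh i k l m) (h2 : p.Coh i j l m) (h3 : p.Coh i j k m) :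
    p.Coh i j k l := by
  have h := (p.pentagon_coh_face₄ hij hjk hkl hlm hC).1 (by
    rw [← (p.pentagon_coh_face₂ hij hjk hkl hlm hC).2 h2,
      ← (p.pentagon_coh_face₀ hij hjk hkl hlm hC).2 (congrArg (fun a => C.wr a (p.ar i j)) h0),
      ← (p.pentagon_coh_face₃ hij hjk hkl hlm hC).2 h3, (p.pentagon_coh_face₁ hij hjk hkl hlm hC).2 h1])
  have hik := hij.trans hjk
  have hil := hik.trans hkl
  have hjl := hjk.trans hkl
  refine hf _ _ ?_ ?_ ?_ h
  all_goals simp (maxDischargeDepth := 8) only [p.src_ar, p.tgt_ar, p.dom_ce, p.cod_ce, dom_wl,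
    cod_wl, dom_wr, cod_wr, dom_vc, cod_vc, src_cm, tgt_cm, cm_assoc, hij, hjk, hkl, hlm, hik,
    hil, hjl]

end Pentagon

end PreSimplex

namespace Simplex

variable (s t : Simplex C n)

open Classical in
/-- The data of a simplex as total functions, with junk values off the ordered vertices. -/
noncomputable def pre : PreSimplex C n where
  ob := s.ob
  ar i j := if h : i ≤ j then s.ar i j h else C.one (s.ob i)
  ce i j k := if h : i ≤ j ∧ j ≤ k then s.ce i j k h.1 h.2 else C.idc (C.one (s.ob i))
  src_ar h := by rw [dif_pos h, s.src_ar]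
  tgt_ar h := by rw [dif_pos h, s.tgt_ar]
  ar_self i := by rw [dif_pos le_rfl, s.ar_self]
  dom_ce h h' := by rw [dif_pos ⟨h, h'⟩, dif_pos (h.trans h'), s.dom_ce]
  cod_ce h h' := by rw [dif_pos ⟨h, h'⟩, dif_pos h, dif_pos h', s.cod_ce, cm_eq]
  ce_left h := by rw [dif_pos ⟨le_rfl, h⟩, dif_pos h, s.ce_left]
  ce_right h := by rw [dif_pos ⟨h, le_rfl⟩, dif_pos h, s.ce_right]

variable {s t} {i j k l : Fin (n + 1)}

lemma pre_ar (h : i ≤ j) : s.pre.ar i j = s.ar i j h := dif_pos h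

lemma pre_ce (h : i ≤ j) (h' : j ≤ k) : s.pre.ce i j k = s.ce i j k h h' := dif_pos ⟨h, h'⟩

lemma pre_coh (hij : i ≤ j) (hjk : j ≤ k) (hkl : k ≤ l) : s.pre.Coh i j k l := by
  have h := s.coherence i j k l hij hjk hkl
  rw [PreSimplex.Coh, pre_ce hjk hkl, pre_ce hij hjk, pre_ce hij (hjk.trans hkl),
    pre_ce (hij.trans hjk) hkl, pre_ar hij, pre_ar hkl, wr, wl, hc_eq, hc_eq, vc_eq, vc_eq]
  exact h

/-- A simplex is determined by its 2-cells. -/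
lemma ext_ce (h : ∀ i j k hij hjk, s.ce i j k hij hjk = t.ce i j k hij hjk) : s = t := by
  have har : ∀ i j hij, s.ar i j hij = t.ar i j hij := fun i j hij => by
    rw [← s.dom_ce i i j le_rfl hij, h, t.dom_ce]
  have hob : ∀ i, s.ob i = t.ob i := fun i => by
    rw [← s.src_ar i i le_rfl, har, t.src_ar]
  exact Simplex.ext (funext hob) (funext fun i => funext fun j => funext fun hij => har i j hij)
    (funext fun i => funext fun j => funext fun k => funext fun hij => funext fun hjk =>
      h i j k hij hjk)

/-- A simplex is determined by its arrows and its nondegenerate 2-cells. -/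
lemma ext_lt (har : ∀ i j hij, s.ar i j hij = t.ar i j hij)
    (h : ∀ i j k (hij : i < j) (hjk : j < k),
      s.ce i j k hij.le hjk.le = t.ce i j k hij.le hjk.le) : s = t := by
  refine ext_ce fun i j k hij hjk => ?_
  obtain rfl | hij' := hij.eq_or_lt
  · rw [s.ce_left, t.ce_left, har]
  obtain rfl | hjk' := hjk.eq_or_lt
  · rw [s.ce_right, t.ce_right, har]
  exact h i j k hij' hjk'

end Simplex

end TwoCat

namespace SmoothStr

section diff

variable {X Y Z W : Type u} {S : SmoothStr X} {T : SmoothStr Y} {U : SmoothStr Z} {Q : SmoothStr W}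

lemma diff_const (y : Y) (x : X) (v : S.E) : S.diff T (fun _ => y) x v = 0 :=
  DFunLike.congr_fun (mfderiv_const (M := S.Carrier) (M' := T.Carrier) (I := 𝓘(ℝ, S.E))
    (I' := 𝓘(ℝ, T.E)) (x := x) (c := y)) v

lemma EmbedsIn.diff_injective {ι : X → Y} (h : EmbedsIn S T ι) {x : X} {v : S.E}
    (hv : S.diff T ι x v = 0) : v = 0 := by
  obtain ⟨r, hr, e⟩ := h.retraction x
  rw [← h.nhd_eq] at e
  rw [← diff_id x v, ← diff_congr e, diff_comp hr (h.smooth x), hv, map_zero]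

/-- The derivative of `op (b w) (a w)` depends only on the values and the derivatives of `b` and
`a`, even if `op` is only partially defined. -/
lemma IsSmoothOp.diff_eq {P : X → Y → Prop} {op : ∀ x y, P x y → Z} (hop : IsSmoothOp S T U P op)
    {w : W} {v : Q.E} {b b' : W → X} {a a' : W → Y} {g g' : W → Z}
    (hb : SmoothNear Q S b w) (hb' : SmoothNear Q S b' w) (ha : SmoothNear Q T a w)
    (ha' : SmoothNear Q T a' w) (eb : b w = b' w) (ea : a w = a' w)
    (deb : Q.diff S b w v = Q.diff S b' w v) (dea : Q.diff T a w v = Q.diff T a' w v)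
    (hg : ∀ᶠ z in Q.nhd w, ∃ h : P (b z) (a z), g z = op (b z) (a z) h)
    (hg' : ∀ᶠ z in Q.nhd w, ∃ h : P (b' z) (a' z), g' z = op (b' z) (a' z) h) :
    Q.diff U g w v = Q.diff U g' w v := by
  obtain ⟨h0, -⟩ := Q.eventually_mem (p := fun z => ∃ h : P (b z) (a z), g z = op _ _ h) hg
  obtain ⟨F, hF, e⟩ := hop.exists_extension h0
  have key (b₁ : W → X) (a₁ : W → Y) (g₁ : W → Z) (hb : SmoothNear Q S b₁ w)
      (ha : SmoothNear Q T a₁ w) (eb : b w = b₁ w) (ea : a w = a₁ w)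
      (hg : ∀ᶠ z in Q.nhd w, ∃ h : P (b₁ z) (a₁ z), g₁ z = op (b₁ z) (a₁ z) h) :
      Q.diff U g₁ w v =
        (S.prod T).diff U F (b w, a w) (Q.diff S b₁ w v, Q.diff T a₁ w v) := by
    have hp := hb.prodMk ha
    rw [eb, ea] at hF e ⊢
    rw [← diff_prodMk hb ha, ← diff_comp (g := F) (f := fun w => (b₁ w, a₁ w)) hF hp]
    refine DFunLike.congr_fun (diff_congr ?_) v
    filter_upwards [hg, hp.tendsto.eventually e] with z ⟨h1, h2⟩ h3
    rw [h2]
    exact (h3 h1).symm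
  rw [key b a g hb ha rfl rfl hg, key b' a' g' hb' ha' eb ea hg', deb, dea]

end diff

end SmoothStr

namespace LieTwoCat

open SmoothStr TwoCat

/-! ### Smoothness of the operations of a Lie 2-category -/

section Along

variable {C : LieTwoCat.{u}} {M X : Type*} {R : SmoothStr M} {ι : X → M} {f g : X → C.Ar}
  {α β : X → C.Ce} {x : X}

variable (C) in
lemma smoothNear_src (f : C.Ar) : SmoothNear C.arStr C.obStr C.src f :=
  ((isSurjSubmersion_iff.1 C.src_submersion).2 f).1

variable (C) in
lemma smoothNear_tgt (f : C.Ar) : SmoothNear C.arStr C.obStr C.tgt f :=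
  ((isSurjSubmersion_iff.1 C.tgt_submersion).2 f).1

variable (C) in
lemma smoothNear_dom (α : C.Ce) : SmoothNear C.ceStr C.arStr C.dom α :=
  ((isSurjSubmersion_iff.1 C.dom_submersion).2 α).1

variable (C) in
lemma smoothNear_cod (α : C.Ce) : SmoothNear C.ceStr C.arStr C.cod α :=
  ((isSurjSubmersion_iff.1 C.cod_submersion).2 α).1

variable (C) in
lemma smoothNear_one (a : C.Ob) : SmoothNear C.obStr C.arStr C.one a :=
  isSmooth_iff.1 C.one_smooth a

variable (C) in
lemma smoothNear_idc (f : C.Ar) : SmoothNear C.arStr C.ceStr C.idc f :=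
  isSmooth_iff.1 C.idc_smooth f

lemma smoothAlong_src (h : SmoothAlong R ι C.arStr f x) :
    SmoothAlong R ι C.obStr (fun z => C.src (f z)) x := (C.smoothNear_src _).comp_along h

lemma smoothAlong_tgt (h : SmoothAlong R ι C.arStr f x) :
    SmoothAlong R ι C.obStr (fun z => C.tgt (f z)) x := (C.smoothNear_tgt _).comp_along h

lemma smoothAlong_dom (h : SmoothAlong R ι C.ceStr α x) :
    SmoothAlong R ι C.arStr (fun z => C.dom (α z)) x := (C.smoothNear_dom _).comp_along h

lemma smoothAlong_one {a : X → C.Ob} (h : SmoothAlong R ι C.obStr a x) :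
    SmoothAlong R ι C.arStr (fun z => C.one (a z)) x := (C.smoothNear_one _).comp_along h

lemma smoothAlong_idc (h : SmoothAlong R ι C.arStr f x) :
    SmoothAlong R ι C.ceStr (fun z => C.idc (f z)) x := (C.smoothNear_idc _).comp_along h

lemma smoothAlong_cm (hg : SmoothAlong R ι C.arStr g x) (hf : SmoothAlong R ι C.arStr f x)
    (h : ∀ᶠ z in comap ι (R.nhd (ι x)), C.src (g z) = C.tgt (f z)) :
    SmoothAlong R ι C.arStr (fun z => C.cm (g z) (f z)) x :=
  C.comp_smooth.smoothAlong hg hf (h.mono fun _ hz => ⟨hz, cm_eq hz⟩)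

lemma smoothAlong_vc (hβ : SmoothAlong R ι C.ceStr β x) (hα : SmoothAlong R ι C.ceStr α x)
    (h : ∀ᶠ z in comap ι (R.nhd (ι x)), C.dom (β z) = C.cod (α z)) :
    SmoothAlong R ι C.ceStr (fun z => C.vc (β z) (α z)) x :=
  C.vcomp_smooth.smoothAlong hβ hα (h.mono fun _ hz => ⟨hz, vc_eq hz⟩)

lemma smoothAlong_hc (hβ : SmoothAlong R ι C.ceStr β x) (hα : SmoothAlong R ι C.ceStr α x)
    (h : ∀ᶠ z in comap ι (R.nhd (ι x)), C.src (C.dom (β z)) = C.tgt (C.dom (α z))) :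
    SmoothAlong R ι C.ceStr (fun z => C.hc (β z) (α z)) x :=
  C.hcomp_smooth.smoothAlong hβ hα (h.mono fun _ hz => ⟨hz, hc_eq hz⟩)

lemma smoothAlong_wl (hg : SmoothAlong R ι C.arStr g x) (hα : SmoothAlong R ι C.ceStr α x)
    (h : ∀ᶠ z in comap ι (R.nhd (ι x)), C.src (g z) = C.tgt (C.dom (α z))) :
    SmoothAlong R ι C.ceStr (fun z => C.wl (g z) (α z)) x :=
  smoothAlong_hc (smoothAlong_idc hg) hα (h.mono fun _ hz => by rw [C.dom_idc, hz])

lemma smoothAlong_wr (hα : SmoothAlong R ι C.ceStr α x) (hf : SmoothAlong R ι C.arStr f x)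
    (h : ∀ᶠ z in comap ι (R.nhd (ι x)), C.src (C.dom (α z)) = C.tgt (f z)) :
    SmoothAlong R ι C.ceStr (fun z => C.wr (α z) (f z)) x :=
  smoothAlong_hc hα (smoothAlong_idc hf) (h.mono fun _ hz => by rw [C.dom_idc, hz])

end Along

/-! ### Smoothness of the inversion of 2-cells -/

section Inverse

variable {C : LieTwoCat.{u}} (hC : C.CellsInvertible)
include hC

/-- If a tangent vector at a pair `(β, α)` of composable 2-cells is killed by the derivatives of
`β • α` and of `α`, then it is killed by the derivative of `β`. To see this, `α` is composed with
a family of 2-cells `δ` with codomain `dom α`, equal to the inverse of `α` at the given pair: then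
`β • (α • δ)` and `β • id` have the same derivative, and the latter product is `β`. -/
lemma diff_eq_zero_of_vc {W : Type u} {Q : SmoothStr W} {b a : W → C.Ce} {w : W} {v : Q.E}
    (hb : SmoothNear Q C.ceStr b w) (ha : SmoothNear Q C.ceStr a w)
    (hba : ∀ z, C.dom (b z) = C.cod (a z)) (hv : Q.diff C.ceStr a w v = 0)
    (hv' : Q.diff C.ceStr (fun z => C.vc (b z) (a z)) w v = 0) : Q.diff C.ceStr b w v = 0 := by
  obtain ⟨s, hs, hs0, hs1⟩ := ((isSurjSubmersion_iff.1 C.cod_submersion).2 (C.iv (a w))).2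
  rw [cod_iv hC] at hs hs0 hs1
  have hda := (C.smoothNear_dom (a w)).comp ha
  have hδ : SmoothNear Q C.ceStr (fun z => s (C.dom (a z))) w :=
    SmoothNear.comp (f := fun z => C.dom (a z)) hs hda
  have hδ0 : ∀ᶠ z in Q.nhd w, C.cod (s (C.dom (a z))) = C.dom (a z) := hda.tendsto.eventually hs1
  have dδ : Q.diff C.ceStr (fun z => s (C.dom (a z))) w v = 0 := by
    rw [diff_comp (f := fun z => C.dom (a z)) hs hda, diff_comp (C.smoothNear_dom _) ha, hv,
      map_zero, map_zero]
  -- a product of families with vanishing derivative has vanishing derivative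
  have key (x y : W → C.Ce) (hx : SmoothNear Q C.ceStr x w) (hy : SmoothNear Q C.ceStr y w)
      (dx : Q.diff C.ceStr x w v = 0) (dy : Q.diff C.ceStr y w v = 0)
      (h : ∀ᶠ z in Q.nhd w, C.dom (x z) = C.cod (y z)) :
      Q.diff C.ceStr (fun z => C.vc (x z) (y z)) w v = 0 := by
    have h0 := Q.eventually_mem (p := fun z => C.dom (x z) = C.cod (y z)) h
    rw [← diff_const (S := Q) (T := C.ceStr) (C.vc (x w) (y w)) w v]
    refine C.vcomp_smooth.diff_eq hx (smoothNear_const (x w) w) hy (smoothNear_const (y w) w)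
      rfl rfl ?_ ?_ (h.mono fun z hz => ⟨hz, vc_eq hz⟩) (Eventually.of_forall fun z => ⟨h0, vc_eq h0⟩)
    · rw [dx, diff_const]
    · rw [dy, diff_const]
  have sm (x y : W → C.Ce) (hx : SmoothNear Q C.ceStr x w) (hy : SmoothNear Q C.ceStr y w)
      (h : ∀ᶠ z in Q.nhd w, C.dom (x z) = C.cod (y z)) :
      SmoothNear Q C.ceStr (fun z => C.vc (x z) (y z)) w := by
    refine smoothAlong_id_iff.1 (smoothAlong_vc (smoothAlong_id_iff.2 hx)
      (smoothAlong_id_iff.2 hy) ?_)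
    rwa [show (fun z : W => z) = id from rfl, comap_id]
  have hε := sm a _ ha hδ (hδ0.mono fun z hz => hz.symm)
  have dε := key a _ ha hδ hv dδ (hδ0.mono fun z hz => hz.symm)
  have hba' := sm b a hb ha (Eventually.of_forall hba)
  have d1 := key _ _ hba' hδ hv' dδ (hδ0.mono fun z hz => by rw [dom_vc (hba z), hz])
  have hi : SmoothNear Q C.ceStr (fun z => C.idc (C.cod (a z))) w :=
    (C.smoothNear_idc _).comp ((C.smoothNear_cod _).comp ha)
  have di : Q.diff C.ceStr (fun z => C.idc (C.cod (a z))) w v = 0 := by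
    rw [diff_comp (f := fun z => C.cod (a z)) (C.smoothNear_idc _) ((C.smoothNear_cod _).comp ha),
      diff_comp (C.smoothNear_cod _) ha, hv, map_zero, map_zero]
  rw [← d1]
  refine C.vcomp_smooth.diff_eq hb hb hi hε rfl ?_ rfl (di.trans dε.symm)
    (Eventually.of_forall fun z => ?_) (hδ0.mono fun z hz => ?_)
  · change _ = C.vc (a w) (s (C.dom (a w)))
    rw [hs0, vc_iv hC]
  · exact ⟨by rw [C.cod_idc, hba], by rw [← vc_eq, vc_idc (hba z).symm]⟩
  · exact ⟨by rw [cod_vc hz.symm, hba], by rw [← vc_eq, vc_assoc (hba z) hz.symm]⟩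

/-- In a Lie 2-category in which every 2-cell is invertible, inversion is automatically smooth:
the map `(β, α) ↦ (β • α, α)` is a smooth bijection between manifolds of equal dimension, with
injective differentials, and its inverse sends `(id, α)` to `(α⁻¹, α)`. -/
lemma smoothNear_iv (α₀ : C.Ce) : SmoothNear C.ceStr C.ceStr C.iv α₀ := by
  let P := {p : C.Ce × C.Ce // C.dom p.1 = C.cod p.2}
  let P' := {p : C.Ce × C.Ce // C.dom p.1 = C.dom p.2}
  obtain ⟨S, hS, hd⟩ := exists_fibreProduct (P := P) C.smoothNear_dom C.smoothNear_cod
    (fun y => ((isSurjSubmersion_iff.1 C.cod_submersion).2 y).2) Subtype.val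
    Subtype.val_injective fun p => ⟨by rintro ⟨q, rfl⟩; exact q.2, fun h => ⟨⟨p, h⟩, rfl⟩⟩
  obtain ⟨S', hS', hd'⟩ := exists_fibreProduct (P := P') C.smoothNear_dom C.smoothNear_dom
    (fun y => ((isSurjSubmersion_iff.1 C.dom_submersion).2 y).2) Subtype.val
    Subtype.val_injective fun p => ⟨by rintro ⟨q, rfl⟩; exact q.2, fun h => ⟨⟨p, h⟩, rfl⟩⟩
  have hb (p : P) : SmoothNear S C.ceStr (fun p => p.1.1) p :=
    SmoothNear.comp (smoothNear_fst _) (hS.smooth p)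
  have ha (p : P) : SmoothNear S C.ceStr (fun p => p.1.2) p :=
    SmoothNear.comp (smoothNear_snd _) (hS.smooth p)
  have hm (p : P) : SmoothNear S C.ceStr (fun p => C.vc p.1.1 p.1.2) p :=
    smoothAlong_id_iff.1 (smoothAlong_vc (smoothAlong_id_iff.2 (hb p))
      (smoothAlong_id_iff.2 (ha p)) (Eventually.of_forall fun z => z.2))
  let Φ : P → P' := fun p => ⟨(C.vc p.1.1 p.1.2, p.1.2), dom_vc p.2⟩
  have hΦ (p : P) : SmoothNear S S' Φ p := hS'.smoothNear ((hm p).prodMk (ha p))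
  let p₀ : P := ⟨(C.iv α₀, α₀), dom_iv hC α₀⟩
  obtain ⟨k, hk, -, hk2⟩ := (hΦ p₀).exists_local_inverse (fun v hv => by
    have h1 : S.diff (C.ceStr.prod C.ceStr) (fun p => (Φ p).1) p₀ v = 0 := by
      rw [diff_comp (g := Subtype.val) (hS'.smooth _) (hΦ p₀), hv, map_zero]
    have h2 := (diff_prodMk (hm p₀) (ha p₀) v).symm.trans h1
    have h4 : S.diff C.ceStr (fun p : P => p.1.2) p₀ v = 0 := congrArg Prod.snd h2
    have h3 : S.diff C.ceStr (fun p : P => p.1.1) p₀ v = 0 :=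
      diff_eq_zero_of_vc hC (hb p₀) (ha p₀) (fun p => p.2) h4 (congrArg Prod.fst h2)
    refine hS.diff_injective ((diff_prodMk (hb p₀) (ha p₀) v).trans ?_)
    exact Prod.ext h3 h4) (hd.trans hd'.symm)
  let c : C.Ce → P' := fun α => ⟨(C.idc (C.dom α), α), by rw [C.dom_idc]⟩
  have hc0 : Φ p₀ = c α₀ := Subtype.ext (Prod.ext (iv_vc hC α₀) rfl)
  rw [hc0] at hk hk2
  have hc : SmoothNear C.ceStr S' c α₀ := hS'.smoothNear
    (((C.smoothNear_idc _).comp (C.smoothNear_dom _)).prodMk (smoothNear_id _))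
  refine (SmoothNear.comp (g := fun p : P => p.1.1) (f := fun α => k (c α)) (hb _)
    (hk.comp hc)).congr ?_
  filter_upwards [hc.tendsto.eventually hk2] with α h
  have h1 : (k (c α)).1.2 = α := congrArg (fun p : P' => p.1.2) h
  have h2 : C.vc (k (c α)).1.1 (k (c α)).1.2 = C.idc (C.dom α) :=
    congrArg (fun p : P' => p.1.1) h
  have h3 := (k (c α)).2
  rw [h1] at h2 h3
  exact (iv_eq_of_vc_eq hC h3 h2).symm

lemma smoothAlong_iv {M X : Type*} {R : SmoothStr M} {ι : X → M} {α : X → C.Ce} {x : X}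
    (h : SmoothAlong R ι C.ceStr α x) : SmoothAlong R ι C.ceStr (fun z => C.iv (α z)) x :=
  (smoothNear_iv hC _).comp_along h

end Inverse

end LieTwoCat

namespace SmoothStr

/-- An embedding into a manifold may be replaced by a map into another manifold, if each is smooth in
terms of the other. -/
lemma EmbedsIn.of_smoothAlong {X M M' : Type*} {S : SmoothStr X} {R : SmoothStr M}
    {R' : SmoothStr M'} {ι : X → M} {ι' : X → M'} (h : EmbedsIn S R ι)
    (hs : ∀ x, SmoothNear S R' ι' x) (ha : ∀ x, SmoothAlong R' ι' R ι x) : EmbedsIn S R' ι' where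
  injective x y e := by
    obtain ⟨r, hr, e'⟩ := h.smoothAlong (c := fun x => x) (ha x)
    rw [eventually_comap] at e'
    have h1 := R'.eventually_mem e'
    exact (h1 x rfl).symm.trans (by simpa only [e] using h1 y e.symm)
  smooth := hs
  retraction x := h.smoothAlong (ha x)

lemma HasSection.pi {ι : Type} [Fintype ι] {X Y : ι → Type*} {S : ∀ i, SmoothStr (X i)}
    {T : ∀ i, SmoothStr (Y i)} {f : ∀ i, X i → Y i} {x : ∀ i, X i}
    (h : ∀ i, HasSection (S i) (T i) (f i) (x i)) :
    HasSection (pi S) (pi T) (fun x i => f i (x i)) x := by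
  choose s hs h0 h1 using h
  refine ⟨fun y i => s i (y i), SmoothNear.pi fun i =>
    SmoothNear.comp (g := s i) (hs i) (smoothNear_apply i _), funext h0, ?_⟩
  rw [nhd_pi]
  filter_upwards [eventually_all.2 fun i => (tendsto_eval_pi _ i).eventually (h1 i)] with y hy
    using funext hy

end SmoothStr

namespace TwoCat

variable {C : TwoCat.{u}} {n : ℕ}

namespace PreSimplex

variable (p : PreSimplex C n) {i j k l : Fin (n + 1)}

/-- The coherence equation, solved for the face opposite the third vertex. -/
lemma coh_iff_ce₂ (hC : C.CellsInvertible) (hij : i ≤ j) (hjk : j ≤ k) (hkl : k ≤ l) :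
    p.Coh i j k l ↔ p.ce i j l = C.vc (C.iv (C.wr (p.ce j k l) (p.ar i j)))
      (C.vc (C.wl (p.ar k l) (p.ce i j k)) (p.ce i k l)) := by
  have hik := hij.trans hjk
  have hil := hik.trans hkl
  have hjl := hjk.trans hkl
  rw [eq_iv_vc_iff hC, Coh]
  all_goals simp (maxDischargeDepth := 8) only [p.src_ar, p.tgt_ar, p.dom_ce, p.cod_ce, dom_wl,
    cod_wl, dom_wr, cod_wr, dom_vc, cod_vc, src_cm, tgt_cm, cm_assoc, hij, hjk, hkl, hik, hil, hjl]

/-- The coherence equation, solved for the face opposite the second vertex. -/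
lemma coh_iff_ce₁ (hC : C.CellsInvertible) (hij : i ≤ j) (hjk : j ≤ k) (hkl : k ≤ l) :
    p.Coh i j k l ↔ p.ce i k l = C.vc (C.iv (C.wl (p.ar k l) (p.ce i j k)))
      (C.vc (C.wr (p.ce j k l) (p.ar i j)) (p.ce i j l)) := by
  have hik := hij.trans hjk
  have hil := hik.trans hkl
  have hjl := hjk.trans hkl
  rw [eq_iv_vc_iff hC, Coh, eq_comm]
  all_goals simp (maxDischargeDepth := 8) only [p.src_ar, p.tgt_ar, p.dom_ce, p.cod_ce, dom_wl,
    cod_wl, dom_wr, cod_wr, dom_vc, cod_vc, src_cm, tgt_cm, cm_assoc, hij, hjk, hkl, hik, hil, hjl]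

end PreSimplex

/-- The order preserving map `[2] → [n]` with the given values. -/
def triple {i j k : Fin (n + 1)} (hij : i ≤ j) (hjk : j ≤ k) : Fin 3 →o Fin (n + 1) where
  toFun := ![i, j, k]
  monotone' := by
    rw [Fin.monotone_iff_le_succ]
    intro x
    fin_cases x
    exacts [hij, hjk]

/-! ### Simplices as cones over a face -/

section Cone

variable (u : Simplex C n) (g : C.Ar) (α : Fin (n + 1) → C.Ce)

/-- The 2-cell of the triangle `i ≤ j < n + 1` in the cone over `u` with last edge `g` and with the
2-cells `α i` of the triangles `i ≤ n < n + 1`, as determined by the coherence equation for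
`i ≤ j ≤ n < n + 1`. -/
noncomputable def coneCe (i j : Fin (n + 1)) : C.Ce :=
  C.vc (C.iv (C.wr (α j) (u.pre.ar i j)))
    (C.vc (C.wl g (u.pre.ce i j (Fin.last n))) (α i))

variable {u g α}

lemma dom_coneCe (hC : C.CellsInvertible) (hg : C.src g = u.ob (Fin.last n))
    (hα : ∀ i, C.cod (α i) = C.cm g (u.pre.ar i (Fin.last n))) {i j : Fin (n + 1)} (hij : i ≤ j) :
    C.dom (coneCe u g α i j) = C.dom (α i) ∧
      C.cod (coneCe u g α i j) = C.cm (C.dom (α j)) (u.pre.ar i j) := by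
  have hg' : C.src g = u.pre.ob (Fin.last n) := hg
  have hs : C.src (C.dom (α j)) = u.pre.ob j := by
    rw [← C.src_cod, hα, src_cm] <;> simp only [u.pre.src_ar, u.pre.tgt_ar, Fin.le_last, hg']
  constructor <;> rw [coneCe] <;>
  simp (maxDischargeDepth := 8) only [u.pre.src_ar, u.pre.tgt_ar, u.pre.dom_ce, u.pre.cod_ce,
    dom_wl, cod_wl, dom_wr, cod_wr, dom_vc, cod_vc, src_cm, tgt_cm, cm_assoc, hij, dom_iv hC,
    cod_iv hC, hα, Fin.le_last, hg', hs]

variable (u g α)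

/-- An `(n + 1)`-simplex without its coherence, from its last face `u`, its last edge `g`, and the
2-cells `α i` of its triangles `i ≤ n ≤ n + 1`. -/
noncomputable def cone (hC : C.CellsInvertible) (hg : C.src g = u.ob (Fin.last n))
    (hα : ∀ i, C.cod (α i) = C.cm g (u.pre.ar i (Fin.last n))) (hα' : α (Fin.last n) = C.idc g) :
    PreSimplex C (n + 1) where
  ob := Fin.lastCases (C.tgt g) u.ob
  ar i j := Fin.lastCases (Fin.lastCases (C.one (C.tgt g)) (fun i => C.dom (α i)) i)
    (fun j => Fin.lastCases g (fun i => u.pre.ar i j) i) j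
  ce i j k := Fin.lastCases
    (Fin.lastCases (C.idc (Fin.lastCases (C.one (C.tgt g)) (fun i => C.dom (α i)) i))
      (fun j => Fin.lastCases (C.idc g) (fun i => coneCe u g α i j) i) j)
    (fun k => Fin.lastCases (C.idc g)
      (fun j => Fin.lastCases (C.idc g) (fun i => u.pre.ce i j k) i) j) k
  src_ar {i j} hij := by
    have hs (i) : C.src (C.dom (α i)) = u.ob i := by
      rw [← C.src_cod, hα, src_cm, u.pre.src_ar (Fin.le_last _)]
      · rfl
      · rw [u.pre.tgt_ar (Fin.le_last _), hg]; rfl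
    induction j using Fin.lastCases <;> induction i using Fin.lastCases
    · simp [C.src_one]
    · simp [hs]
    · simp at hij
    · rw [Fin.castSucc_le_castSucc_iff] at hij
      simp [u.pre.src_ar hij]; rfl
  tgt_ar {i j} hij := by
    have ht (i) : C.tgt (C.dom (α i)) = C.tgt g := by
      rw [← C.tgt_cod, hα, tgt_cm]
      rw [u.pre.tgt_ar (Fin.le_last _), hg]; rfl
    induction j using Fin.lastCases <;> induction i using Fin.lastCases
    · simp [C.tgt_one]
    · simp [ht]
    · simp at hij
    · rw [Fin.castSucc_le_castSucc_iff] at hij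
      simp [u.pre.tgt_ar hij]; rfl
  ar_self i := by
    induction i using Fin.lastCases
    · simp
    · simp [u.pre.ar_self]; rfl
  dom_ce {i j k} hij hjk := by
    induction k using Fin.lastCases <;> induction j using Fin.lastCases <;>
      induction i using Fin.lastCases
    any_goals simp at hij
    any_goals simp at hjk
    · simp [C.dom_idc]
    · simp [C.dom_idc]
    · simp [(dom_coneCe hC hg hα hij).1]
    · simp [u.pre.dom_ce hij hjk]
  cod_ce {i j k} hij hjk := by
    have ht (i) : C.tgt (C.dom (α i)) = C.tgt g := by
      rw [← C.tgt_cod, hα, tgt_cm]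
      rw [u.pre.tgt_ar (Fin.le_last _), hg]; rfl
    induction k using Fin.lastCases <;> induction j using Fin.lastCases <;>
      induction i using Fin.lastCases
    any_goals simp at hij
    any_goals simp at hjk
    · simp [C.cod_idc, one_cm (C.tgt_one _).symm]
    · simp [C.cod_idc, one_cm (ht _).symm]
    · simp [(dom_coneCe hC hg hα hij).2]
    · simp [u.pre.cod_ce hij hjk]
  ce_left {i k} h := by
    induction k using Fin.lastCases <;> induction i using Fin.lastCases
    any_goals simp at h
    · simp
    · rename_i i
      have hg' : C.src g = C.tgt (u.pre.ar i (Fin.last n)) := by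
        rw [u.pre.tgt_ar (Fin.le_last _), hg]; rfl
      have hs : C.src (C.dom (α i)) = u.pre.ob i := by
        rw [← C.src_cod, hα, src_cm hg', u.pre.src_ar (Fin.le_last _)]
      simp only [Fin.lastCases_last, Fin.lastCases_castSucc]
      rw [coneCe, u.pre.ar_self, wr_one hs.symm, u.pre.ce_left (Fin.le_last _), wl_idc hg',
        idc_vc (hα i).symm, iv_vc hC]
    · simp [u.pre.ce_left h]
  ce_right {i k} h := by
    induction k using Fin.lastCases <;> induction i using Fin.lastCases
    any_goals simp at h
    · simp
    · simp
    · simp [u.pre.ce_right h]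

variable {u g α}

/-- The 2-cells of the triangles `i ≤ n ≤ n + 1` in the cone are the given ones. -/
lemma coneCe_last (hC : C.CellsInvertible) (hg : C.src g = u.ob (Fin.last n))
    (hα : ∀ i, C.cod (α i) = C.cm g (u.pre.ar i (Fin.last n))) (hα' : α (Fin.last n) = C.idc g)
    (i : Fin (n + 1)) : coneCe u g α i (Fin.last n) = α i := by
  have hg' : C.src g = C.tgt (u.pre.ar i (Fin.last n)) := by
    rw [u.pre.tgt_ar (Fin.le_last _), hg]; rfl
  rw [coneCe, hα', wr_idc hg', u.pre.ce_right (Fin.le_last _), wl_idc hg', idc_vc (hα i).symm,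
    ← hα i, iv_eq_of_vc_eq hC (β := C.idc (C.cod (α i))) (by rw [C.dom_idc, C.cod_idc])
      (by rw [C.dom_idc, idc_vc (C.cod_idc _).symm]), idc_vc rfl]

/-- The tetrahedra `i ≤ j ≤ n ≤ n + 1` of the cone are coherent by the definition of its 2-cells, and
those of its base are coherent; the others follow from the pentagon. -/
lemma cone_coh (hC : C.CellsInvertible) (hg : C.src g = u.ob (Fin.last n))
    (hα : ∀ i, C.cod (α i) = C.cm g (u.pre.ar i (Fin.last n))) (hα' : α (Fin.last n) = C.idc g)
    (i j k l : Fin (n + 2)) (hij : i < j) (hjk : j < k) (hkl : k < l) :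
    (cone u g α hC hg hα hα').Coh i j k l := by
  have h0 (i j k l : Fin (n + 1)) (hij : i ≤ j) (hjk : j ≤ k) (hkl : k ≤ l) :
      (cone u g α hC hg hα hα').Coh i.castSucc j.castSucc k.castSucc l.castSucc := by
    have := u.pre_coh hij hjk hkl
    simpa [PreSimplex.Coh, cone] using this
  have h1 (i j : Fin (n + 1)) (hij : i ≤ j) :
      (cone u g α hC hg hα hα').Coh i.castSucc j.castSucc (Fin.last n).castSucc
        (Fin.last (n + 1)) := by
    rw [PreSimplex.coh_iff_ce₂ _ (i := i.castSucc) (j := j.castSucc) (k := (Fin.last n).castSucc)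
      hC hij (Fin.le_last j) (Fin.le_last _)]
    simp [cone, coneCe_last hC hg hα hα', hα', C.dom_idc]
    rfl
  induction i using Fin.lastCases with
  | last => exact absurd (hij.trans_le (Fin.le_last j)) (lt_irrefl _)
  | cast i =>
  induction j using Fin.lastCases with
  | last => exact absurd (hjk.trans_le (Fin.le_last k)) (lt_irrefl _)
  | cast j =>
  induction k using Fin.lastCases with
  | last => exact absurd (hkl.trans_le (Fin.le_last l)) (lt_irrefl _)
  | cast k =>
  induction l using Fin.lastCases with
  | cast l => exact h0 i j k l hij.le hjk.le hkl.le
  | last =>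
    exact PreSimplex.coh_face₃ _ (l := (Fin.last n).castSucc) hij.le hjk.le (Fin.le_last k)
      (Fin.le_last _) hC (h1 j k hjk.le) (h1 i k (hij.le.trans hjk.le)) (h1 i j hij.le)
      (h0 i j k (Fin.last n) hij.le hjk.le (Fin.le_last k))

end Cone
end TwoCat
namespace LieTwoCat

open SmoothStr TwoCat

/-! ### The manifolds of simplices -/

noncomputable instance (m n : ℕ) : Fintype (Fin m →o Fin n) := Fintype.ofFinite _

variable {C : LieTwoCat.{u}} {n : ℕ}

/-- The family of all 2-cells of a simplex. -/
def cells (u : Simplex C.toTwoCat n) (a : Fin 3 →o Fin (n + 1)) : C.Ce :=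
  u.ce (a 0) (a 1) (a 2) (a.monotone (by decide)) (a.monotone (by decide))

lemma smoothAlong_cells_ce {i j k : Fin (n + 1)} (hij : i ≤ j) (hjk : j ≤ k)
    (u : Simplex C.toTwoCat n) :
    SmoothAlong (pi fun _ => C.ceStr) cells C.ceStr (fun u => u.ce i j k hij hjk) u :=
  SmoothNear.comp_along (g := cells) (k := fun q => q (triple hij hjk)) (smoothNear_apply _ _)
    (smoothAlong_self u)

lemma smoothAlong_cells_ar {i j : Fin (n + 1)} (hij : i ≤ j) (u : Simplex C.toTwoCat n) :
    SmoothAlong (pi fun _ => C.ceStr) cells C.arStr (fun u => u.ar i j hij) u :=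
  (smoothAlong_dom (smoothAlong_cells_ce le_rfl hij u)).congr
    (Eventually.of_forall fun u => u.dom_ce _ _ _ _ _)

lemma smoothAlong_cells_ob (i : Fin (n + 1)) (u : Simplex C.toTwoCat n) :
    SmoothAlong (pi fun _ => C.ceStr) cells C.obStr (fun u => u.ob i) u :=
  (smoothAlong_src (smoothAlong_cells_ar le_rfl u)).congr
    (Eventually.of_forall fun u => u.src_ar _ _ _)

/-- A structure on the simplices is the natural one if and only if the 2-cells embed it in a power of
the manifold of 2-cells, with local retractions. -/
lemma isNerveStr_iff {S : ∀ n : ℕ, SmoothStr (C.nerve _⦋n⦌)} : C.IsNerveStr S ↔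
    ∀ n, EmbedsIn (X := Simplex C.toTwoCat n) (S n) (pi fun _ => C.ceStr) cells :=
  forall_congr' fun _ => ⟨fun h => h.embedsIn, fun h =>
    EmbedsIn.isEmbeddingInProduct (φ := fun a => ⟨C.Ce, C.ceStr, fun u => cells u a⟩) h⟩

section Smooth

variable {S : SmoothStr (Simplex C.toTwoCat n)} (hS : EmbedsIn S (pi fun _ => C.ceStr) cells)
  {i j k : Fin (n + 1)}
include hS

lemma smoothNear_ce (hij : i ≤ j) (hjk : j ≤ k) (u : Simplex C.toTwoCat n) :
    SmoothNear S C.ceStr (fun u => u.ce i j k hij hjk) u :=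
  (smoothAlong_cells_ce hij hjk u).comp_plot (c := fun u => u) (hS.smooth u)

lemma smoothNear_ar (hij : i ≤ j) (u : Simplex C.toTwoCat n) :
    SmoothNear S C.arStr (fun u => u.ar i j hij) u :=
  (smoothAlong_cells_ar hij u).comp_plot (c := fun u => u) (hS.smooth u)

lemma smoothNear_ob (i : Fin (n + 1)) (u : Simplex C.toTwoCat n) :
    SmoothNear S C.obStr (fun u => u.ob i) u :=
  (smoothAlong_cells_ob i u).comp_plot (c := fun u => u) (hS.smooth u)

/-- A family of simplices is smooth if its objects, arrows and nondegenerate 2-cells are. -/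
lemma smoothAlong_simplex {M X : Type*} {R : SmoothStr M} {ι : X → M}
    {c : X → Simplex C.toTwoCat n} {x : X}
    (hob : ∀ i, SmoothAlong R ι C.obStr (fun z => (c z).ob i) x)
    (har : ∀ i j (h : i < j), SmoothAlong R ι C.arStr (fun z => (c z).ar i j h.le) x)
    (hce : ∀ i j k (h : i < j) (h' : j < k),
      SmoothAlong R ι C.ceStr (fun z => (c z).ce i j k h.le h'.le) x) :
    SmoothAlong R ι S c x := by
  have har' (i j) (h : i ≤ j) : SmoothAlong R ι C.arStr (fun z => (c z).ar i j h) x := by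
    obtain rfl | h' := h.eq_or_lt
    · exact (smoothAlong_one (hob i)).congr (Eventually.of_forall fun z => ((c z).ar_self i).symm)
    · exact har i j h'
  refine hS.smoothAlong (SmoothAlong.pi fun a => ?_)
  have h01 : a 0 ≤ a 1 := a.monotone (by decide)
  have h12 : a 1 ≤ a 2 := a.monotone (by decide)
  change SmoothAlong R ι C.ceStr (fun z => (c z).ce (a 0) (a 1) (a 2) h01 h12) x
  generalize a 0 = i, a 1 = j, a 2 = k at h01 h12
  obtain rfl | h01' := h01.eq_or_lt
  · exact (smoothAlong_idc (har' i k h12)).congr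
      (Eventually.of_forall fun z => ((c z).ce_left i k _).symm)
  obtain rfl | h12' := h12.eq_or_lt
  · exact (smoothAlong_idc (har' i j h01)).congr
      (Eventually.of_forall fun z => ((c z).ce_right i j _).symm)
  exact hce i j k h01' h12'

lemma smoothNear_simplex {W : Type*} {Q : SmoothStr W} {c : W → Simplex C.toTwoCat n} {w : W}
    (hob : ∀ i, SmoothNear Q C.obStr (fun z => (c z).ob i) w)
    (har : ∀ i j (h : i < j), SmoothNear Q C.arStr (fun z => (c z).ar i j h.le) w)
    (hce : ∀ i j k (h : i < j) (h' : j < k),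
      SmoothNear Q C.ceStr (fun z => (c z).ce i j k h.le h'.le) w) :
    SmoothNear Q S c w := by
  simp only [← smoothAlong_id_iff] at *
  exact smoothAlong_simplex hS hob har hce

end Smooth

/-- The 0-simplices are the objects. -/
lemma _root_.TwoCat.Simplex.ob_zero_bijective {C : TwoCat.{u}} :
    Function.Bijective fun u : Simplex C 0 => u.ob 0 := by
  have hsub : Subsingleton (Fin (0 + 1)) := inferInstanceAs (Subsingleton (Fin 1))
  refine ⟨fun u v e => ?_, fun x => ?_⟩
  · refine Simplex.ext_lt (fun i j hij => ?_) fun i j k h => ?_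
    · obtain rfl := Subsingleton.elim i 0
      obtain rfl := Subsingleton.elim j 0
      rw [u.ar_self, v.ar_self]
      exact congrArg C.one e
    · exact absurd (Subsingleton.elim i j) h.ne
  · refine ⟨PreSimplex.toSimplex
      { ob _ := x, ar _ _ := C.one x, ce _ _ _ := C.idc (C.one x), src_ar _ := C.src_one x,
        tgt_ar _ := C.tgt_one x, ar_self _ := rfl, dom_ce _ _ := C.dom_idc _,
        cod_ce _ _ := by rw [C.cod_idc, one_cm (C.tgt_one x).symm], ce_left _ := rfl,
        ce_right _ := rfl } fun i j _ _ h => ?_, rfl⟩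
    exact absurd (Subsingleton.elim i j) h.ne

variable (C) in
/-- The manifold of objects is the manifold of `0`-simplices. -/
lemma exists_simplexStr_zero : ∃ S : SmoothStr (Simplex C.toTwoCat 0),
    EmbedsIn S (pi fun _ => C.ceStr) cells := by
  have hsub : Subsingleton (Fin (0 + 1)) := inferInstanceAs (Subsingleton (Fin 1))
  obtain ⟨S, hS⟩ := exists_embedsIn_of_bijective (R := C.obStr) Simplex.ob_zero_bijective
  refine ⟨S, hS.of_smoothAlong (fun u => SmoothNear.pi fun a => ?_)
    fun u => smoothAlong_cells_ob 0 u⟩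
  have h1 : SmoothNear S C.ceStr (fun u : Simplex C.toTwoCat 0 => C.idc (C.one (u.ob 0))) u :=
    (C.smoothNear_idc _).comp ((C.smoothNear_one _).comp (hS.smooth u))
  refine h1.congr (Eventually.of_forall fun v => ?_)
  have h01 : a 0 ≤ a 1 := a.monotone (by decide)
  have h12 : a 1 ≤ a 2 := a.monotone (by decide)
  change _ = v.ce (a 0) (a 1) (a 2) h01 h12
  generalize a 0 = i, a 1 = j, a 2 = k at h01 h12
  obtain rfl := Subsingleton.elim i 0
  obtain rfl := Subsingleton.elim j 0
  obtain rfl := Subsingleton.elim k 0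
  rw [v.ce_left, v.ar_self]

end LieTwoCat

namespace TwoCat.Simplex

variable {C : TwoCat.{u}} {n : ℕ}

/-- The face of an `(n + 1)`-simplex opposite the last vertex. -/
def base (s : Simplex C (n + 1)) : Simplex C n := s.pullback Fin.castSuccOrderEmb.toOrderHom

/-- The last edge `n → n + 1` of an `(n + 1)`-simplex. -/
def lastEdge (s : Simplex C (n + 1)) : C.Ar :=
  s.ar (Fin.last n).castSucc (Fin.last (n + 1)) (Fin.le_last _)

/-- The 2-cell of the triangle `i ≤ n ≤ n + 1` of an `(n + 1)`-simplex. -/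
def lastCe (s : Simplex C (n + 1)) (i : Fin (n + 1)) : C.Ce :=
  s.ce i.castSucc (Fin.last n).castSucc (Fin.last (n + 1)) (Fin.le_last i) (Fin.le_last _)

variable (s t : Simplex C (n + 1))

lemma lastCe_last : s.lastCe (Fin.last n) = C.idc s.lastEdge := s.ce_left _ _ _

lemma src_lastEdge : C.src s.lastEdge = s.base.ob (Fin.last n) := s.src_ar _ _ _

lemma cod_lastCe (i : Fin (n + 1)) :
    C.cod (s.lastCe i) = C.cm s.lastEdge (s.base.ar i (Fin.last n) (Fin.le_last _)) := by
  rw [lastCe, cod_ce, ← cm_eq]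
  rfl

lemma ar_last (i : Fin (n + 1)) :
    s.ar i.castSucc (Fin.last (n + 1)) (Fin.le_last _) = C.dom (s.lastCe i) :=
  (s.dom_ce _ _ _ _ _).symm

lemma ce_last (hC : C.CellsInvertible) (i j : Fin (n + 1)) (h : i ≤ j) :
    s.ce i.castSucc j.castSucc (Fin.last (n + 1)) h (Fin.le_last _) =
      C.vc (C.iv (C.wr (s.lastCe j) (s.base.ar i j h))) (C.vc (C.wl s.lastEdge
        (s.base.ce i j (Fin.last n) h (Fin.le_last _))) (s.lastCe i)) := by
  have h1 := (s.pre.coh_iff_ce₂ (i := i.castSucc) (j := j.castSucc) (k := (Fin.last n).castSucc)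
    hC h (Fin.le_last j) (Fin.le_last (Fin.last n).castSucc)).1 (pre_coh h (Fin.le_last j)
      (Fin.le_last (Fin.last n).castSucc))
  have h2 : i.castSucc ≤ j.castSucc := h
  have h3 : j.castSucc ≤ (Fin.last n).castSucc := Fin.le_last j
  have h4 : (Fin.last n).castSucc ≤ Fin.last (n + 1) := Fin.le_last _
  rw [pre_ce h2 (h3.trans h4), pre_ce h3 h4, pre_ar h2, pre_ar h4, pre_ce h2 h3,
    pre_ce (h2.trans h3) h4] at h1
  exact h1

variable {s t}

lemma ext_base (hC : C.CellsInvertible) (hb : s.base = t.base) (he : s.lastEdge = t.lastEdge)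
    (hc : ∀ i : Fin n, s.lastCe i.castSucc = t.lastCe i.castSucc) : s = t := by
  have hc' (i) : s.lastCe i = t.lastCe i := by
    induction i using Fin.lastCases with
    | last => rw [lastCe_last, lastCe_last, he]
    | cast i => exact hc i
  have hbc (i j k hij hjk) : s.base.ce i j k hij hjk = t.base.ce i j k hij hjk := by rw [hb]
  have hba (i j hij) : s.base.ar i j hij = t.base.ar i j hij := by rw [hb]
  have har : ∀ i j hij, s.ar i j hij = t.ar i j hij := fun i j hij => by
    induction j using Fin.lastCases with
    | last =>
      induction i using Fin.lastCases with
      | last =>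
        rw [s.ar_self, t.ar_self]
        refine congrArg C.one ?_
        rw [← s.tgt_ar _ _ (Fin.le_last (Fin.last n).castSucc),
          ← t.tgt_ar _ _ (Fin.le_last (Fin.last n).castSucc)]
        exact congrArg C.tgt he
      | cast i => rw [ar_last, ar_last, hc']
    | cast j =>
      induction i using Fin.lastCases with
      | last => exact absurd (hij.trans_lt (Fin.castSucc_lt_last j)) (lt_irrefl _)
      | cast i => exact hba i j hij
  refine ext_lt har fun i j k hij hjk => ?_
  induction j using Fin.lastCases with
  | last => exact absurd (hjk.trans_le (Fin.le_last k)) (lt_irrefl _)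
  | cast j =>
  induction i using Fin.lastCases with
  | last => exact absurd (hij.trans (Fin.castSucc_lt_last j)) (lt_irrefl _)
  | cast i =>
  induction k using Fin.lastCases with
  | cast k => exact hbc i j k hij.le hjk.le
  | last => rw [ce_last s hC i j hij.le, ce_last t hC i j hij.le, hc', hc', he, hba, hbc]

/-- Each family of 2-cells with the right codomains extends a simplex to a cone. -/
lemma exists_of_base (hC : C.CellsInvertible) (u : Simplex C n) (g : C.Ar) (α : Fin n → C.Ce)
    (hg : u.ob (Fin.last n) = C.src g)
    (hα : ∀ i, C.cm g (u.ar i.castSucc (Fin.last n) (Fin.le_last _)) = C.cod (α i)) :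
    ∃ s : Simplex C (n + 1), s.base = u ∧ s.lastEdge = g ∧ ∀ i, s.lastCe i.castSucc = α i := by
  let α' : Fin (n + 1) → C.Ce := Fin.lastCases (C.idc g) α
  have h1 : α' (Fin.last n) = C.idc g := Fin.lastCases_last
  have h2 (i : Fin n) : α' i.castSucc = α i := Fin.lastCases_castSucc _
  have hα' (i) : C.cod (α' i) = C.cm g (u.pre.ar i (Fin.last n)) := by
    rw [pre_ar (Fin.le_last _)]
    induction i using Fin.lastCases with
    | last => rw [h1, C.cod_idc, u.ar_self, cm_one hg]
    | cast i => rw [h2, hα]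
  refine ⟨(cone u g α' hC hg.symm hα' h1).toSimplex (cone_coh hC hg.symm hα' h1), ?_, ?_, ?_⟩
  · refine ext_ce fun i j k hij hjk => ?_
    change (cone u g α' hC hg.symm hα' h1).ce i.castSucc j.castSucc k.castSucc = _
    rw [← pre_ce hij hjk]
    simp [cone]
  · change (cone u g α' hC hg.symm hα' h1).ar (Fin.last n).castSucc (Fin.last (n + 1)) = _
    simp [cone, h1, C.dom_idc]
  · intro i
    change (cone u g α' hC hg.symm hα' h1).ce i.castSucc.castSucc (Fin.last n).castSucc
      (Fin.last (n + 1)) = _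
    simp [cone, coneCe_last hC hg.symm hα' h1, h2]

end TwoCat.Simplex

namespace LieTwoCat

open SmoothStr TwoCat

variable {C : LieTwoCat.{u}} {n : ℕ}

/-- The manifold of `(n + 1)`-simplices, as a fibre product: the cones with a given base and last
edge are parametrized by `n` 2-cells of which the codomain is prescribed. -/
lemma exists_simplexStr_succ (hC : C.CellsInvertible) {S : SmoothStr (Simplex C.toTwoCat n)}
    (hS : EmbedsIn S (pi fun _ => C.ceStr) cells) : ∃ S : SmoothStr (Simplex C.toTwoCat (n + 1)),
    EmbedsIn S (pi fun _ => C.ceStr) cells := by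
  let P := {p : Simplex C.toTwoCat n × C.Ar // p.1.ob (Fin.last n) = C.src p.2}
  obtain ⟨Q, hQ, -⟩ := exists_fibreProduct (P := P) (smoothNear_ob hS (Fin.last n))
    C.smoothNear_src (fun y => ((isSurjSubmersion_iff.1 C.src_submersion).2 y).2) Subtype.val
    Subtype.val_injective fun p => ⟨by rintro ⟨q, rfl⟩; exact q.2, fun h => ⟨⟨p, h⟩, rfl⟩⟩
  have hQ1 (q : P) : SmoothNear Q S (fun q => q.1.1) q :=
    SmoothNear.comp (smoothNear_fst _) (hQ.smooth q)
  have hQ2 (q : P) : SmoothNear Q C.arStr (fun q => q.1.2) q :=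
    SmoothNear.comp (smoothNear_snd _) (hQ.smooth q)
  have hQ3 (q : P) : SmoothNear Q (pi fun _ => C.arStr) (fun q (i : Fin n) =>
      C.cm q.1.2 (q.1.1.ar i.castSucc (Fin.last n) (Fin.le_last _))) q := by
    refine SmoothNear.pi fun i => smoothAlong_id_iff.1 (smoothAlong_cm (smoothAlong_id_iff.2 (hQ2 q))
      (smoothAlong_id_iff.2 ?_) (Eventually.of_forall fun z => ?_))
    · exact SmoothNear.comp (f := fun q : P => q.1.1) (smoothNear_ar hS _ _) (hQ1 q)
    · rw [Simplex.tgt_ar, z.2]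
  let ι : Simplex C.toTwoCat (n + 1) → P × (Fin n → C.Ce) := fun s =>
    (⟨(s.base, s.lastEdge), s.src_lastEdge.symm⟩, fun i => s.lastCe i.castSucc)
  obtain ⟨T, hT, -⟩ := exists_fibreProduct (T := pi fun _ : Fin n => C.ceStr) hQ3
    (g := fun (α : Fin n → C.Ce) i => C.cod (α i))
    (fun α => SmoothNear.pi fun i => SmoothNear.comp (f := fun α : Fin n → C.Ce => α i)
      (C.smoothNear_cod _) (smoothNear_apply i α))
    (fun α => HasSection.pi fun i => ((isSurjSubmersion_iff.1 C.cod_submersion).2 (α i)).2) ι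
    (fun s t h => Simplex.ext_base hC (congrArg (fun p => p.1.1.1) h)
      (congrArg (fun p => p.1.1.2) h) fun i => congrArg (fun p => p.2 i) h)
    (fun p => by
      constructor
      · rintro ⟨s, rfl⟩
        exact funext fun i => (s.cod_lastCe _).symm
      · obtain ⟨⟨⟨u, g⟩, hg⟩, α⟩ := p
        intro h
        obtain ⟨s, rfl, rfl, h2⟩ := Simplex.exists_of_base hC u g α hg (congrFun h)
        exact ⟨s, Prod.ext rfl (funext h2)⟩)
  have hT1 (s) : SmoothNear T Q (fun s => (ι s).1) s :=
    SmoothNear.comp (smoothNear_fst _) (hT.smooth s)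
  have hbase (s) : SmoothNear T S Simplex.base s :=
    SmoothNear.comp (f := fun s => (ι s).1) (hQ1 _) (hT1 s)
  have hedge (s) : SmoothNear T C.arStr Simplex.lastEdge s :=
    SmoothNear.comp (f := fun s => (ι s).1) (hQ2 _) (hT1 s)
  have hlast (s i) : SmoothNear T C.ceStr (fun s => s.lastCe i) s := by
    induction i using Fin.lastCases with
    | last =>
      simp only [Simplex.lastCe_last]
      exact (C.smoothNear_idc _).comp (hedge s)
    | cast i =>
      exact SmoothNear.comp (f := ι) (SmoothNear.comp (g := fun α : Fin n → C.Ce => α i)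
        (smoothNear_apply i _) (smoothNear_snd _)) (hT.smooth s)
  refine ⟨T, hT.of_smoothAlong (fun s => ?_) fun s => ?_⟩
  · have hbce (i j k hij hjk) : SmoothNear T C.ceStr (fun s => s.base.ce i j k hij hjk) s :=
      SmoothNear.comp (smoothNear_ce hS hij hjk _) (hbase s)
    have hbar (i j hij) : SmoothNear T C.arStr (fun s => s.base.ar i j hij) s :=
      SmoothNear.comp (smoothNear_ar hS hij _) (hbase s)
    refine SmoothNear.pi fun a => ?_
    have h01 : a 0 ≤ a 1 := a.monotone (by decide)
    have h12 : a 1 ≤ a 2 := a.monotone (by decide)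
    change SmoothNear T C.ceStr (fun s => s.ce (a 0) (a 1) (a 2) h01 h12) s
    generalize a 0 = i, a 1 = j, a 2 = k at h01 h12
    have har (i j hij) : SmoothNear T C.arStr (fun s => s.ar i j hij) s := by
      induction j using Fin.lastCases with
      | last =>
        induction i using Fin.lastCases with
        | last =>
          refine ((C.smoothNear_one _).comp ((C.smoothNear_tgt _).comp (hedge s))).congr
            (Eventually.of_forall fun s => ?_)
          rw [s.ar_self]
          exact congrArg C.one (s.tgt_ar _ _ _)
        | cast i =>
          simp only [Simplex.ar_last]
          exact (C.smoothNear_dom _).comp (hlast s i)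
      | cast j =>
        induction i using Fin.lastCases with
        | last => exact absurd (hij.trans_lt (Fin.castSucc_lt_last j)) (lt_irrefl _)
        | cast i => exact hbar i j hij
    induction k using Fin.lastCases with
    | cast k =>
      induction j using Fin.lastCases with
      | last => exact absurd (h12.trans_lt (Fin.castSucc_lt_last k)) (lt_irrefl _)
      | cast j =>
      induction i using Fin.lastCases with
      | last => exact absurd (h01.trans_lt (Fin.castSucc_lt_last j)) (lt_irrefl _)
      | cast i => exact hbce i j k h01 h12
    | last =>
      induction j using Fin.lastCases with
      | last =>
        simp only [Simplex.ce_right]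
        exact (C.smoothNear_idc _).comp (har _ _ _)
      | cast j =>
      induction i using Fin.lastCases with
      | last => exact absurd (h01.trans_lt (Fin.castSucc_lt_last j)) (lt_irrefl _)
      | cast i =>
      have hij : i ≤ j := h01
      have e1 (s : Simplex C.toTwoCat (n + 1)) : C.src s.lastEdge =
          C.tgt (C.dom (s.base.ce i j (Fin.last n) hij (Fin.le_last _))) := by
        rw [s.src_lastEdge, s.base.dom_ce, s.base.tgt_ar]
      have e2 (s : Simplex C.toTwoCat (n + 1)) : C.dom (C.wl s.lastEdge
          (s.base.ce i j (Fin.last n) hij (Fin.le_last _))) = C.cod (s.lastCe i) := by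
        rw [dom_wl (e1 s), s.base.dom_ce, s.cod_lastCe]
      have e3 (s : Simplex C.toTwoCat (n + 1)) :
          C.src (C.dom (s.lastCe j)) = C.tgt (s.base.ar i j hij) := by
        rw [← s.ar_last, s.src_ar, s.base.tgt_ar]
        rfl
      simp only [fun s => Simplex.ce_last (C := C.toTwoCat) s hC i j hij]
      simp only [← smoothAlong_id_iff] at *
      refine smoothAlong_vc (smoothAlong_iv hC (smoothAlong_wr (hlast s j) (hbar i j hij)
        (Eventually.of_forall e3))) (smoothAlong_vc (smoothAlong_wl (hedge s)
        (hbce i j _ hij (Fin.le_last _)) (Eventually.of_forall e1)) (hlast s i)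
        (Eventually.of_forall e2)) (Eventually.of_forall fun s => ?_)
      rw [dom_iv hC, cod_wr (e3 s), cod_vc (e2 s), cod_wl (e1 s), s.base.cod_ce, s.cod_lastCe,
        ← cm_eq, cm_assoc]
      · rw [s.src_lastEdge, s.base.tgt_ar]
      · rw [s.base.src_ar, s.base.tgt_ar]
  · refine SmoothAlong.prodMk (hQ.smoothAlong (SmoothAlong.prodMk ?_ ?_)) (SmoothAlong.pi fun i => ?_)
    · exact smoothAlong_simplex hS (fun i => smoothAlong_cells_ob _ _)
        (fun i j h => smoothAlong_cells_ar _ _) (fun i j k h h' => smoothAlong_cells_ce _ _ _)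
    · exact smoothAlong_cells_ar _ _
    · exact smoothAlong_cells_ce _ _ _

lemma exists_simplexStr (hC : C.CellsInvertible) (n : ℕ) :
    ∃ S : SmoothStr (Simplex C.toTwoCat n), EmbedsIn S (pi fun _ => C.ceStr) cells := by
  induction n with
  | zero => exact exists_simplexStr_zero C
  | succ n ih =>
    obtain ⟨S, hS⟩ := ih
    exact exists_simplexStr_succ hC hS

lemma exists_isNerveStr (hC : C.CellsInvertible) :
    ∃ S : ∀ n : ℕ, SmoothStr (C.nerve _⦋n⦌), C.IsNerveStr S := by
  choose S hS using exists_simplexStr hC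
  exact ⟨S, isNerveStr_iff.2 hS⟩

lemma isSimplicialManifold {S : ∀ n : ℕ, SmoothStr (C.nerve _⦋n⦌)} (hS : C.IsNerveStr S) :
    C.nerve.IsSimplicialManifold S := by
  rw [isNerveStr_iff] at hS
  intro m n a
  rw [isSmooth_iff]
  intro u
  exact smoothNear_simplex (hS m) (c := C.nerve.map a.op) (fun i => smoothNear_ob (hS n) _ u)
    (fun i j h => smoothNear_ar (hS n) _ u) (fun i j k h h' => smoothNear_ce (hS n) _ _ u)

end LieTwoCat

namespace TwoCat

/-! ### Whiskering by an equivalence -/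

section Whisker

variable {C : TwoCat.{u}} {f f' g k k' : C.Ar} {α β γ δ ε η : C.Ce}

variable (C) in
/-- `ε : 1 ⇒ f ∘ f'` exhibits `f'` as a right inverse of the arrow `f`, up to a 2-cell. -/
structure IsRightInv (f f' : C.Ar) (ε : C.Ce) : Prop where
  tgt_eq : C.tgt f' = C.src f
  dom_eq : C.dom ε = C.one (C.tgt f)
  cod_eq : C.cod ε = C.cm f f'

variable (C) in
/-- `η : 1 ⇒ f' ∘ f` exhibits `f'` as a left inverse of the arrow `f`, up to a 2-cell. -/
structure IsLeftInv (f f' : C.Ar) (η : C.Ce) : Prop where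
  src_eq : C.src f' = C.tgt f
  dom_eq : C.dom η = C.one (C.src f)
  cod_eq : C.cod η = C.cm f' f

/-- The 2-cell `k ⇒ k ∘ f ∘ f' ⇒ k' ∘ f ∘ f' ⇒ k'` given by a right inverse `(f', ε)` of `f` and by
`δ : k ∘ f ⇒ k' ∘ f`. If `f'` has a right inverse, it is the only 2-cell `k ⇒ k'` whose right
whiskering by `f` is `δ`. -/
noncomputable def unwr (f' : C.Ar) (ε : C.Ce) (k k' : C.Ar) (δ : C.Ce) : C.Ce :=
  C.vc (C.iv (C.wl k' ε)) (C.vc (C.wr δ f') (C.wl k ε))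

/-- The 2-cell `k ⇒ f' ∘ f ∘ k ⇒ f' ∘ f ∘ k' ⇒ k'` given by a left inverse `(f', η)` of `f` and by
`δ : f ∘ k ⇒ f ∘ k'`. If `f'` has a left inverse, it is the only 2-cell `k ⇒ k'` whose left
whiskering by `f` is `δ`. -/
noncomputable def unwl (f' : C.Ar) (η : C.Ce) (k k' : C.Ar) (δ : C.Ce) : C.Ce :=
  C.vc (C.iv (C.wr η k')) (C.vc (C.wl f' δ) (C.wr η k))

lemma IsRightInv.src_eq (h : C.IsRightInv f f' ε) : C.src f' = C.tgt f := by
  rw [← src_cm h.tgt_eq.symm, ← h.cod_eq, C.src_cod, h.dom_eq, C.src_one]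

section Right

variable (h : C.IsRightInv f f' ε) (hk : C.src k = C.tgt f) (hk' : C.src k' = C.tgt f)
include h hk hk'

lemma IsRightInv.dom_unwr (hC : C.CellsInvertible) (hd : C.dom δ = C.cm k f)
    (hc : C.cod δ = C.cm k' f) :
    C.dom (C.unwr f' ε k k' δ) = k ∧ C.cod (C.unwr f' ε k k' δ) = k' := by
  have e1 : C.tgt (C.dom ε) = C.tgt f := by rw [h.dom_eq, C.tgt_one]
  have e2 : C.tgt f = C.tgt (C.dom ε) := e1.symm
  have e3 := h.tgt_eq
  rw [unwr]
  constructor <;>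
  simp (maxDischargeDepth := 8) only [dom_iv hC, cod_iv hC, dom_vc, cod_vc, dom_wl, cod_wl,
    dom_wr, cod_wr, hk, hk', e1, src_cm, tgt_cm, cm_assoc, hd, hc, h.cod_eq, e3] <;>
  rw [h.dom_eq, cm_one (by simp only [hk, hk'])]

/-- The interchange law, for a 2-cell and a right inverse up to a 2-cell. -/
lemma IsRightInv.interchange (hd : C.dom γ = k) (hc : C.cod γ = k') :
    C.vc (C.wl k' ε) γ = C.vc (C.wr (C.wr γ f) f') (C.wl k ε) := by
  have e := vc_wl_wr (C := C) (β := γ) (α := ε) (by rw [hd, hk, h.dom_eq, C.tgt_one])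
  rwa [hd, hc, h.dom_eq, wr_one (by rw [hd, hk]), h.cod_eq,
    ← wr_wr (by rw [hd, hk]) h.tgt_eq.symm] at e

lemma IsRightInv.unwr_wr (hC : C.CellsInvertible) (hd : C.dom γ = k) (hc : C.cod γ = k') :
    C.unwr f' ε k k' (C.wr γ f) = γ := by
  rw [unwr, ← h.interchange hk hk' hd hc, iv_vc_cancel hC]
  rw [dom_wl (by rw [hk', h.dom_eq, C.tgt_one]), h.dom_eq, cm_one hk'.symm, hc]

lemma IsRightInv.wr_unwr (hC : C.CellsInvertible) {f'' : C.Ar} {ε' : C.Ce}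
    (h' : C.IsRightInv f' f'' ε') (hd : C.dom δ = C.cm k f) (hc : C.cod δ = C.cm k' f) :
    C.wr (C.unwr f' ε k k' δ) f = δ := by
  obtain ⟨e1, e2⟩ := h.dom_unwr hk hk' hC hd hc
  have e3 : C.src (C.cm k f) = C.tgt f' := by rw [src_cm hk, h.tgt_eq]
  have e4 : C.src (C.cm k' f) = C.tgt f' := by rw [src_cm hk', h.tgt_eq]
  have e5 : C.src (C.dom (C.unwr f' ε k k' δ)) = C.tgt f := by rw [e1, hk]
  have e6 : C.dom (C.wr (C.unwr f' ε k k' δ) f) = C.cm k f := by rw [dom_wr e5, e1]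
  have e7 : C.cod (C.wr (C.unwr f' ε k k' δ) f) = C.cm k' f := by rw [cod_wr e5, e2]
  have e8 : C.dom (C.wl k ε) = k := by
    rw [dom_wl (by rw [hk, h.dom_eq, C.tgt_one]), h.dom_eq, cm_one hk.symm]
  have e9 : C.cod (C.wl k ε) = C.cm (C.cm k f) f' := by
    rw [cod_wl (by rw [hk, h.dom_eq, C.tgt_one]), h.cod_eq, cm_assoc hk h.tgt_eq.symm]
  -- whiskering by `f'` is faithful, and the two sides agree after this whiskering
  refine ((h'.unwr_wr e3 e4 hC e6 e7).symm.trans (congrArg _ ?_)).trans (h'.unwr_wr e3 e4 hC hd hc)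
  rw [← vc_right_cancel hC (γ := C.wl k ε), ← h.interchange hk hk' e1 e2]
  · rw [unwr, vc_iv_cancel hC]
    rw [cod_wl, cod_vc, cod_wr, hc, h.cod_eq, cm_assoc hk' h.tgt_eq.symm]
    all_goals simp (maxDischargeDepth := 8) only [dom_wr, hd, e3, e9, hk', h.dom_eq, C.tgt_one]
  · rw [dom_wr, e6, e9]; rw [e6, e3]
  · rw [dom_wr, hd, e9]; rw [hd, e3]

end Right

section Left

variable (h : C.IsLeftInv f f' η) (hk : C.tgt k = C.src f) (hk' : C.tgt k' = C.src f)
include h hk hk'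

lemma IsLeftInv.dom_unwl (hC : C.CellsInvertible) (hd : C.dom δ = C.cm f k)
    (hc : C.cod δ = C.cm f k') :
    C.dom (C.unwl f' η k k' δ) = k ∧ C.cod (C.unwl f' η k k' δ) = k' := by
  have e1 : C.src (C.dom η) = C.src f := by rw [h.dom_eq, C.src_one]
  have e3 := h.src_eq
  rw [unwl]
  constructor <;>
  simp (maxDischargeDepth := 8) only [dom_iv hC, cod_iv hC, dom_vc, cod_vc, dom_wl, cod_wl,
    dom_wr, cod_wr, hk, hk', e1, src_cm, tgt_cm, cm_assoc, hd, hc, h.cod_eq, e3] <;>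
  rw [h.dom_eq, one_cm (by simp only [hk, hk'])]

/-- The interchange law, for a 2-cell and a left inverse up to a 2-cell. -/
lemma IsLeftInv.interchange (hd : C.dom γ = k) (hc : C.cod γ = k') :
    C.vc (C.wr η k') γ = C.vc (C.wl f' (C.wl f γ)) (C.wr η k) := by
  have e := vc_wl_wr (C := C) (β := η) (α := γ) (by rw [hd, hk, h.dom_eq, C.src_one])
  rw [hd, hc, h.dom_eq, wl_one (by rw [hd, hk]), h.cod_eq,
    ← wl_wl h.src_eq (by rw [hd, hk])] at e
  exact e.symm

lemma IsLeftInv.unwl_wl (hC : C.CellsInvertible) (hd : C.dom γ = k) (hc : C.cod γ = k') :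
    C.unwl f' η k k' (C.wl f γ) = γ := by
  rw [unwl, ← h.interchange hk hk' hd hc, iv_vc_cancel hC]
  rw [dom_wr (by rw [hk', h.dom_eq, C.src_one]), h.dom_eq, one_cm hk'.symm, hc]

lemma IsLeftInv.wl_unwl (hC : C.CellsInvertible) {f'' : C.Ar} {η' : C.Ce}
    (h' : C.IsLeftInv f' f'' η') (hd : C.dom δ = C.cm f k) (hc : C.cod δ = C.cm f k') :
    C.wl f (C.unwl f' η k k' δ) = δ := by
  obtain ⟨e1, e2⟩ := h.dom_unwl hk hk' hC hd hc
  have e3 : C.tgt (C.cm f k) = C.src f' := by rw [tgt_cm hk.symm, h.src_eq]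
  have e4 : C.tgt (C.cm f k') = C.src f' := by rw [tgt_cm hk'.symm, h.src_eq]
  have e5 : C.src f = C.tgt (C.dom (C.unwl f' η k k' δ)) := by rw [e1, hk]
  have e6 : C.dom (C.wl f (C.unwl f' η k k' δ)) = C.cm f k := by rw [dom_wl e5, e1]
  have e7 : C.cod (C.wl f (C.unwl f' η k k' δ)) = C.cm f k' := by rw [cod_wl e5, e2]
  have e9 : C.cod (C.wr η k) = C.cm f' (C.cm f k) := by
    rw [cod_wr (by rw [hk, h.dom_eq, C.src_one]), h.cod_eq, cm_assoc h.src_eq hk.symm]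
  -- whiskering by `f'` is faithful, and the two sides agree after this whiskering
  refine ((h'.unwl_wl e3 e4 hC e6 e7).symm.trans (congrArg _ ?_)).trans (h'.unwl_wl e3 e4 hC hd hc)
  rw [← vc_right_cancel hC (γ := C.wr η k), ← h.interchange hk hk' e1 e2]
  · rw [unwl, vc_iv_cancel hC]
    rw [cod_wr, cod_vc, cod_wl, hc, h.cod_eq, cm_assoc h.src_eq hk'.symm]
    all_goals simp (maxDischargeDepth := 8) only [dom_wl, hd, e3, e9, hk', h.dom_eq, C.src_one]
  · rw [dom_wl, e6, e9]; rw [e6, e3]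
  · rw [dom_wl, hd, e9]; rw [hd, e3]

end Left

lemma isomorphic_iff (hC : C.CellsInvertible) :
    C.Isomorphic f g ↔ ∃ α, C.dom α = f ∧ C.cod α = g :=
  ⟨fun ⟨α, _, h1, h2, _⟩ => ⟨α, h1, h2⟩, fun ⟨α, h1, h2⟩ => ⟨α, _, h1, h2, (hC α).choose_spec⟩⟩

/-- If all arrows have left and right inverses up to 2-cells, the 2-category is a 2-groupoid: left
and right inverses of an arrow are isomorphic. -/
lemma isTwoGroupoid_of_inverses (hC : C.CellsInvertible)
    (hR : ∀ f : C.Ar, ∃ f' ε, C.IsRightInv f f' ε) (hL : ∀ f : C.Ar, ∃ f' η, C.IsLeftInv f f' η) :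
    C.IsTwoGroupoid := by
  refine ⟨hC, fun f => ?_⟩
  obtain ⟨r, ε, h⟩ := hR f
  obtain ⟨l, η, h'⟩ := hL f
  refine ⟨r, h.tgt_eq.symm, h.src_eq, ?_, ?_⟩
  · rw [isomorphic_iff hC]
    exact ⟨C.iv ε, by rw [dom_iv hC, h.cod_eq, cm_eq], by rw [cod_iv hC, h.dom_eq]⟩
  · rw [isomorphic_iff hC]
    have e1 : C.src (C.dom η) = C.tgt r := by rw [h'.dom_eq, C.src_one, h.tgt_eq]
    have e2 : C.src l = C.tgt (C.dom ε) := by rw [h'.src_eq, h.dom_eq, C.tgt_one]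
    -- the composite `r ⇒ l ∘ f ∘ r ⇒ l`
    have e3 : C.dom (C.iv (C.wl l ε)) = C.cod (C.wr η r) := by
      rw [dom_iv hC, cod_wl e2, cod_wr e1, h'.cod_eq, h.cod_eq,
        cm_assoc h'.src_eq h.tgt_eq.symm]
    have e4 : C.dom (C.vc (C.iv (C.wl l ε)) (C.wr η r)) = r := by
      rw [dom_vc e3, dom_wr e1, h'.dom_eq, one_cm h.tgt_eq.symm]
    have e5 : C.cod (C.vc (C.iv (C.wl l ε)) (C.wr η r)) = l := by
      rw [cod_vc e3, cod_iv hC, dom_wl e2, h.dom_eq, cm_one h'.src_eq.symm]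
    have e6 : C.src (C.dom (C.vc (C.iv (C.wl l ε)) (C.wr η r))) = C.tgt f := by rw [e4, h.src_eq]
    have e7 : C.dom (C.iv η) = C.cod (C.wr (C.vc (C.iv (C.wl l ε)) (C.wr η r)) f) := by
      rw [dom_iv hC, h'.cod_eq, cod_wr e6, e5]
    exact ⟨C.vc (C.iv η) (C.wr (C.vc (C.iv (C.wl l ε)) (C.wr η r)) f),
      by rw [dom_vc e7, dom_wr e6, e4, cm_eq], by rw [cod_vc e7, cod_iv hC, h'.dom_eq]⟩

end Whisker

end TwoCat

namespace TwoCat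

/-! ### Horns in the nerve -/

variable {C : TwoCat.{u}} {m n : ℕ}

/-- The monotone map `a : [m] → [n]` belongs to the horn `Λ[n, k]`: it misses a vertex other
than `k`. -/
def InHorn {n : ℕ} (k : Fin (n + 1)) (a : Fin (m + 1) →o Fin (n + 1)) : Prop :=
  ∃ i, i ≠ k ∧ ∀ x, a x ≠ i

/-- The simplex of a horn in the nerve at a monotone map that belongs to the horn. -/
def hornSimplex {k : Fin (n + 1)} (h : (Λ[n, k] : SSet.{u}) ⟶ C.nerve)
    (a : Fin (m + 1) →o Fin (n + 1)) (ha : InHorn k a) : Simplex C m :=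
  h.app (op ⦋m⦌) ⟨SSet.stdSimplex.objMk (n := ⦋n⦌) (m := op ⦋m⦌) a, by
    rw [SSet.mem_horn_iff_notMem_range]
    obtain ⟨i, hi, hx⟩ := ha
    exact ⟨i, hi, by rintro ⟨x, h⟩; exact hx x h⟩⟩

lemma pullback_hornSimplex {k : Fin (n + 1)} (h : (Λ[n, k] : SSet.{u}) ⟶ C.nerve)
    {a : Fin (m + 1) →o Fin (n + 1)} (ha : InHorn k a) {l : ℕ} (b : Fin (l + 1) →o Fin (m + 1))
    (hab : InHorn k (a.comp b)) :
    (hornSimplex h a ha).pullback b = hornSimplex h (a.comp b) hab :=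
  (NatTrans.naturality_apply h (Quiver.Hom.op (V := SimplexCategory) (X := ⦋l⦌) (Y := ⦋m⦌)
    (SimplexCategory.Hom.mk b)) _).symm

lemma hornSimplex_hornRestriction {k : Fin (n + 1)} (u : Simplex C n)
    (a : Fin (m + 1) →o Fin (n + 1)) (ha : InHorn k a) :
    hornSimplex (SSet.hornRestriction C.nerve n k u) a ha = u.pullback a := rfl

lemma inHorn_succAbove {k i : Fin (n + 2)} (hi : i ≠ k) :
    InHorn k (Fin.succAboveOrderEmb i).toOrderHom := ⟨i, hi, fun x => Fin.succAbove_ne i x⟩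

lemma yonedaEquiv_horn_ι {k i : Fin (n + 2)} (hi : i ≠ k)
    (h : (Λ[n + 1, k] : SSet.{u}) ⟶ C.nerve) : SSet.yonedaEquiv (SSet.horn.ι k i hi ≫ h) =
      hornSimplex h (Fin.succAboveOrderEmb i).toOrderHom (inHorn_succAbove hi) := by
  rw [SSet.yonedaEquiv_comp, SSet.horn.yonedaEquiv_ι]
  rfl

lemma horn_ext {k : Fin (n + 2)} {h h' : (Λ[n + 1, k] : SSet.{u}) ⟶ C.nerve}
    (e : ∀ i (hi : i ≠ k), hornSimplex h (Fin.succAboveOrderEmb i).toOrderHom (inHorn_succAbove hi) =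
      hornSimplex h' (Fin.succAboveOrderEmb i).toOrderHom (inHorn_succAbove hi)) : h = h' := by
  refine SSet.horn.hom_ext' fun i hi => SSet.yonedaEquiv.injective ?_
  exact (yonedaEquiv_horn_ι hi h).trans ((e i hi).trans (yonedaEquiv_horn_ι hi h').symm)

/-- The order preserving map `[1] → [n]` with the given values. -/
def pair {i j : Fin (n + 1)} (hij : i ≤ j) : Fin 2 →o Fin (n + 1) where
  toFun := ![i, j]
  monotone' := by
    rw [Fin.monotone_iff_le_succ]
    intro x
    fin_cases x
    exact hij

/-- The order preserving map `[3] → [n]` with the given values. -/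
def quadruple {i j k l : Fin (n + 1)} (hij : i ≤ j) (hjk : j ≤ k) (hkl : k ≤ l) :
    Fin 4 →o Fin (n + 1) where
  toFun := ![i, j, k, l]
  monotone' := by
    rw [Fin.monotone_iff_le_succ]
    intro x
    fin_cases x
    exacts [hij, hjk, hkl]

section Fill

lemma exists_ne_three (k i j : Fin (n + 4)) : ∃ a, a ≠ k ∧ a ≠ i ∧ a ≠ j := by
  have h : ({k, i, j} : Finset (Fin (n + 4))).card < (Finset.univ : Finset (Fin (n + 4))).card := by
    refine Finset.card_le_three.trans_lt ?_
    rw [Finset.card_univ, Fintype.card_fin]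
    omega
  obtain ⟨a, -, ha⟩ := Finset.exists_mem_notMem_of_card_lt_card h
  exact ⟨a, by simpa using ha⟩

lemma inHorn_pair (k : Fin (n + 4)) {i j : Fin (n + 4)} (hij : i ≤ j) :
    InHorn k (pair hij) := by
  obtain ⟨a, h1, h2, h3⟩ := exists_ne_three k i j
  refine ⟨a, h1, fun x => ?_⟩
  fin_cases x
  exacts [h2.symm, h3.symm]

variable {k : Fin (n + 4)} (h : (Λ[n + 3, k] : SSet.{u}) ⟶ C.nerve) (x : C.Ce)

/-- The vertices of a horn of dimension at least three. -/
def vert (i : Fin (n + 4)) : C.Ob :=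
  (hornSimplex h (pair (le_refl i)) (inHorn_pair k _)).ob 0

open Classical in
/-- The edges of a horn of dimension at least three. -/
noncomputable def edge (i j : Fin (n + 4)) : C.Ar :=
  if hij : i ≤ j then
    (hornSimplex h (pair hij) (inHorn_pair k hij)).ar 0 1 (by decide) else C.one (vert h i)

open Classical in
/-- The 2-cells of the triangles of a horn of dimension at least three, with the value `x` for the
triangle that may be missing. -/
noncomputable def tri (i j l : Fin (n + 4)) : C.Ce :=
  if H : ∃ (hij : i ≤ j) (hjl : j ≤ l), InHorn k (triple hij hjl) then
    (hornSimplex h (triple H.1 H.2.1) H.2.2).ce 0 1 2 (by decide) (by decide) else x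

variable {a : Fin (m + 1) →o Fin (n + 4)} (ha : InHorn k a)

lemma InHorn.comp {n : ℕ} {k : Fin (n + 1)} {a : Fin (m + 1) →o Fin (n + 1)} (ha : InHorn k a)
    {l : ℕ} (b : Fin (l + 1) →o Fin (m + 1)) : InHorn k (a.comp b) := by
  obtain ⟨i, hi, h⟩ := ha
  exact ⟨i, hi, fun x => h (b x)⟩

lemma hornSimplex_ar {p q : Fin (m + 1)} (hpq : p ≤ q) :
    (hornSimplex h a ha).ar p q hpq = edge h (a p) (a q) := by
  have e : a.comp (pair hpq) = pair (a.monotone hpq) := by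
    ext x
    fin_cases x <;> rfl
  have e1 := pullback_hornSimplex h ha (pair hpq) (ha.comp _)
  rw [edge, dif_pos (a.monotone hpq)]
  simp only [← e]
  rw [← e1]
  rfl

lemma hornSimplex_ob (p : Fin (m + 1)) : (hornSimplex h a ha).ob p = vert h (a p) := by
  have e : a.comp (pair (le_refl p)) = pair (le_refl (a p)) := by
    ext x
    fin_cases x <;> rfl
  have e1 := pullback_hornSimplex h ha (pair (le_refl p)) (ha.comp _)
  rw [vert]
  simp only [← e]
  rw [← e1]
  rfl

lemma hornSimplex_ce {p q r : Fin (m + 1)} (hpq : p ≤ q) (hqr : q ≤ r) :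
    (hornSimplex h a ha).ce p q r hpq hqr = tri h x (a p) (a q) (a r) := by
  have e : a.comp (triple hpq hqr) = triple (a.monotone hpq) (a.monotone hqr) := by
    ext x
    fin_cases x <;> rfl
  have e1 := pullback_hornSimplex h ha (triple hpq hqr) (ha.comp _)
  rw [tri, dif_pos ⟨a.monotone hpq, a.monotone hqr, by rw [← e]; exact ha.comp _⟩]
  simp only [← e]
  rw [← e1]
  rfl

variable {x}

lemma src_edge {i j : Fin (n + 4)} (hij : i ≤ j) : C.src (edge h i j) = vert h i := by
  have e := hornSimplex_ar h (inHorn_pair k hij) (p := 0) (q := 1) (by decide)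
  exact (congrArg C.src e).symm.trans ((Simplex.src_ar _ _ _ _).trans (hornSimplex_ob h _ _))

lemma tgt_edge {i j : Fin (n + 4)} (hij : i ≤ j) : C.tgt (edge h i j) = vert h j := by
  have e := hornSimplex_ar h (inHorn_pair k hij) (p := 0) (q := 1) (by decide)
  exact (congrArg C.tgt e).symm.trans ((Simplex.tgt_ar _ _ _ _).trans (hornSimplex_ob h _ _))

lemma edge_self (i : Fin (n + 4)) : edge h i i = C.one (vert h i) := by
  have e := hornSimplex_ar h (inHorn_pair k (le_refl i)) (p := 0) (q := 0) (le_refl _)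
  exact e.symm.trans ((Simplex.ar_self _ _).trans (congrArg C.one (hornSimplex_ob h _ _)))

variable (x)

lemma dom_tri {i j l : Fin (n + 4)} (hij : i ≤ j) (hjl : j ≤ l) (H : InHorn k (triple hij hjl)) :
    C.dom (tri h x i j l) = edge h i l := by
  have e := hornSimplex_ce h x H (p := 0) (q := 1) (r := 2) (by decide) (by decide)
  exact (congrArg C.dom e).symm.trans ((Simplex.dom_ce _ _ _ _ _ _).trans (hornSimplex_ar h _ _))

lemma cod_tri {i j l : Fin (n + 4)} (hij : i ≤ j) (hjl : j ≤ l) (H : InHorn k (triple hij hjl)) :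
    C.cod (tri h x i j l) = C.cm (edge h j l) (edge h i j) := by
  have e := hornSimplex_ce h x H (p := 0) (q := 1) (r := 2) (by decide) (by decide)
  refine (congrArg C.cod e).symm.trans ((Simplex.cod_ce _ _ _ _ _ _).trans ?_)
  rw [← cm_eq, hornSimplex_ar, hornSimplex_ar]
  rfl

lemma tri_left {i l : Fin (n + 4)} (hil : i ≤ l) : tri h x i i l = C.idc (edge h i l) := by
  have e := hornSimplex_ce h x (inHorn_pair k hil) (p := 0) (q := 0) (r := 1) le_rfl (by decide)
  exact e.symm.trans ((Simplex.ce_left _ _ _ _).trans (congrArg C.idc (hornSimplex_ar h _ _)))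

lemma tri_right {i l : Fin (n + 4)} (hil : i ≤ l) : tri h x i l l = C.idc (edge h i l) := by
  have e := hornSimplex_ce h x (inHorn_pair k hil) (p := 0) (q := 1) (r := 1) (by decide) le_rfl
  exact e.symm.trans ((Simplex.ce_right _ _ _ _).trans (congrArg C.idc (hornSimplex_ar h _ _)))

/-- The 2-cell `x` has the right boundary to be the value at the missing triangle of a horn. (Only
horns of dimension three miss a triangle.) -/
def IsMissingCe : Prop := ∀ i j l (hij : i ≤ j) (hjl : j ≤ l), ¬ InHorn k (triple hij hjl) →
  C.dom x = edge h i l ∧ C.cod x = C.cm (edge h j l) (edge h i j)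

variable {x}

/-- The simplex without coherence that consists of the vertices, edges and triangles of a horn, with
the 2-cell `x` for the triangle that may be missing. -/
noncomputable def fill (hx : IsMissingCe h x) : PreSimplex C (n + 3) where
  ob := vert h
  ar := edge h
  ce := tri h x
  src_ar := src_edge h
  tgt_ar := tgt_edge h
  ar_self := edge_self h
  dom_ce {i j l} hij hjl := by
    by_cases H : InHorn k (triple hij hjl)
    · exact dom_tri h x hij hjl H
    · rw [tri, dif_neg (fun H' => H H'.2.2)]
      exact (hx i j l hij hjl H).1
  cod_ce {i j l} hij hjl := by
    by_cases H : InHorn k (triple hij hjl)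
    · exact cod_tri h x hij hjl H
    · rw [tri, dif_neg (fun H' => H H'.2.2)]
      exact (hx i j l hij hjl H).2
  ce_left := tri_left h x
  ce_right := tri_right h x

variable {h}

lemma fill_coh (hx : IsMissingCe h x) {i j l m : Fin (n + 4)} (hij : i ≤ j) (hjl : j ≤ l)
    (hlm : l ≤ m) (H : InHorn k (quadruple hij hjl hlm)) : (fill h hx).Coh i j l m := by
  have e := Simplex.pre_coh (s := hornSimplex h _ H) (i := 0) (j := 1) (k := 2) (l := 3)
    (by decide) (by decide) (by decide)
  rw [PreSimplex.Coh] at e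
  rw [Simplex.pre_ar (by decide), Simplex.pre_ar (by decide), Simplex.pre_ce (by decide) (by decide),
    Simplex.pre_ce (by decide) (by decide), Simplex.pre_ce (by decide) (by decide),
    Simplex.pre_ce (by decide) (by decide)] at e
  simp only [hornSimplex_ar, fun p q r hpq hqr => hornSimplex_ce h x H (p := p) (q := q) (r := r)
    hpq hqr] at e
  exact e

lemma hornRestriction_fill (hx : IsMissingCe h x)
    (H : ∀ i j l m, i < j → j < l → l < m → (fill h hx).Coh i j l m) :
    SSet.hornRestriction C.nerve (n + 3) k ((fill h hx).toSimplex H) = h := by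
  refine horn_ext fun i hi => ?_
  rw [hornSimplex_hornRestriction]
  refine Simplex.ext_ce fun p q r hpq hqr => ?_
  rw [hornSimplex_ce h x]
  rfl

end Fill

/-- A simplex of dimension at least three is determined by the triangles of a horn, together with
the missing triangle. -/
lemma Simplex.ext_horn {k : Fin (n + 4)} {s t : Simplex C (n + 3)}
    (h : SSet.hornRestriction C.nerve (n + 3) k s = SSet.hornRestriction C.nerve (n + 3) k t)
    (H : ∀ i j l (hij : i ≤ j) (hjl : j ≤ l), ¬ InHorn k (triple hij hjl) →
      s.pre.ce i j l = t.pre.ce i j l) : s = t := by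
  refine Simplex.ext_ce fun i j l hij hjl => ?_
  by_cases ha : InHorn k (triple hij hjl)
  · have e : s.pullback (triple hij hjl) = t.pullback (triple hij hjl) := by
      rw [← hornSimplex_hornRestriction s _ ha, h, hornSimplex_hornRestriction]
    have e' (s : Simplex C (n + 3)) : s.ce i j l hij hjl =
      (s.pullback (triple hij hjl)).ce 0 1 2 (by decide) (by decide) := rfl
    rw [e', e', e]
  · rw [← pre_ce hij hjl, ← pre_ce hij hjl]
    exact H i j l hij hjl ha

end TwoCat

namespace TwoCat

/-! ### Filling horns of dimension at least four -/

variable {C : TwoCat.{u}} {n : ℕ}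

lemma inHorn_triple_of_ne {k a i j l : Fin (n + 1)} {hij : i ≤ j} {hjl : j ≤ l} (hk : a ≠ k)
    (hi : a ≠ i) (hj : a ≠ j) (hl : a ≠ l) : InHorn k (triple hij hjl) := by
  refine ⟨a, hk, fun x => ?_⟩
  fin_cases x
  exacts [hi.symm, hj.symm, hl.symm]

lemma inHorn_quadruple_of_ne {k a i j l m : Fin (n + 1)} {hij : i ≤ j} {hjl : j ≤ l} {hlm : l ≤ m}
    (hk : a ≠ k) (hi : a ≠ i) (hj : a ≠ j) (hl : a ≠ l) (hm : a ≠ m) :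
    InHorn k (quadruple hij hjl hlm) := by
  refine ⟨a, hk, fun x => ?_⟩
  fin_cases x
  exacts [hi.symm, hj.symm, hl.symm, hm.symm]

lemma exists_ne_four (k i j l : Fin (n + 5)) : ∃ a, a ≠ k ∧ a ≠ i ∧ a ≠ j ∧ a ≠ l := by
  have h : ({k, i, j, l} : Finset (Fin (n + 5))).card <
      (Finset.univ : Finset (Fin (n + 5))).card := by
    refine Finset.card_le_four.trans_lt ?_
    rw [Finset.card_univ, Fintype.card_fin]
    omega
  obtain ⟨a, -, ha⟩ := Finset.exists_mem_notMem_of_card_lt_card h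
  exact ⟨a, by simpa using ha⟩

/-- Horns of dimension at least four contain all triangles. -/
lemma inHorn_triple (k : Fin (n + 5)) {i j l : Fin (n + 5)} (hij : i ≤ j) (hjl : j ≤ l) :
    InHorn k (triple hij hjl) := by
  obtain ⟨a, hk, hi, hj, hl⟩ := exists_ne_four k i j l
  exact inHorn_triple_of_ne hk hi hj hl

/-- A horn of dimension at least four has a filler: it contains all 2-cells, and at most one
coherence equation is missing, which follows from the pentagon. -/
lemma exists_filler_of_four_le (hC : C.CellsInvertible) (k : Fin (n + 5))
    (hR : k = 0 → ∀ f : C.Ar, ∃ f' ε, C.IsRightInv f f' ε)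
    (hL : k = Fin.last (n + 4) → ∀ f : C.Ar, ∃ f' η, C.IsLeftInv f f' η)
    (h : (Λ[n + 4, k] : SSet.{u}) ⟶ C.nerve) :
    ∃ s, SSet.hornRestriction C.nerve (n + 4) k s = h := by
  have hx : IsMissingCe h (C.idc (C.one (vert h 0))) :=
    fun i j l hij hjl H => absurd (inHorn_triple k hij hjl) H
  refine ⟨_, hornRestriction_fill hx fun i j l m hij hjl hlm => ?_⟩
  by_cases H : InHorn k (quadruple hij.le hjl.le hlm.le)
  · exact fill_coh hx _ _ _ H
  -- a tetrahedron that is not in the horn contains all vertices but `k`; so `n = 0`, and it is the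
  -- face opposite `k`, whose coherence follows from that of the other faces of the 4-simplex
  have H' (a : Fin (n + 5)) (hk : a ≠ k) : a = i ∨ a = j ∨ a = l ∨ a = m := by
    by_contra! hc
    exact H (inHorn_quadruple_of_ne hk hc.1 hc.2.1 hc.2.2.1 hc.2.2.2)
  have hki : k ≠ i ∧ k ≠ j ∧ k ≠ l ∧ k ≠ m := by
    obtain ⟨a, h1, h2, h3, h4⟩ := exists_ne_four i j l m
    by_cases hk : a = k
    · rw [← hk]
      exact ⟨h1, h2, h3, h4⟩
    · rcases H' a hk with h | h | h | h <;> contradiction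
  obtain ⟨hki, hkj, hkl, hkm⟩ := hki
  have hil := hij.trans hjl
  have him := hil.trans hlm
  have hjm := hjl.trans hlm
  have coh (a p q r s : Fin (n + 5)) (h1 : p ≤ q) (h2 : q ≤ r) (h3 : r ≤ s) (hak : a ≠ k)
      (hap : a ≠ p) (haq : a ≠ q) (har : a ≠ r) (has : a ≠ s) : (fill h hx).Coh p q r s :=
    fill_coh hx h1 h2 h3 (inHorn_quadruple_of_ne hak hap haq har has)
  rcases lt_or_gt_of_ne hki with h0 | h0
  · have hk : k = 0 := by
      by_contra hk
      rcases H' 0 (Ne.symm hk) with e | e | e | e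
      · exact absurd (h0.trans_le (e ▸ Fin.zero_le k)) (lt_irrefl _)
      · exact absurd ((h0.trans hij).trans_le (e ▸ Fin.zero_le k)) (lt_irrefl _)
      · exact absurd ((h0.trans hil).trans_le (e ▸ Fin.zero_le k)) (lt_irrefl _)
      · exact absurd ((h0.trans him).trans_le (e ▸ Fin.zero_le k)) (lt_irrefl _)
    refine PreSimplex.coh_face₀ _ (i := k) h0.le hij.le hjl.le hlm.le hC ?_
      (coh i _ _ _ _ ?_ ?_ ?_ ?_ ?_ ?_ ?_ ?_) (coh j _ _ _ _ ?_ ?_ ?_ ?_ ?_ ?_ ?_ ?_)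
      (coh l _ _ _ _ ?_ ?_ ?_ ?_ ?_ ?_ ?_ ?_) (coh m _ _ _ _ ?_ ?_ ?_ ?_ ?_ ?_ ?_ ?_)
    · intro α β hd hc hs e
      obtain ⟨f', ε, hf⟩ := hR hk ((fill h hx).ar k i)
      rw [← hf.unwr_wr hs (by rw [C.src_cod, hs]) hC rfl rfl, e,
        hf.unwr_wr hs (by rw [C.src_cod, hs]) hC hd.symm hc.symm]
    all_goals order
  rcases lt_or_gt_of_ne hkj with h1 | h1
  · refine PreSimplex.coh_face₁ _ (j := k) h0.le h1.le hjl.le hlm.le hC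
      (coh i _ _ _ _ ?_ ?_ ?_ ?_ ?_ ?_ ?_ ?_) (coh j _ _ _ _ ?_ ?_ ?_ ?_ ?_ ?_ ?_ ?_)
      (coh l _ _ _ _ ?_ ?_ ?_ ?_ ?_ ?_ ?_ ?_) (coh m _ _ _ _ ?_ ?_ ?_ ?_ ?_ ?_ ?_ ?_)
    all_goals order
  rcases lt_or_gt_of_ne hkl with h2 | h2
  · refine PreSimplex.coh_face₂ _ (k := k) hij.le h1.le h2.le hlm.le hC
      (coh i _ _ _ _ ?_ ?_ ?_ ?_ ?_ ?_ ?_ ?_) (coh j _ _ _ _ ?_ ?_ ?_ ?_ ?_ ?_ ?_ ?_)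
      (coh l _ _ _ _ ?_ ?_ ?_ ?_ ?_ ?_ ?_ ?_) (coh m _ _ _ _ ?_ ?_ ?_ ?_ ?_ ?_ ?_ ?_)
    all_goals order
  rcases lt_or_gt_of_ne hkm with h3 | h3
  · refine PreSimplex.coh_face₃ _ (l := k) hij.le hjl.le h2.le h3.le hC
      (coh i _ _ _ _ ?_ ?_ ?_ ?_ ?_ ?_ ?_ ?_) (coh j _ _ _ _ ?_ ?_ ?_ ?_ ?_ ?_ ?_ ?_)
      (coh l _ _ _ _ ?_ ?_ ?_ ?_ ?_ ?_ ?_ ?_) (coh m _ _ _ _ ?_ ?_ ?_ ?_ ?_ ?_ ?_ ?_)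
    all_goals order
  · have hk : k = Fin.last (n + 4) := by
      by_contra hk
      rcases H' (Fin.last _) (Ne.symm hk) with e | e | e | e
      · exact absurd (h0.trans_le (e ▸ Fin.le_last k)) (lt_irrefl _)
      · exact absurd (h1.trans_le (e ▸ Fin.le_last k)) (lt_irrefl _)
      · exact absurd (h2.trans_le (e ▸ Fin.le_last k)) (lt_irrefl _)
      · exact absurd (h3.trans_le (e ▸ Fin.le_last k)) (lt_irrefl _)
    refine PreSimplex.coh_face₄ _ (m := k) hij.le hjl.le hlm.le h3.le hC ?_
      (coh i _ _ _ _ ?_ ?_ ?_ ?_ ?_ ?_ ?_ ?_) (coh j _ _ _ _ ?_ ?_ ?_ ?_ ?_ ?_ ?_ ?_)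
      (coh l _ _ _ _ ?_ ?_ ?_ ?_ ?_ ?_ ?_ ?_) (coh m _ _ _ _ ?_ ?_ ?_ ?_ ?_ ?_ ?_ ?_)
    · intro α β hd hc hs e
      obtain ⟨f', ε, hf⟩ := hL hk ((fill h hx).ar m k)
      rw [← hf.unwl_wl hs.symm (by rw [C.tgt_cod, hs]) hC rfl rfl, e,
        hf.unwl_wl hs.symm (by rw [C.tgt_cod, hs]) hC hd.symm hc.symm]
    all_goals order

/-! ### Filling horns of dimension three -/

namespace PreSimplex

variable (p : PreSimplex C n) {i j k l : Fin (n + 1)}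

/-- The coherence equation, solved for the face opposite the first vertex. -/
lemma coh_iff_ce₀ (hC : C.CellsInvertible) (hij : i ≤ j) (hjk : j ≤ k) (hkl : k ≤ l)
    {f' f'' : C.Ar} {ε ε' : C.Ce} (h : C.IsRightInv (p.ar i j) f' ε)
    (h' : C.IsRightInv f' f'' ε') :
    p.Coh i j k l ↔ p.ce j k l = C.unwr f' ε (p.ar j l) (C.cm (p.ar k l) (p.ar j k))
      (C.vc (C.vc (C.wl (p.ar k l) (p.ce i j k)) (p.ce i k l)) (C.iv (p.ce i j l))) := by
  have hik := hij.trans hjk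
  have hil := hik.trans hkl
  have hjl := hjk.trans hkl
  have e : p.Coh i j k l ↔ C.wr (p.ce j k l) (p.ar i j) =
      C.vc (C.vc (C.wl (p.ar k l) (p.ce i j k)) (p.ce i k l)) (C.iv (p.ce i j l)) := by
    rw [eq_vc_iv_iff hC, Coh]
    all_goals simp (maxDischargeDepth := 8) only [p.src_ar, p.tgt_ar, p.dom_ce, p.cod_ce, dom_wl,
      cod_wl, dom_wr, cod_wr, dom_vc, cod_vc, src_cm, tgt_cm, cm_assoc, hij, hjk, hkl, hik, hil,
      hjl]
  have h1 : C.src (p.ar j l) = C.tgt (p.ar i j) := by rw [p.src_ar hjl, p.tgt_ar hij]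
  have h2 : C.src (C.cm (p.ar k l) (p.ar j k)) = C.tgt (p.ar i j) := by
    rw [src_cm, p.src_ar hjk, p.tgt_ar hij]
    rw [p.src_ar hkl, p.tgt_ar hjk]
  rw [e]
  constructor
  · intro e1
    rw [← e1, h.unwr_wr h1 h2 hC (p.dom_ce hjk hkl) (p.cod_ce hjk hkl)]
  · intro e1
    rw [e1, h.wr_unwr h1 h2 hC h']
    all_goals simp (maxDischargeDepth := 8) only [p.src_ar, p.tgt_ar, p.dom_ce, p.cod_ce, dom_wl,
      cod_wl, dom_wr, cod_wr, dom_vc, cod_vc, src_cm, tgt_cm, cm_assoc, dom_iv hC, cod_iv hC, hij,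
      hjk, hkl, hik, hil, hjl]

/-- The coherence equation, solved for the face opposite the last vertex. -/
lemma coh_iff_ce₃ (hC : C.CellsInvertible) (hij : i ≤ j) (hjk : j ≤ k) (hkl : k ≤ l)
    {f' f'' : C.Ar} {η η' : C.Ce} (h : C.IsLeftInv (p.ar k l) f' η)
    (h' : C.IsLeftInv f' f'' η') :
    p.Coh i j k l ↔ p.ce i j k = C.unwl f' η (p.ar i k) (C.cm (p.ar j k) (p.ar i j))
      (C.vc (C.vc (C.wr (p.ce j k l) (p.ar i j)) (p.ce i j l)) (C.iv (p.ce i k l))) := by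
  have hik := hij.trans hjk
  have hil := hik.trans hkl
  have hjl := hjk.trans hkl
  have e : p.Coh i j k l ↔ C.wl (p.ar k l) (p.ce i j k) =
      C.vc (C.vc (C.wr (p.ce j k l) (p.ar i j)) (p.ce i j l)) (C.iv (p.ce i k l)) := by
    rw [eq_vc_iv_iff hC, Coh, eq_comm]
    all_goals simp (maxDischargeDepth := 8) only [p.src_ar, p.tgt_ar, p.dom_ce, p.cod_ce, dom_wl,
      cod_wl, dom_wr, cod_wr, dom_vc, cod_vc, src_cm, tgt_cm, cm_assoc, hij, hjk, hkl, hik, hil,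
      hjl]
  have h1 : C.tgt (p.ar i k) = C.src (p.ar k l) := by rw [p.src_ar hkl, p.tgt_ar hik]
  have h2 : C.tgt (C.cm (p.ar j k) (p.ar i j)) = C.src (p.ar k l) := by
    rw [tgt_cm, p.src_ar hkl, p.tgt_ar hjk]
    rw [p.src_ar hjk, p.tgt_ar hij]
  rw [e]
  constructor
  · intro e1
    rw [← e1, h.unwl_wl h1 h2 hC (p.dom_ce hij hjk) (p.cod_ce hij hjk)]
  · intro e1
    rw [e1, h.wl_unwl h1 h2 hC h']
    all_goals simp (maxDischargeDepth := 8) only [p.src_ar, p.tgt_ar, p.dom_ce, p.cod_ce, dom_wl,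
      cod_wl, dom_wr, cod_wr, dom_vc, cod_vc, src_cm, tgt_cm, cm_assoc, dom_iv hC, cod_iv hC, hij,
      hjk, hkl, hik, hil, hjl]

end PreSimplex

end TwoCat

namespace TwoCat

section Restriction

variable {C : TwoCat.{u}} {n : ℕ} {k : Fin (n + 4)} (s : Simplex C (n + 3)) (x : C.Ce)

lemma edge_hornRestriction {i j : Fin (n + 4)} (hij : i ≤ j) :
    edge (k := k) (SSet.hornRestriction C.nerve (n + 3) k s) i j = s.pre.ar i j := by
  rw [edge, dif_pos hij, Simplex.pre_ar hij]
  rfl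

lemma tri_hornRestriction {i j l : Fin (n + 4)} {hij : i ≤ j} {hjl : j ≤ l}
    (H : InHorn k (triple hij hjl)) :
    tri (k := k) (SSet.hornRestriction C.nerve (n + 3) k s) x i j l = s.pre.ce i j l := by
  rw [tri, dif_pos ⟨hij, hjl, H⟩, Simplex.pre_ce hij hjl]
  rfl

lemma tri_eq_of_inHorn (h : (Λ[n + 3, k] : SSet.{u}) ⟶ C.nerve) (x y : C.Ce) {i j l : Fin (n + 4)}
    {hij : i ≤ j} {hjl : j ≤ l} (H : InHorn k (triple hij hjl)) : tri h x i j l = tri h y i j l := by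
  rw [tri, dif_pos ⟨hij, hjl, H⟩, tri, dif_pos ⟨hij, hjl, H⟩]

lemma tri_eq_of_not_inHorn (h : (Λ[n + 3, k] : SSet.{u}) ⟶ C.nerve) (x : C.Ce) {i j l : Fin (n + 4)}
    {hij : i ≤ j} {hjl : j ≤ l} (H : ¬ InHorn k (triple hij hjl)) : tri h x i j l = x := by
  rw [tri, dif_neg fun H' => H H'.2.2]

end Restriction

section Three

variable {C : TwoCat.{u}} {k : Fin 4}

lemma triple_inHorn {i j l : Fin 4} (a : Fin 4) (hij : i ≤ j) (hjl : j ≤ l)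
    (H : a ≠ k ∧ a ≠ i ∧ a ≠ j ∧ a ≠ l) : InHorn k (triple (n := 3) hij hjl) :=
  inHorn_triple_of_ne H.1 H.2.1 H.2.2.1 H.2.2.2

/-- The horn `Λ[3, k]` misses exactly the face opposite `k`. -/
lemma eq_of_not_inHorn {i j l : Fin 4} (hij : i ≤ j) (hjl : j ≤ l)
    (H : ¬ InHorn k (triple (n := 3) hij hjl)) :
    i = k.succAbove 0 ∧ j = k.succAbove 1 ∧ l = k.succAbove 2 := by
  have h1 : ∀ a, a ≠ k → a = i ∨ a = j ∨ a = l := fun a hk => by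
    by_contra! hc
    exact H (triple_inHorn a hij hjl ⟨hk, hc⟩)
  clear H
  revert k i j l
  decide

lemma not_inHorn_triple {i j l : Fin 4} (hij : i ≤ j) (hjl : j ≤ l)
    (H : ∀ a, a ≠ k → a = i ∨ a = j ∨ a = l) : ¬ InHorn k (triple (n := 3) hij hjl) := by
  rintro ⟨a, hk, ha⟩
  rcases H a hk with e | e | e
  · exact ha 0 e.symm
  · exact ha 1 e.symm
  · exact ha 2 e.symm

lemma exists_filler_three {h : (Λ[3, k] : SSet.{u}) ⟶ C.nerve} {x : C.Ce}
    (hd : C.dom x = edge (n := 0) h (k.succAbove 0) (k.succAbove 2))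
    (hc : C.cod x = C.cm (edge (n := 0) h (k.succAbove 1) (k.succAbove 2))
      (edge (n := 0) h (k.succAbove 0) (k.succAbove 1)))
    (H : ∀ hx : IsMissingCe (n := 0) h x, (fill h hx).Coh 0 1 2 3) :
    ∃ s, SSet.hornRestriction C.nerve 3 k s = h := by
  have hx : IsMissingCe (n := 0) h x := by
    intro i j l hij hjl H
    obtain ⟨rfl, rfl, rfl⟩ := eq_of_not_inHorn hij hjl H
    exact ⟨hd, hc⟩
  refine ⟨_, hornRestriction_fill hx fun i j l m hij hjl hlm => ?_⟩
  obtain ⟨rfl, rfl, rfl, rfl⟩ : i = 0 ∧ j = 1 ∧ l = 2 ∧ m = 3 := by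
    clear H hd hc hx
    revert i j l m
    decide
  exact H hx

lemma Simplex.ext_three {s t : Simplex C 3}
    (h : SSet.hornRestriction C.nerve 3 k s = SSet.hornRestriction C.nerve 3 k t)
    (H : s.pre.ce (k.succAbove 0) (k.succAbove 1) (k.succAbove 2) =
      t.pre.ce (k.succAbove 0) (k.succAbove 1) (k.succAbove 2)) : s = t := by
  refine Simplex.ext_horn (n := 0) h fun i j l hij hjl H' => ?_
  obtain ⟨rfl, rfl, rfl⟩ := eq_of_not_inHorn hij hjl H'
  exact H

/-- A placeholder for the missing 2-cell of a horn. -/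
noncomputable def baseCe (h : (Λ[3, k] : SSet.{u}) ⟶ C.nerve) : C.Ce :=
  C.idc (edge (n := 0) h 0 0)

/-- The missing 2-cell of an inner horn `Λ[3, 1]`. -/
noncomputable def missingCe₁ (h : (Λ[3, 1] : SSet.{u}) ⟶ C.nerve) : C.Ce :=
  C.vc (C.iv (C.wl (edge (n := 0) h 2 3) (tri (n := 0) h (baseCe h) 0 1 2)))
    (C.vc (C.wr (tri (n := 0) h (baseCe h) 1 2 3) (edge (n := 0) h 0 1))
      (tri (n := 0) h (baseCe h) 0 1 3))

/-- The missing 2-cell of an inner horn `Λ[3, 2]`. -/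
noncomputable def missingCe₂ (h : (Λ[3, 2] : SSet.{u}) ⟶ C.nerve) : C.Ce :=
  C.vc (C.iv (C.wr (tri (n := 0) h (baseCe h) 1 2 3) (edge (n := 0) h 0 1)))
    (C.vc (C.wl (edge (n := 0) h 2 3) (tri (n := 0) h (baseCe h) 0 1 2))
      (tri (n := 0) h (baseCe h) 0 2 3))

/-- The missing 2-cell of an outer horn `Λ[3, 0]`, computed by means of a right inverse `f'` of
its first edge. -/
noncomputable def missingCe₀ (h : (Λ[3, 0] : SSet.{u}) ⟶ C.nerve) (f' : C.Ar) (ε : C.Ce) : C.Ce :=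
  C.unwr f' ε (edge (n := 0) h 1 3) (C.cm (edge (n := 0) h 2 3) (edge (n := 0) h 1 2))
    (C.vc (C.vc (C.wl (edge (n := 0) h 2 3) (tri (n := 0) h (baseCe h) 0 1 2))
      (tri (n := 0) h (baseCe h) 0 2 3)) (C.iv (tri (n := 0) h (baseCe h) 0 1 3)))

/-- The missing 2-cell of an outer horn `Λ[3, 3]`, computed by means of a left inverse `f'` of
its last edge. -/
noncomputable def missingCe₃ (h : (Λ[3, 3] : SSet.{u}) ⟶ C.nerve) (f' : C.Ar) (η : C.Ce) : C.Ce :=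
  C.unwl f' η (edge (n := 0) h 0 2) (C.cm (edge (n := 0) h 1 2) (edge (n := 0) h 0 1))
    (C.vc (C.vc (C.wr (tri (n := 0) h (baseCe h) 1 2 3) (edge (n := 0) h 0 1))
      (tri (n := 0) h (baseCe h) 0 1 3)) (C.iv (tri (n := 0) h (baseCe h) 0 2 3)))

variable (k) in
/-- The boundaries of the edges and triangles of a horn `Λ[3, k]`. -/
lemma horn_boundary (h : (Λ[3, k] : SSet.{u}) ⟶ C.nerve) :
    (∀ i j, i ≤ j → C.src (edge (n := 0) h i j) = vert (n := 0) h i) ∧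
    (∀ i j, i ≤ j → C.tgt (edge (n := 0) h i j) = vert (n := 0) h j) ∧
    (∀ i j l, i ≤ j → j ≤ l → (∃ a, a ≠ k ∧ a ≠ i ∧ a ≠ j ∧ a ≠ l) →
      C.dom (tri (n := 0) h (baseCe h) i j l) = edge (n := 0) h i l) ∧
    (∀ i j l, i ≤ j → j ≤ l → (∃ a, a ≠ k ∧ a ≠ i ∧ a ≠ j ∧ a ≠ l) →
      C.cod (tri (n := 0) h (baseCe h) i j l) =
        C.cm (edge (n := 0) h j l) (edge (n := 0) h i j)) :=
  ⟨fun _ _ => src_edge (n := 0) h, fun _ _ => tgt_edge (n := 0) h,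
    fun _ _ _ hij hjl ⟨a, H⟩ => dom_tri (n := 0) h _ hij hjl (triple_inHorn a hij hjl H),
    fun _ _ _ hij hjl ⟨a, H⟩ => cod_tri (n := 0) h _ hij hjl (triple_inHorn a hij hjl H)⟩

variable (hC : C.CellsInvertible)
include hC

section Formulas

variable (s : Simplex C 3)

lemma Simplex.ce_eq_missingCe₁ :
    s.pre.ce 0 2 3 = missingCe₁ (SSet.hornRestriction C.nerve 3 1 s) := by
  have e := (s.pre.coh_iff_ce₁ hC (i := 0) (j := 1) (k := 2) (l := 3) (by decide) (by decide)
    (by decide)).1 (Simplex.pre_coh (by decide) (by decide) (by decide))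
  rw [e, missingCe₁, edge_hornRestriction (n := 0) s (by decide),
    edge_hornRestriction (n := 0) s (by decide),
    tri_hornRestriction (n := 0) s _ (triple_inHorn 3 (by decide) (by decide) (by decide)),
    tri_hornRestriction (n := 0) s _ (triple_inHorn 0 (by decide) (by decide) (by decide)),
    tri_hornRestriction (n := 0) s _ (triple_inHorn 2 (by decide) (by decide) (by decide))]

lemma Simplex.ce_eq_missingCe₂ :
    s.pre.ce 0 1 3 = missingCe₂ (SSet.hornRestriction C.nerve 3 2 s) := by
  have e := (s.pre.coh_iff_ce₂ hC (i := 0) (j := 1) (k := 2) (l := 3) (by decide) (by decide)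
    (by decide)).1 (Simplex.pre_coh (by decide) (by decide) (by decide))
  rw [e, missingCe₂, edge_hornRestriction (n := 0) s (by decide),
    edge_hornRestriction (n := 0) s (by decide),
    tri_hornRestriction (n := 0) s _ (triple_inHorn 0 (by decide) (by decide) (by decide)),
    tri_hornRestriction (n := 0) s _ (triple_inHorn 3 (by decide) (by decide) (by decide)),
    tri_hornRestriction (n := 0) s _ (triple_inHorn 1 (by decide) (by decide) (by decide))]


lemma Simplex.ce_eq_missingCe₀ {f' f'' : C.Ar} {ε ε' : C.Ce}
    (h : C.IsRightInv (s.pre.ar 0 1) f' ε) (h' : C.IsRightInv f' f'' ε') :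
    s.pre.ce 1 2 3 = missingCe₀ (SSet.hornRestriction C.nerve 3 0 s) f' ε := by
  have e := (s.pre.coh_iff_ce₀ hC (i := 0) (j := 1) (k := 2) (l := 3) (by decide) (by decide)
    (by decide) h h').1 (Simplex.pre_coh (by decide) (by decide) (by decide))
  rw [e, missingCe₀, edge_hornRestriction (n := 0) s (by decide),
    edge_hornRestriction (n := 0) s (by decide), edge_hornRestriction (n := 0) s (by decide),
    tri_hornRestriction (n := 0) s _ (triple_inHorn 3 (by decide) (by decide) (by decide)),
    tri_hornRestriction (n := 0) s _ (triple_inHorn 1 (by decide) (by decide) (by decide)),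
    tri_hornRestriction (n := 0) s _ (triple_inHorn 2 (by decide) (by decide) (by decide))]

lemma Simplex.ce_eq_missingCe₃ {f' f'' : C.Ar} {η η' : C.Ce}
    (h : C.IsLeftInv (s.pre.ar 2 3) f' η) (h' : C.IsLeftInv f' f'' η') :
    s.pre.ce 0 1 2 = missingCe₃ (SSet.hornRestriction C.nerve 3 3 s) f' η := by
  have e := (s.pre.coh_iff_ce₃ hC (i := 0) (j := 1) (k := 2) (l := 3) (by decide) (by decide)
    (by decide) h h').1 (Simplex.pre_coh (by decide) (by decide) (by decide))
  rw [e, missingCe₃, edge_hornRestriction (n := 0) s (by decide),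
    edge_hornRestriction (n := 0) s (by decide), edge_hornRestriction (n := 0) s (by decide),
    tri_hornRestriction (n := 0) s _ (triple_inHorn 0 (by decide) (by decide) (by decide)),
    tri_hornRestriction (n := 0) s _ (triple_inHorn 2 (by decide) (by decide) (by decide)),
    tri_hornRestriction (n := 0) s _ (triple_inHorn 1 (by decide) (by decide) (by decide))]

end Formulas

section Fillers

lemma exists_filler₁ (h : (Λ[3, 1] : SSet.{u}) ⟶ C.nerve) :
    ∃ s, SSet.hornRestriction C.nerve 3 1 s = h := by
  obtain ⟨hs, ht, hd, hc⟩ := horn_boundary 1 h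
  refine exists_filler_three (k := 1) (x := missingCe₁ h) ?_ ?_ fun hx => ?_
  · change C.dom (missingCe₁ h) = edge (n := 0) h 0 3
    rw [missingCe₁]
    simp (decide := true) (maxDischargeDepth := 8) only [hs, ht, hd, hc, dom_wl, cod_wl, dom_wr,
      cod_wr, dom_vc, cod_vc, src_cm, tgt_cm, cm_assoc, dom_iv hC, cod_iv hC]
  · change C.cod (missingCe₁ h) = C.cm (edge (n := 0) h 2 3) (edge (n := 0) h 0 2)
    rw [missingCe₁]
    simp (decide := true) (maxDischargeDepth := 8) only [hs, ht, hd, hc, dom_wl, cod_wl, dom_wr,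
      cod_wr, dom_vc, cod_vc, src_cm, tgt_cm, cm_assoc, dom_iv hC, cod_iv hC]
  · rw [PreSimplex.coh_iff_ce₁ _ hC (by decide) (by decide) (by decide)]
    refine (tri_eq_of_not_inHorn (n := 0) h _ (not_inHorn_triple (by decide) (by decide)
      (by decide))).trans ?_
    have e1 := tri_eq_of_inHorn (n := 0) h (missingCe₁ h) (baseCe h)
      (triple_inHorn 3 (i := 0) (j := 1) (l := 2) (by decide) (by decide) (by decide))
    have e2 := tri_eq_of_inHorn (n := 0) h (missingCe₁ h) (baseCe h)
      (triple_inHorn 0 (i := 1) (j := 2) (l := 3) (by decide) (by decide) (by decide))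
    have e3 := tri_eq_of_inHorn (n := 0) h (missingCe₁ h) (baseCe h)
      (triple_inHorn 2 (i := 0) (j := 1) (l := 3) (by decide) (by decide) (by decide))
    simp only [fill, e1, e2, e3]
    rfl

lemma exists_filler₂ (h : (Λ[3, 2] : SSet.{u}) ⟶ C.nerve) :
    ∃ s, SSet.hornRestriction C.nerve 3 2 s = h := by
  obtain ⟨hs, ht, hd, hc⟩ := horn_boundary 2 h
  refine exists_filler_three (k := 2) (x := missingCe₂ h) ?_ ?_ fun hx => ?_
  · change C.dom (missingCe₂ h) = edge (n := 0) h 0 3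
    rw [missingCe₂]
    simp (decide := true) (maxDischargeDepth := 8) only [hs, ht, hd, hc, dom_wl, cod_wl, dom_wr,
      cod_wr, dom_vc, cod_vc, src_cm, tgt_cm, cm_assoc, dom_iv hC, cod_iv hC]
  · change C.cod (missingCe₂ h) = C.cm (edge (n := 0) h 1 3) (edge (n := 0) h 0 1)
    rw [missingCe₂]
    simp (decide := true) (maxDischargeDepth := 8) only [hs, ht, hd, hc, dom_wl, cod_wl, dom_wr,
      cod_wr, dom_vc, cod_vc, src_cm, tgt_cm, cm_assoc, dom_iv hC, cod_iv hC]
  · rw [PreSimplex.coh_iff_ce₂ _ hC (by decide) (by decide) (by decide)]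
    refine (tri_eq_of_not_inHorn (n := 0) h _ (not_inHorn_triple (by decide) (by decide)
      (by decide))).trans ?_
    have e1 := tri_eq_of_inHorn (n := 0) h (missingCe₂ h) (baseCe h)
      (triple_inHorn 3 (i := 0) (j := 1) (l := 2) (by decide) (by decide) (by decide))
    have e2 := tri_eq_of_inHorn (n := 0) h (missingCe₂ h) (baseCe h)
      (triple_inHorn 0 (i := 1) (j := 2) (l := 3) (by decide) (by decide) (by decide))
    have e3 := tri_eq_of_inHorn (n := 0) h (missingCe₂ h) (baseCe h)
      (triple_inHorn 1 (i := 0) (j := 2) (l := 3) (by decide) (by decide) (by decide))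
    simp only [fill, e1, e2, e3]
    rfl

lemma exists_filler₀ (h : (Λ[3, 0] : SSet.{u}) ⟶ C.nerve) {f' f'' : C.Ar} {ε ε' : C.Ce}
    (h1 : C.IsRightInv (edge (n := 0) h 0 1) f' ε) (h2 : C.IsRightInv f' f'' ε') :
    ∃ s, SSet.hornRestriction C.nerve 3 0 s = h := by
  obtain ⟨hs, ht, hd, hc⟩ := horn_boundary 0 h
  have hb : C.dom (missingCe₀ h f' ε) = edge (n := 0) h 1 3 ∧
      C.cod (missingCe₀ h f' ε) = C.cm (edge (n := 0) h 2 3) (edge (n := 0) h 1 2) := by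
    refine h1.dom_unwr ?_ ?_ hC ?_ ?_ <;>
    simp (decide := true) (maxDischargeDepth := 8) only [hs, ht, hd, hc, dom_wl, cod_wl, dom_wr,
      cod_wr, dom_vc, cod_vc, src_cm, tgt_cm, cm_assoc, dom_iv hC, cod_iv hC]
  refine exists_filler_three (k := 0) (x := missingCe₀ h f' ε) hb.1 hb.2 fun hx => ?_
  rw [PreSimplex.coh_iff_ce₀ _ hC (by decide) (by decide) (by decide) h1 h2]
  refine (tri_eq_of_not_inHorn (n := 0) h _ (not_inHorn_triple (by decide) (by decide)
    (by decide))).trans ?_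
  have e1 := tri_eq_of_inHorn (n := 0) h (missingCe₀ h f' ε) (baseCe h)
    (triple_inHorn 3 (i := 0) (j := 1) (l := 2) (by decide) (by decide) (by decide))
  have e2 := tri_eq_of_inHorn (n := 0) h (missingCe₀ h f' ε) (baseCe h)
    (triple_inHorn 2 (i := 0) (j := 1) (l := 3) (by decide) (by decide) (by decide))
  have e3 := tri_eq_of_inHorn (n := 0) h (missingCe₀ h f' ε) (baseCe h)
    (triple_inHorn 1 (i := 0) (j := 2) (l := 3) (by decide) (by decide) (by decide))
  simp only [fill, e1, e2, e3]
  rfl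

lemma exists_filler₃ (h : (Λ[3, 3] : SSet.{u}) ⟶ C.nerve) {f' f'' : C.Ar} {η η' : C.Ce}
    (h1 : C.IsLeftInv (edge (n := 0) h 2 3) f' η) (h2 : C.IsLeftInv f' f'' η') :
    ∃ s, SSet.hornRestriction C.nerve 3 3 s = h := by
  obtain ⟨hs, ht, hd, hc⟩ := horn_boundary 3 h
  have hb : C.dom (missingCe₃ h f' η) = edge (n := 0) h 0 2 ∧
      C.cod (missingCe₃ h f' η) = C.cm (edge (n := 0) h 1 2) (edge (n := 0) h 0 1) := by
    refine h1.dom_unwl ?_ ?_ hC ?_ ?_ <;>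
    simp (decide := true) (maxDischargeDepth := 8) only [hs, ht, hd, hc, dom_wl, cod_wl, dom_wr,
      cod_wr, dom_vc, cod_vc, src_cm, tgt_cm, cm_assoc, dom_iv hC, cod_iv hC]
  refine exists_filler_three (k := 3) (x := missingCe₃ h f' η) hb.1 hb.2 fun hx => ?_
  rw [PreSimplex.coh_iff_ce₃ _ hC (by decide) (by decide) (by decide) h1 h2]
  refine (tri_eq_of_not_inHorn (n := 0) h _ (not_inHorn_triple (by decide) (by decide)
    (by decide))).trans ?_
  have e1 := tri_eq_of_inHorn (n := 0) h (missingCe₃ h f' η) (baseCe h)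
    (triple_inHorn 0 (i := 1) (j := 2) (l := 3) (by decide) (by decide) (by decide))
  have e2 := tri_eq_of_inHorn (n := 0) h (missingCe₃ h f' η) (baseCe h)
    (triple_inHorn 2 (i := 0) (j := 1) (l := 3) (by decide) (by decide) (by decide))
  have e3 := tri_eq_of_inHorn (n := 0) h (missingCe₃ h f' η) (baseCe h)
    (triple_inHorn 1 (i := 0) (j := 2) (l := 3) (by decide) (by decide) (by decide))
  simp only [fill, e1, e2, e3]
  rfl

end Fillers

end Three

end TwoCat

namespace LieTwoCat

open SmoothStr TwoCat

/-! ### The manifolds of horns of dimension at least three -/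

variable {C : LieTwoCat.{u}} {n : ℕ}

/-- The faces of a horn. -/
noncomputable def faces {k : Fin (n + 2)} (h : (Λ[n + 1, k] : SSet.{u}) ⟶ C.nerve)
    (i : {i : Fin (n + 2) // i ≠ k}) : Simplex C.toTwoCat n :=
  SSet.yonedaEquiv (SSet.horn.ι k i.1 i.2 ≫ h)

lemma faces_eq {k : Fin (n + 2)} (h : (Λ[n + 1, k] : SSet.{u}) ⟶ C.nerve)
    (i : {i : Fin (n + 2) // i ≠ k}) :
    faces h i = hornSimplex h (Fin.succAboveOrderEmb i.1).toOrderHom (inHorn_succAbove i.2) :=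
  yonedaEquiv_horn_ι i.2 h

variable {S : ∀ n, SmoothStr (Simplex C.toTwoCat n)}
  (hS : ∀ n, EmbedsIn (S n) (pi fun _ => C.ceStr) cells)

/-- The condition on horns, in terms of local retractions and local sections. -/
lemma hornSubmersion_of_embedsIn {k : Fin (n + 2)}
    {T : SmoothStr ((Λ[n + 1, k] : SSet.{u}) ⟶ C.nerve)}
    (hT : EmbedsIn T (pi fun _ => S n) faces)
    (hs : Function.Surjective (SSet.hornRestriction C.nerve (n + 1) k))
    (h : ∀ u, SmoothNear (S (n + 1)) T (SSet.hornRestriction C.nerve (n + 1) k) u ∧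
      HasSection (S (n + 1)) T (SSet.hornRestriction C.nerve (n + 1) k) u) :
    SSet.HornSubmersion C.nerve S n k :=
  ⟨T, EmbedsIn.isEmbeddingInProduct (φ := fun i : {i : Fin (n + 2) // i ≠ k} =>
    ⟨C.nerve _⦋n⦌, S n, fun h => SSet.yonedaEquiv (SSet.horn.ι k i.1 i.2 ≫ h)⟩) hT,
    isSurjSubmersion_iff.2 ⟨hs, h⟩⟩

include hS

/-- If horns have unique fillers, which depend smoothly on the faces of the horn, then the space of
horns is a manifold diffeomorphic to that of simplices. -/
lemma hornSubmersion_of_bijective {k : Fin (n + 2)}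
    (hb : Function.Bijective (SSet.hornRestriction C.nerve (n + 1) k))
    (hρ : ∀ h, SmoothAlong (pi fun _ => S n) faces (S (n + 1))
      (Equiv.ofBijective _ hb).symm h) : SSet.HornSubmersion C.nerve S n k := by
  let e := Equiv.ofBijective _ hb
  obtain ⟨T, hT⟩ := exists_embedsIn_of_bijective (R := S (n + 1)) e.symm.bijective
  have hfaces (h) : SmoothNear T (pi fun _ => S n) faces h := by
    refine SmoothNear.pi fun i => ?_
    have h1 : SmoothNear (S (n + 1)) (S n)
        (fun u => u.pullback (Fin.succAboveOrderEmb i.1).toOrderHom) (e.symm h) :=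
      smoothNear_simplex (hS n) (fun _ => smoothNear_ob (hS (n + 1)) _ _)
        (fun _ _ _ => smoothNear_ar (hS (n + 1)) _ _)
        (fun _ _ _ _ _ => smoothNear_ce (hS (n + 1)) _ _ _)
    refine (h1.comp (hT.smooth h)).congr (Eventually.of_forall fun h' => ?_)
    refine (hornSimplex_hornRestriction (k := k) (e.symm h') _ (inHorn_succAbove i.2)).symm.trans
      (Eq.trans ?_ (faces_eq h' i).symm)
    exact congrArg (fun h => hornSimplex h _ (inHorn_succAbove i.2)) (e.apply_symm_apply h')
  refine hornSubmersion_of_embedsIn (hT.of_smoothAlong hfaces hρ) hb.2 fun u => ?_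
  refine ⟨hT.smoothNear ((smoothNear_id u).congr (Eventually.of_forall fun v => ?_)),
    e.symm, hT.smooth _, e.symm_apply_apply u, Eventually.of_forall e.apply_symm_apply⟩
  exact (e.symm_apply_apply v).symm

section Along

variable {k : Fin (n + 4)} (h₀ : (Λ[n + 3, k] : SSet.{u}) ⟶ C.nerve)

lemma smoothAlong_tri {i j l : Fin (n + 4)} {hij : i ≤ j} {hjl : j ≤ l}
    (H : InHorn k (triple hij hjl)) (x : ((Λ[n + 3, k] : SSet.{u}) ⟶ C.nerve) → C.Ce) :
    SmoothAlong (pi fun _ => S (n + 2)) faces C.ceStr (fun h => tri h (x h) i j l) h₀ := by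
  obtain ⟨a, hk, ha⟩ := H
  obtain ⟨p, rfl⟩ := Fin.exists_succAbove_eq (ha 0)
  obtain ⟨q, hq⟩ := Fin.exists_succAbove_eq (ha 1)
  obtain ⟨r, hr⟩ := Fin.exists_succAbove_eq (ha 2)
  obtain rfl : a.succAbove q = j := hq
  obtain rfl : a.succAbove r = l := hr
  have hpq : p ≤ q := (Fin.succAboveOrderEmb a).le_iff_le.1 hij
  have hqr : q ≤ r := (Fin.succAboveOrderEmb a).le_iff_le.1 hjl
  let b : {i : Fin (n + 4) // i ≠ k} := ⟨a, hk⟩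
  have h1 : SmoothAlong (pi fun _ => S (n + 2)) faces C.ceStr
      (fun h => (faces h b).ce p q r hpq hqr) h₀ :=
    SmoothNear.comp_along (g := faces) (k := fun f => (f b).ce p q r hpq hqr)
      (SmoothNear.comp (g := fun u : Simplex C.toTwoCat (n + 2) => u.ce p q r hpq hqr)
        (f := fun f : {i : Fin (n + 4) // i ≠ k} → Simplex C.toTwoCat (n + 2) => f b)
        (smoothNear_ce (hS (n + 2)) hpq hqr _)
        (smoothNear_apply (T := fun _ => S (n + 2)) b _)) (smoothAlong_self h₀)
  refine h1.congr (Eventually.of_forall fun h => ?_)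
  rw [faces_eq, hornSimplex_ce h (x h)]
  rfl

lemma smoothAlong_edge {i j : Fin (n + 4)} (hij : i ≤ j) :
    SmoothAlong (pi fun _ => S (n + 2)) faces C.arStr (fun h => edge h i j) h₀ := by
  have H : InHorn k (triple le_rfl hij) := (inHorn_pair k hij).comp (triple (n := 1) (i := 0)
    (j := 0) (k := 1) le_rfl (by decide)) |> fun H => by
      convert H using 1
      ext x
      fin_cases x <;> rfl
  refine (smoothAlong_dom (smoothAlong_tri hS h₀ H fun h => C.idc (C.one (vert h 0)))).congr
    (Eventually.of_forall fun h => dom_tri h _ le_rfl hij H)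

/-- Fillers depend smoothly on the faces of a horn if the 2-cell of the missing triangle does. -/
lemma smoothAlong_filler {ρ : ((Λ[n + 3, k] : SSet.{u}) ⟶ C.nerve) → Simplex C.toTwoCat (n + 3)}
    (hρ : ∀ h, SSet.hornRestriction C.nerve (n + 3) k (ρ h) = h)
    (H : ∀ i j l (hij : i ≤ j) (hjl : j ≤ l), ¬ InHorn k (triple hij hjl) →
      SmoothAlong (pi fun _ => S (n + 2)) faces C.ceStr (fun h => (ρ h).pre.ce i j l) h₀) :
    SmoothAlong (pi fun _ => S (n + 2)) faces (S (n + 3)) ρ h₀ := by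
  have har (i j) (hij : i ≤ j) :
      SmoothAlong (pi fun _ => S (n + 2)) faces C.arStr (fun h => (ρ h).ar i j hij) h₀ :=
    (smoothAlong_edge hS h₀ hij).congr (Eventually.of_forall fun h => by
      rw [← Simplex.pre_ar hij, ← edge_hornRestriction (k := k) (ρ h) hij, hρ])
  refine smoothAlong_simplex (hS (n + 3)) (fun i => ?_) (fun i j hij => har i j hij.le)
    fun i j l hij hjl => ?_
  · exact (smoothAlong_src (har i i le_rfl)).congr
      (Eventually.of_forall fun h => (ρ h).src_ar _ _ _)
  · simp only [← Simplex.pre_ce hij.le hjl.le]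
    by_cases ha : InHorn k (triple hij.le hjl.le)
    · refine (smoothAlong_tri hS h₀ ha fun h => C.idc (C.one (vert h 0))).congr
        (Eventually.of_forall fun h => ?_)
      rw [← tri_hornRestriction (k := k) (ρ h) (C.idc (C.one (vert h 0))) ha, hρ]
    · exact H i j l hij.le hjl.le ha

end Along

/-- Horns of dimension at least four: they contain all 2-cells of a simplex. -/
lemma hornSubmersion_of_four_le (hC : C.CellsInvertible) (k : Fin (n + 5))
    (hR : k = 0 → ∀ f : C.Ar, ∃ f' ε, C.IsRightInv f f' ε)
    (hL : k = Fin.last (n + 4) → ∀ f : C.Ar, ∃ f' η, C.IsLeftInv f f' η) :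
    Function.Bijective (SSet.hornRestriction C.nerve (n + 4) k) ∧
      SSet.HornSubmersion C.nerve S (n + 3) k := by
  have hb : Function.Bijective (SSet.hornRestriction C.nerve (n + 4) k) :=
    ⟨fun s t e => Simplex.ext_horn e fun i j l hij hjl H => absurd (inHorn_triple k hij hjl) H,
      exists_filler_of_four_le hC k hR hL⟩
  refine ⟨hb, hornSubmersion_of_bijective hS hb fun h => ?_⟩
  exact smoothAlong_filler hS h (Equiv.ofBijective _ hb).apply_symm_apply
    fun i j l hij hjl H => absurd (inHorn_triple k hij hjl) H

section Whisker

omit hS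

variable {M X : Type*} {R : SmoothStr M} {ι : X → M} {x : X} {f f' k k' : X → C.Ar}
  {ε δ : X → C.Ce}

lemma smoothAlong_unwr (hC : C.CellsInvertible) (hf' : SmoothAlong R ι C.arStr f' x)
    (hε : SmoothAlong R ι C.ceStr ε x) (hk : SmoothAlong R ι C.arStr k x)
    (hk' : SmoothAlong R ι C.arStr k' x) (hδ : SmoothAlong R ι C.ceStr δ x)
    (h : ∀ᶠ z in comap ι (R.nhd (ι x)), C.IsRightInv (f z) (f' z) (ε z) ∧
      C.src (k z) = C.tgt (f z) ∧ C.src (k' z) = C.tgt (f z) ∧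
      C.dom (δ z) = C.cm (k z) (f z) ∧ C.cod (δ z) = C.cm (k' z) (f z)) :
    SmoothAlong R ι C.ceStr (fun z => C.unwr (f' z) (ε z) (k z) (k' z) (δ z)) x := by
  refine smoothAlong_vc (smoothAlong_iv hC (smoothAlong_wl hk' hε ?_)) (smoothAlong_vc
    (smoothAlong_wr hδ hf' ?_) (smoothAlong_wl hk hε ?_) ?_) ?_
  all_goals
    filter_upwards [h] with z ⟨h, hs, hs', hd, hc⟩
    have e1 : C.tgt (C.dom (ε z)) = C.tgt (f z) := by rw [h.dom_eq, C.tgt_one]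
    have e2 := h.tgt_eq
    simp (maxDischargeDepth := 8) only [dom_wl, cod_wl, dom_wr, cod_wr, dom_vc, cod_vc, src_cm,
      tgt_cm, cm_assoc, dom_iv hC, cod_iv hC, hs, hs', hd, hc, e1, e2, h.cod_eq]

lemma smoothAlong_unwl (hC : C.CellsInvertible) (hf' : SmoothAlong R ι C.arStr f' x)
    (hε : SmoothAlong R ι C.ceStr ε x) (hk : SmoothAlong R ι C.arStr k x)
    (hk' : SmoothAlong R ι C.arStr k' x) (hδ : SmoothAlong R ι C.ceStr δ x)
    (h : ∀ᶠ z in comap ι (R.nhd (ι x)), C.IsLeftInv (f z) (f' z) (ε z) ∧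
      C.tgt (k z) = C.src (f z) ∧ C.tgt (k' z) = C.src (f z) ∧
      C.dom (δ z) = C.cm (f z) (k z) ∧ C.cod (δ z) = C.cm (f z) (k' z)) :
    SmoothAlong R ι C.ceStr (fun z => C.unwl (f' z) (ε z) (k z) (k' z) (δ z)) x := by
  refine smoothAlong_vc (smoothAlong_iv hC (smoothAlong_wr hε hk' ?_)) (smoothAlong_vc
    (smoothAlong_wl hf' hδ ?_) (smoothAlong_wr hε hk ?_) ?_) ?_
  all_goals
    filter_upwards [h] with z ⟨h, hs, hs', hd, hc⟩
    have e1 : C.src (C.dom (ε z)) = C.src (f z) := by rw [h.dom_eq, C.src_one]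
    have e2 := h.src_eq
    simp (maxDischargeDepth := 8) only [dom_wl, cod_wl, dom_wr, cod_wr, dom_vc, cod_vc, src_cm,
      tgt_cm, cm_assoc, dom_iv hC, cod_iv hC, hs, hs', hd, hc, e1, e2, h.cod_eq]

end Whisker

variable (C) in
/-- All arrows have right inverses up to 2-cells, which can be chosen smoothly near any arrow. -/
def HasSmoothRightInv : Prop := ∀ f₀ : C.Ar, ∃ (f' : C.Ar → C.Ar) (ε : C.Ar → C.Ce),
  SmoothNear C.arStr C.arStr f' f₀ ∧ SmoothNear C.arStr C.ceStr ε f₀ ∧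
    ∀ᶠ f in C.arStr.nhd f₀, C.IsRightInv f (f' f) (ε f)

variable (C) in
/-- All arrows have left inverses up to 2-cells, which can be chosen smoothly near any arrow. -/
def HasSmoothLeftInv : Prop := ∀ f₀ : C.Ar, ∃ (f' : C.Ar → C.Ar) (η : C.Ar → C.Ce),
  SmoothNear C.arStr C.arStr f' f₀ ∧ SmoothNear C.arStr C.ceStr η f₀ ∧
    ∀ᶠ f in C.arStr.nhd f₀, C.IsLeftInv f (f' f) (η f)

omit hS in
lemma HasSmoothRightInv.exists (h : C.HasSmoothRightInv) (f : C.Ar) :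
    ∃ f' ε, C.IsRightInv f f' ε := by
  obtain ⟨f', ε, -, -, e⟩ := h f
  exact ⟨_, _, C.arStr.eventually_mem (p := fun f => C.IsRightInv f (f' f) (ε f)) e⟩

omit hS in
lemma HasSmoothLeftInv.exists (h : C.HasSmoothLeftInv) (f : C.Ar) :
    ∃ f' η, C.IsLeftInv f f' η := by
  obtain ⟨f', ε, -, -, e⟩ := h f
  exact ⟨_, _, C.arStr.eventually_mem (p := fun f => C.IsLeftInv f (f' f) (ε f)) e⟩

section Three

/-- The edges of a horn `Λ[3, k]`, and its triangles, depend smoothly on the faces. -/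
lemma smoothAlong_horn_three {k : Fin 4} (h₀ : (Λ[3, k] : SSet.{u}) ⟶ C.nerve) :
    (∀ i j : Fin 4, i ≤ j → SmoothAlong (pi fun _ => S 2) faces C.arStr
      (fun h : (Λ[3, k] : SSet.{u}) ⟶ C.nerve => edge (n := 0) h i j) h₀) ∧
    ∀ i j l : Fin 4, i ≤ j → j ≤ l → (∃ a, a ≠ k ∧ a ≠ i ∧ a ≠ j ∧ a ≠ l) →
      SmoothAlong (pi fun _ => S 2) faces C.ceStr (fun h : (Λ[3, k] : SSet.{u}) ⟶ C.nerve =>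
        tri (n := 0) h (baseCe h) i j l) h₀ :=
  ⟨fun i j hij => smoothAlong_edge (n := 0) hS h₀ hij, fun i j l hij hjl ⟨a, H⟩ =>
    smoothAlong_tri (n := 0) hS h₀ (triple_inHorn a hij hjl H) baseCe⟩

/-- For horns of dimension three, only the 2-cell of the missing face has to be considered. -/
lemma hornSubmersion_three (k : Fin 4)
    (hb : Function.Bijective (SSet.hornRestriction C.nerve 3 k))
    (H : ∀ h₀, SmoothAlong (pi fun _ => S 2) faces C.ceStr (fun h =>
      ((Equiv.ofBijective _ hb).symm h : Simplex C.toTwoCat 3).pre.ce (k.succAbove 0)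
        (k.succAbove 1) (k.succAbove 2)) h₀) :
    SSet.HornSubmersion C.nerve S 2 k := by
  refine hornSubmersion_of_bijective hS hb fun h => ?_
  refine smoothAlong_filler (n := 0) hS h (Equiv.ofBijective _ hb).apply_symm_apply
    fun i j l hij hjl H' => ?_
  obtain ⟨rfl, rfl, rfl⟩ := eq_of_not_inHorn hij hjl H'
  exact H h

variable (hC : C.CellsInvertible)
include hC

/-- The coherence equation expresses the missing 2-cell of an inner horn, which it contains
unwhiskered, through the other three: it can be solved as 2-cells are invertible. -/
lemma hornSubmersion_three_one : Function.Bijective (SSet.hornRestriction C.nerve 3 1) ∧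
    SSet.HornSubmersion C.nerve S 2 1 := by
  have hb : Function.Bijective (SSet.hornRestriction C.nerve 3 1) :=
    ⟨fun s t e => Simplex.ext_three e ((Simplex.ce_eq_missingCe₁ hC s).trans
      (Eq.trans (congrArg missingCe₁ e) (Simplex.ce_eq_missingCe₁ hC t).symm)), exists_filler₁ hC⟩
  refine ⟨hb, hornSubmersion_three hS 1 hb fun h₀ => ?_⟩
  obtain ⟨ha, hc⟩ := smoothAlong_horn_three hS h₀
  have key : SmoothAlong (pi fun _ => S 2) faces C.ceStr missingCe₁ h₀ := by
    refine smoothAlong_vc (smoothAlong_iv hC (smoothAlong_wl (ha _ _ (by decide))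
      (hc _ _ _ (by decide) (by decide) (by decide)) (Eventually.of_forall fun h => ?_)))
      (smoothAlong_vc (smoothAlong_wr (hc _ _ _ (by decide) (by decide) (by decide))
      (ha _ _ (by decide)) (Eventually.of_forall fun h => ?_))
      (hc _ _ _ (by decide) (by decide) (by decide)) (Eventually.of_forall fun h => ?_))
      (Eventually.of_forall fun h => ?_)
    all_goals
      obtain ⟨hs, ht, hd, hc⟩ := horn_boundary 1 h
      simp (decide := true) (maxDischargeDepth := 8) only [hs, ht, hd, hc, dom_wl, cod_wl, dom_wr,
        cod_wr, dom_vc, cod_vc, src_cm, tgt_cm, cm_assoc, dom_iv hC, cod_iv hC]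
  refine key.congr (Eventually.of_forall fun h => ?_)
  refine Eq.trans ?_ (Simplex.ce_eq_missingCe₁ hC _).symm
  exact congrArg missingCe₁ ((Equiv.ofBijective _ hb).apply_symm_apply h).symm

lemma hornSubmersion_three_two : Function.Bijective (SSet.hornRestriction C.nerve 3 2) ∧
    SSet.HornSubmersion C.nerve S 2 2 := by
  have hb : Function.Bijective (SSet.hornRestriction C.nerve 3 2) :=
    ⟨fun s t e => Simplex.ext_three e ((Simplex.ce_eq_missingCe₂ hC s).trans
      (Eq.trans (congrArg missingCe₂ e) (Simplex.ce_eq_missingCe₂ hC t).symm)), exists_filler₂ hC⟩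
  refine ⟨hb, hornSubmersion_three hS 2 hb fun h₀ => ?_⟩
  obtain ⟨ha, hc⟩ := smoothAlong_horn_three hS h₀
  have key : SmoothAlong (pi fun _ => S 2) faces C.ceStr missingCe₂ h₀ := by
    refine smoothAlong_vc (smoothAlong_iv hC (smoothAlong_wr
      (hc _ _ _ (by decide) (by decide) (by decide)) (ha _ _ (by decide))
      (Eventually.of_forall fun h => ?_)))
      (smoothAlong_vc (smoothAlong_wl (ha _ _ (by decide))
      (hc _ _ _ (by decide) (by decide) (by decide)) (Eventually.of_forall fun h => ?_))
      (hc _ _ _ (by decide) (by decide) (by decide)) (Eventually.of_forall fun h => ?_))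
      (Eventually.of_forall fun h => ?_)
    all_goals
      obtain ⟨hs, ht, hd, hc⟩ := horn_boundary 2 h
      simp (decide := true) (maxDischargeDepth := 8) only [hs, ht, hd, hc, dom_wl, cod_wl, dom_wr,
        cod_wr, dom_vc, cod_vc, src_cm, tgt_cm, cm_assoc, dom_iv hC, cod_iv hC]
  refine key.congr (Eventually.of_forall fun h => ?_)
  refine Eq.trans ?_ (Simplex.ce_eq_missingCe₂ hC _).symm
  exact congrArg missingCe₂ ((Equiv.ofBijective _ hb).apply_symm_apply h).symm

/-- The coherence equation determines the missing 2-cell of an outer horn `Λ[3, 0]` whiskered by the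
first edge; a right inverse of this edge, chosen smoothly, undoes the whiskering. -/
lemma hornSubmersion_three_zero (hR : C.HasSmoothRightInv) :
    Function.Bijective (SSet.hornRestriction C.nerve 3 0) ∧ SSet.HornSubmersion C.nerve S 2 0 := by
  have hb : Function.Bijective (SSet.hornRestriction C.nerve 3 0) := by
    refine ⟨fun s t e => ?_, fun h => ?_⟩
    · obtain ⟨f', ε, h1⟩ := hR.exists (s.pre.ar 0 1)
      obtain ⟨f'', ε', h2⟩ := hR.exists f'
      have e1 : s.pre.ar 0 1 = t.pre.ar 0 1 := by
        rw [← edge_hornRestriction (n := 0) (k := 0) s (by decide), e,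
          edge_hornRestriction (n := 0) t (by decide)]
      exact Simplex.ext_three e ((Simplex.ce_eq_missingCe₀ hC s h1 h2).trans
        (Eq.trans (congrArg (fun h => missingCe₀ h f' ε) e)
          (Simplex.ce_eq_missingCe₀ hC t (e1 ▸ h1) h2).symm))
    · obtain ⟨f', ε, h1⟩ := hR.exists (edge (n := 0) h 0 1)
      obtain ⟨f'', ε', h2⟩ := hR.exists f'
      exact exists_filler₀ hC h h1 h2
  refine ⟨hb, hornSubmersion_three hS 0 hb fun h₀ => ?_⟩
  obtain ⟨ha, hc⟩ := smoothAlong_horn_three hS h₀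
  obtain ⟨f', ε, hf', hε, hinv⟩ := hR (edge (n := 0) h₀ 0 1)
  have ha01 := ha 0 1 (by decide)
  have hinv' := ha01.tendsto.eventually hinv
  have key : SmoothAlong (pi fun _ => S 2) faces C.ceStr
      (fun h => missingCe₀ h (f' (edge (n := 0) h 0 1)) (ε (edge (n := 0) h 0 1))) h₀ := by
    refine smoothAlong_unwr hC
      (SmoothNear.comp_along (g := fun h : (Λ[3, 0] : SSet.{u}) ⟶ C.nerve => edge (n := 0) h 0 1) hf' ha01)
      (SmoothNear.comp_along (g := fun h : (Λ[3, 0] : SSet.{u}) ⟶ C.nerve => edge (n := 0) h 0 1) hε ha01)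
      (ha _ _ (by decide))
      (smoothAlong_cm (ha _ _ (by decide)) (ha _ _ (by decide)) (Eventually.of_forall fun h => ?_))
      (smoothAlong_vc (smoothAlong_vc (smoothAlong_wl (ha _ _ (by decide))
      (hc _ _ _ (by decide) (by decide) (by decide)) (Eventually.of_forall fun h => ?_))
      (hc _ _ _ (by decide) (by decide) (by decide)) (Eventually.of_forall fun h => ?_))
      (smoothAlong_iv hC (hc _ _ _ (by decide) (by decide) (by decide)))
      (Eventually.of_forall fun h => ?_))
      (hinv'.mono fun h hh => ⟨hh, ?_, ?_, ?_, ?_⟩)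
    all_goals
      obtain ⟨hs, ht, hd, hc⟩ := horn_boundary 0 h
      simp (decide := true) (maxDischargeDepth := 8) only [hs, ht, hd, hc, dom_wl, cod_wl, dom_wr,
        cod_wr, dom_vc, cod_vc, src_cm, tgt_cm, cm_assoc, dom_iv hC, cod_iv hC]
  refine key.congr (hinv'.mono fun h hh => ?_)
  obtain ⟨f'', ε', h2⟩ := hR.exists (f' (edge (n := 0) h 0 1))
  obtain ⟨s, rfl⟩ := hb.2 h
  rw [edge_hornRestriction (n := 0) s (by decide)] at hh h2 ⊢
  refine (Simplex.ce_eq_missingCe₀ hC s hh h2).symm.trans ?_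
  exact congrArg (fun u : Simplex C.toTwoCat 3 => u.pre.ce 1 2 3)
    ((Equiv.ofBijective _ hb).symm_apply_apply s).symm

/-- The coherence equation determines the missing 2-cell of an outer horn `Λ[3, 3]` whiskered by the
last edge; a left inverse of this edge, chosen smoothly, undoes the whiskering. -/
lemma hornSubmersion_three_three (hL : C.HasSmoothLeftInv) :
    Function.Bijective (SSet.hornRestriction C.nerve 3 3) ∧ SSet.HornSubmersion C.nerve S 2 3 := by
  have hb : Function.Bijective (SSet.hornRestriction C.nerve 3 3) := by
    refine ⟨fun s t e => ?_, fun h => ?_⟩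
    · obtain ⟨f', ε, h1⟩ := hL.exists (s.pre.ar 2 3)
      obtain ⟨f'', ε', h2⟩ := hL.exists f'
      have e1 : s.pre.ar 2 3 = t.pre.ar 2 3 := by
        rw [← edge_hornRestriction (n := 0) (k := 3) s (by decide), e,
          edge_hornRestriction (n := 0) t (by decide)]
      exact Simplex.ext_three e ((Simplex.ce_eq_missingCe₃ hC s h1 h2).trans
        (Eq.trans (congrArg (fun h => missingCe₃ h f' ε) e)
          (Simplex.ce_eq_missingCe₃ hC t (e1 ▸ h1) h2).symm))
    · obtain ⟨f', ε, h1⟩ := hL.exists (edge (n := 0) h 2 3)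
      obtain ⟨f'', ε', h2⟩ := hL.exists f'
      exact exists_filler₃ hC h h1 h2
  refine ⟨hb, hornSubmersion_three hS 3 hb fun h₀ => ?_⟩
  obtain ⟨ha, hc⟩ := smoothAlong_horn_three hS h₀
  obtain ⟨f', ε, hf', hε, hinv⟩ := hL (edge (n := 0) h₀ 2 3)
  have ha23 := ha 2 3 (by decide)
  have hinv' := ha23.tendsto.eventually hinv
  have key : SmoothAlong (pi fun _ => S 2) faces C.ceStr
      (fun h => missingCe₃ h (f' (edge (n := 0) h 2 3)) (ε (edge (n := 0) h 2 3))) h₀ := by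
    refine smoothAlong_unwl hC
      (SmoothNear.comp_along (g := fun h : (Λ[3, 3] : SSet.{u}) ⟶ C.nerve => edge (n := 0) h 2 3) hf' ha23)
      (SmoothNear.comp_along (g := fun h : (Λ[3, 3] : SSet.{u}) ⟶ C.nerve => edge (n := 0) h 2 3) hε ha23)
      (ha _ _ (by decide))
      (smoothAlong_cm (ha _ _ (by decide)) (ha _ _ (by decide)) (Eventually.of_forall fun h => ?_))
      (smoothAlong_vc (smoothAlong_vc (smoothAlong_wr
      (hc _ _ _ (by decide) (by decide) (by decide)) (ha _ _ (by decide))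
      (Eventually.of_forall fun h => ?_))
      (hc _ _ _ (by decide) (by decide) (by decide)) (Eventually.of_forall fun h => ?_))
      (smoothAlong_iv hC (hc _ _ _ (by decide) (by decide) (by decide)))
      (Eventually.of_forall fun h => ?_))
      (hinv'.mono fun h hh => ⟨hh, ?_, ?_, ?_, ?_⟩)
    all_goals
      obtain ⟨hs, ht, hd, hc⟩ := horn_boundary 3 h
      simp (decide := true) (maxDischargeDepth := 8) only [hs, ht, hd, hc, dom_wl, cod_wl, dom_wr,
        cod_wr, dom_vc, cod_vc, src_cm, tgt_cm, cm_assoc, dom_iv hC, cod_iv hC]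
  refine key.congr (hinv'.mono fun h hh => ?_)
  obtain ⟨f'', ε', h2⟩ := hL.exists (f' (edge (n := 0) h 2 3))
  obtain ⟨s, rfl⟩ := hb.2 h
  rw [edge_hornRestriction (n := 0) s (by decide)] at hh h2 ⊢
  refine (Simplex.ce_eq_missingCe₃ hC s hh h2).symm.trans ?_
  exact congrArg (fun u : Simplex C.toTwoCat 3 => u.pre.ce 0 1 2)
    ((Equiv.ofBijective _ hb).symm_apply_apply s).symm

end Three

end LieTwoCat

namespace SmoothStr

/-! ### Horns of dimension at most two -/

variable {X X' Y Y' : Type u} {S : SmoothStr X} {S' : SmoothStr X'} {T : SmoothStr Y}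
  {T' : SmoothStr Y'} {f : X → Y} {f' : X' → Y'}

/-- Surjective submersions are invariant under diffeomorphisms of the source and the target. -/
lemma IsSurjSubmersion.of_equiv (h : S.IsSurjSubmersion T f) (eX : X ≃ X') (eY : Y ≃ Y')
    (hc : ∀ x, f' (eX x) = eY (f x)) (hX : ∀ x, SmoothNear S S' eX x)
    (hX' : ∀ x, SmoothNear S' S eX.symm x) (hY : ∀ y, SmoothNear T T' eY y)
    (hY' : ∀ y, SmoothNear T' T eY.symm y) : S'.IsSurjSubmersion T' f' := by
  have hf' : ∀ x, f' x = eY (f (eX.symm x)) := fun x => by rw [← hc, Equiv.apply_symm_apply]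
  rw [isSurjSubmersion_iff] at h ⊢
  refine ⟨fun y => ?_, fun x => ⟨?_, ?_⟩⟩
  · obtain ⟨x, hx⟩ := h.1 (eY.symm y)
    exact ⟨eX x, by rw [hc, hx, Equiv.apply_symm_apply]⟩
  · rw [funext hf']
    exact SmoothNear.comp (f := fun x => f (eX.symm x)) (hY _)
      (SmoothNear.comp (g := f) (h.2 _).1 (hX' x))
  · obtain ⟨s, hs, h0, h1⟩ := (h.2 (eX.symm x)).2
    have e : eY.symm (f' x) = f (eX.symm x) := by rw [hf', Equiv.symm_apply_apply]
    rw [← e] at hs h0 h1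
    refine ⟨fun y => eX (s (eY.symm y)), SmoothNear.comp (f := fun y => s (eY.symm y)) (hX _)
      (hs.comp (hY' _)), ?_, ?_⟩
    · simp only [h0, Equiv.apply_symm_apply]
    · filter_upwards [(hY' (f' x)).tendsto.eventually h1] with y hy
      rw [hc, hy, Equiv.apply_symm_apply]

end SmoothStr

namespace TwoCat

variable {C : TwoCat.{u}}

/-- The end points of an arrow. -/
def endpt (C : TwoCat.{u}) (f : C.Ar) : Fin 2 → C.Ob := ![C.src f, C.tgt f]

namespace Simplex

lemma ob_eq_endpt (s : Simplex C 1) (x : Fin 2) : s.ob x = C.endpt (s.ar 0 1 (by decide)) x := by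
  fin_cases x
  · exact (s.src_ar _ _ _).symm
  · exact (s.tgt_ar _ _ _).symm

lemma ar_of_ob {n : ℕ} {s t : Simplex C n} (h : s.ob = t.ob)
    (h' : ∀ i j (hij : i < j), s.ar i j hij.le = t.ar i j hij.le) (i j) (hij : i ≤ j) :
    s.ar i j hij = t.ar i j hij := by
  obtain rfl | hij' := hij.eq_or_lt
  · rw [s.ar_self, t.ar_self, h]
  · exact h' i j hij'

lemma ext_one {s t : Simplex C 1} (h : s.ar 0 1 (by decide) = t.ar 0 1 (by decide)) : s = t := by
  refine ext_lt (ar_of_ob (funext fun i => ?_) fun i j hij => ?_) fun i j k hij hjk => ?_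
  · rw [ob_eq_endpt, ob_eq_endpt, h]
  · have H : ∀ i j : Fin 2, i < j → i = 0 ∧ j = 1 := by decide
    obtain ⟨rfl, rfl⟩ := H i j hij
    exact h
  · omega

lemma exists_one (hC : C.CellsInvertible) (f : C.Ar) :
    ∃ s : Simplex C 1, s.ar 0 1 (by decide) = f := by
  obtain ⟨u, hu⟩ := ob_zero_bijective.2 (C.src f)
  obtain ⟨s, -, h, -⟩ := exists_of_base hC u f Fin.elim0 hu (fun i => i.elim0)
  exact ⟨s, h⟩

/-- The triangle of a 2-simplex. -/
def triangle (s : Simplex C 2) : C.Triangle :=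
  ⟨(s.ce 0 1 2 (by decide) (by decide), s.ar 1 2 (by decide), s.ar 0 1 (by decide)),
    by rw [s.src_ar, s.tgt_ar], s.cod_ce _ _ _ _ _⟩

lemma triangle_bijective (hC : C.CellsInvertible) : Function.Bijective (triangle (C := C)) := by
  refine ⟨fun s t h => ?_, fun p => ?_⟩
  · have h0 := congrArg (fun p => p.1.1) h
    have h1 := congrArg (fun p => p.1.2.1) h
    have h2 := congrArg (fun p => p.1.2.2) h
    dsimp only [triangle] at h0 h1 h2
    refine ext_lt (ar_of_ob (funext fun i => ?_) fun i j hij => ?_) fun i j k hij hjk => ?_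
    · fin_cases i
      · exact (s.src_ar _ _ _).symm.trans ((congrArg C.src h2).trans (t.src_ar _ _ _))
      · exact (s.tgt_ar _ _ _).symm.trans ((congrArg C.tgt h2).trans (t.tgt_ar _ _ _))
      · exact (s.tgt_ar _ _ _).symm.trans ((congrArg C.tgt h1).trans (t.tgt_ar _ _ _))
    · have H : ∀ i j : Fin 3, i < j → (i = 0 ∧ j = 1) ∨ (i = 1 ∧ j = 2) ∨ (i = 0 ∧ j = 2) := by
        decide
      obtain ⟨rfl, rfl⟩ | ⟨rfl, rfl⟩ | ⟨rfl, rfl⟩ := H i j hij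
      · exact h2
      · exact h1
      · rw [← s.dom_ce 0 1 2 (by decide) (by decide), h0, t.dom_ce]
    · have H : ∀ i j k : Fin 3, i < j → j < k → i = 0 ∧ j = 1 ∧ k = 2 := by decide
      obtain ⟨rfl, rfl, rfl⟩ := H i j k hij hjk
      exact h0
  · obtain ⟨⟨α, g, f⟩, h, hα⟩ := p
    obtain ⟨u, rfl⟩ := exists_one hC f
    obtain ⟨s, rfl, h1, h2⟩ := exists_of_base hC u g (fun _ => α) ((u.tgt_ar _ _ _).symm.trans h.symm)
      fun i => by rw [Subsingleton.elim i 0]; exact (cm_eq h).trans hα.symm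
    exact ⟨s, Subtype.ext (Prod.ext (h2 0) (Prod.ext h1 rfl))⟩

end Simplex

end TwoCat

namespace LieTwoCat

open SmoothStr TwoCat

variable {C : LieTwoCat.{u}}

section Triangle

variable {W : Type*} {Q : SmoothStr W} {w : W} {T : SmoothStr C.Triangle}

lemma IsTriangleStr.smoothNear_ce (hT : C.IsTriangleStr T) (p : C.Triangle) :
    SmoothNear T C.ceStr (fun p => p.1.1) p := isSmooth_iff.1 (hT.smooth 0) p

lemma IsTriangleStr.smoothNear_left (hT : C.IsTriangleStr T) (p : C.Triangle) :
    SmoothNear T C.arStr (fun p => p.1.2.1) p := isSmooth_iff.1 (hT.smooth 1) p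

lemma IsTriangleStr.smoothNear_right (hT : C.IsTriangleStr T) (p : C.Triangle) :
    SmoothNear T C.arStr (fun p => p.1.2.2) p := isSmooth_iff.1 (hT.smooth 2) p

lemma IsTriangleStr.smoothNear (hT : C.IsTriangleStr T) {c : W → C.Triangle}
    (h0 : SmoothNear Q C.ceStr (fun w => (c w).1.1) w)
    (h1 : SmoothNear Q C.arStr (fun w => (c w).1.2.1) w)
    (h2 : SmoothNear Q C.arStr (fun w => (c w).1.2.2) w) : SmoothNear Q T c w := by
  refine hT.embedsIn.smoothNear (SmoothNear.pi fun i => ?_)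
  fin_cases i
  exacts [h0, h1, h2]

/-- For two maps to the manifold of arrows, the embeddings into the product of the family of two
manifolds are those into the binary product. -/
lemma isEmbeddingInProduct_pair_iff {P : Type u} {T : SmoothStr P} {f g : P → C.Ar} :
    T.IsEmbeddingInProduct (ι := Fin 2) ![⟨C.Ar, C.arStr, f⟩, ⟨C.Ar, C.arStr, g⟩] ↔
      EmbedsIn T (C.arStr.prod C.arStr) fun p => (f p, g p) := by
  let φ : Fin 2 → MapToManifold P := ![⟨C.Ar, C.arStr, f⟩, ⟨C.Ar, C.arStr, g⟩]
  constructor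
  · intro h
    have hf (p) : SmoothNear T C.arStr f p := isSmooth_iff.1 (h.smooth 0) p
    have hg (p) : SmoothNear T C.arStr g p := isSmooth_iff.1 (h.smooth 1) p
    refine h.embedsIn.of_smoothAlong (fun p => (hf p).prodMk (hg p)) fun p =>
      SmoothAlong.pi fun i => ?_
    have h1 := smoothAlong_self (R := C.arStr.prod C.arStr) (ι := fun p => (f p, g p)) p
    fin_cases i
    · exact SmoothNear.comp_along (k := Prod.fst) (smoothNear_fst _) h1
    · exact SmoothNear.comp_along (k := Prod.snd) (smoothNear_snd _) h1
  · intro h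
    refine EmbedsIn.isEmbeddingInProduct (h.of_smoothAlong (fun p => SmoothNear.pi fun i => ?_)
      fun p => ?_)
    · fin_cases i
      · exact SmoothNear.comp (g := Prod.fst) (smoothNear_fst _) (h.smooth p)
      · exact SmoothNear.comp (g := Prod.snd) (smoothNear_snd _) (h.smooth p)
    · have h1 := smoothAlong_self (R := pi fun i => (φ i).str) (ι := tuple φ) p
      exact SmoothAlong.prodMk
        (SmoothNear.comp_along (g := tuple φ) (k := fun m => m 0)
          (smoothNear_apply (T := fun i => (φ i).str) 0 _) h1)
        (SmoothNear.comp_along (g := tuple φ) (k := fun m => m 1)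
          (smoothNear_apply (T := fun i => (φ i).str) 1 _) h1)

end Triangle

section Simplices

variable {S : ∀ n, SmoothStr (Simplex C.toTwoCat n)}
  (hS : ∀ n, EmbedsIn (S n) (pi fun _ => C.ceStr) cells)
  {W : Type*} {Q : SmoothStr W} {w : W}

include hS

lemma smoothNear_simplex_one {c : W → Simplex C.toTwoCat 1}
    (h : SmoothNear Q C.arStr (fun w => (c w).ar 0 1 (by decide)) w) : SmoothNear Q (S 1) c w := by
  refine smoothNear_simplex (hS 1) (fun i => ?_) (fun i j hij => ?_) fun i j k hij hjk => ?_
  · fin_cases i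
    · exact ((C.smoothNear_src _).comp h).congr (Eventually.of_forall fun w => (c w).src_ar _ _ _)
    · exact ((C.smoothNear_tgt _).comp h).congr (Eventually.of_forall fun w => (c w).tgt_ar _ _ _)
  · have H : ∀ i j : Fin 2, i < j → i = 0 ∧ j = 1 := by decide
    obtain ⟨rfl, rfl⟩ := H i j hij
    exact h
  · omega

lemma smoothAlong_simplex_two {X M : Type*} {R : SmoothStr M} {ι : X → M} {x : X}
    {c : X → Simplex C.toTwoCat 2}
    (h0 : SmoothAlong R ι C.ceStr (fun x => (c x).ce 0 1 2 (by decide) (by decide)) x)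
    (h1 : SmoothAlong R ι C.arStr (fun x => (c x).ar 1 2 (by decide)) x)
    (h2 : SmoothAlong R ι C.arStr (fun x => (c x).ar 0 1 (by decide)) x) :
    SmoothAlong R ι (S 2) c x := by
  refine smoothAlong_simplex (hS 2) (fun i => ?_) (fun i j hij => ?_) fun i j k hij hjk => ?_
  · fin_cases i
    · exact (smoothAlong_src h2).congr (Eventually.of_forall fun x => (c x).src_ar _ _ _)
    · exact (smoothAlong_tgt h2).congr (Eventually.of_forall fun x => (c x).tgt_ar _ _ _)
    · exact (smoothAlong_tgt h1).congr (Eventually.of_forall fun x => (c x).tgt_ar _ _ _)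
  · have H : ∀ i j : Fin 3, i < j → (i = 0 ∧ j = 1) ∨ (i = 1 ∧ j = 2) ∨ (i = 0 ∧ j = 2) := by
      decide
    obtain ⟨rfl, rfl⟩ | ⟨rfl, rfl⟩ | ⟨rfl, rfl⟩ := H i j hij
    · exact h2
    · exact h1
    · exact (smoothAlong_dom h0).congr (Eventually.of_forall fun x => (c x).dom_ce _ _ _ _ _)
  · have H : ∀ i j k : Fin 3, i < j → j < k → i = 0 ∧ j = 1 ∧ k = 2 := by decide
    obtain ⟨rfl, rfl, rfl⟩ := H i j k hij hjk
    exact h0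

lemma smoothNear_simplex_two {c : W → Simplex C.toTwoCat 2}
    (h0 : SmoothNear Q C.ceStr (fun w => (c w).ce 0 1 2 (by decide) (by decide)) w)
    (h1 : SmoothNear Q C.arStr (fun w => (c w).ar 1 2 (by decide)) w)
    (h2 : SmoothNear Q C.arStr (fun w => (c w).ar 0 1 (by decide)) w) :
    SmoothNear Q (S 2) c w := by
  simp only [← smoothAlong_id_iff] at *
  exact smoothAlong_simplex_two hS h0 h1 h2

variable {T : SmoothStr C.Triangle}

lemma smoothNear_triangle (hT : C.IsTriangleStr T) (s : Simplex C.toTwoCat 2) :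
    SmoothNear (S 2) T Simplex.triangle s :=
  hT.smoothNear (smoothNear_ce (hS 2) _ _ _) (smoothNear_ar (hS 2) _ _) (smoothNear_ar (hS 2) _ _)

lemma smoothNear_of_triangle (hT : C.IsTriangleStr T) {c : C.Triangle → Simplex C.toTwoCat 2}
    (hc : ∀ p, (c p).triangle = p) (p : C.Triangle) : SmoothNear T (S 2) c p := by
  refine smoothNear_simplex_two hS ?_ ?_ ?_
  · exact (hT.smoothNear_ce p).congr (Eventually.of_forall fun q => (congrArg (·.1.1) (hc q)).symm)
  · exact (hT.smoothNear_left p).congr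
      (Eventually.of_forall fun q => (congrArg (·.1.2.1) (hc q)).symm)
  · exact (hT.smoothNear_right p).congr
      (Eventually.of_forall fun q => (congrArg (·.1.2.2) (hc q)).symm)

omit hS in
/-- The fibre product of composable pairs of arrows and 2-cells is the manifold of 2-simplices. -/
lemma exists_isTriangleStr (hC : C.CellsInvertible) : ∃ T : SmoothStr C.Triangle,
    C.IsTriangleStr T := by
  choose S hS using exists_simplexStr hC
  let e := Equiv.ofBijective _ (Simplex.triangle_bijective hC)
  obtain ⟨T, hT⟩ := exists_embedsIn_of_bijective (R := S 2) e.symm.bijective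
  have h : ∀ p, (e.symm p).triangle = p := e.apply_symm_apply
  refine ⟨T, EmbedsIn.isEmbeddingInProduct (hT.of_smoothAlong (fun p => SmoothNear.pi fun i => ?_)
    fun p => ?_)⟩
  · fin_cases i
    · exact ((smoothNear_ce (hS 2) _ _ _).comp (hT.smooth p)).congr
        (Eventually.of_forall fun q => congrArg (·.1.1) (h q))
    · exact ((smoothNear_ar (hS 2) _ _).comp (hT.smooth p)).congr
        (Eventually.of_forall fun q => congrArg (·.1.2.1) (h q))
    · exact ((smoothNear_ar (hS 2) _ _).comp (hT.smooth p)).congr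
        (Eventually.of_forall fun q => congrArg (·.1.2.2) (h q))
  · let φ : Fin 3 → MapToManifold C.Triangle := ![⟨C.Ce, C.ceStr, fun p => p.1.1⟩,
      ⟨C.Ar, C.arStr, fun p => p.1.2.1⟩, ⟨C.Ar, C.arStr, fun p => p.1.2.2⟩]
    have h1 (i : Fin 3) : SmoothAlong (pi fun i => (φ i).str) (tuple φ) (φ i).str (φ i).toFun p :=
      SmoothNear.comp_along (g := tuple φ) (k := fun m => m i)
        (smoothNear_apply (T := fun i => (φ i).str) i _) (smoothAlong_self p)
    refine smoothAlong_simplex_two hS ?_ ?_ ?_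
    · exact (h1 0).congr (Eventually.of_forall fun q => (congrArg (·.1.1) (h q)).symm)
    · exact (h1 1).congr (Eventually.of_forall fun q => (congrArg (·.1.2.1) (h q)).symm)
    · exact (h1 2).congr (Eventually.of_forall fun q => (congrArg (·.1.2.2) (h q)).symm)

end Simplices

section Horns

variable {n : ℕ} {S : ∀ n, SmoothStr (Simplex C.toTwoCat n)}

/-- If the space of horns is parametrized by a manifold, smoothly in both directions with respect to
the faces of horns, then it may be replaced by this manifold. -/
lemma hornSubmersion_iff {k : Fin (n + 2)} {P : Type u} {Q : SmoothStr P}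
    {e : ((Λ[n + 1, k] : SSet.{u}) ⟶ C.nerve) → P} (hb : Function.Bijective e)
    (h1 : ∀ h, SmoothAlong (pi fun _ => S n) faces Q e h)
    (h2 : ∀ p, SmoothNear Q (pi fun _ => S n)
      (fun p => faces ((Equiv.ofBijective e hb).symm p)) p) :
    SSet.HornSubmersion C.nerve S n k ↔
      (S (n + 1)).IsSurjSubmersion Q fun u => e (SSet.hornRestriction C.nerve (n + 1) k u) := by
  let E := Equiv.ofBijective e hb
  constructor
  · rintro ⟨T, hT, hs⟩
    have hT' : EmbedsIn T (pi fun _ => S n) faces := hT.embedsIn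
    exact hs.of_equiv (Equiv.refl _) E (fun u => rfl) (fun u => smoothNear_id u)
      (fun u => smoothNear_id u) (fun h => SmoothAlong.comp_plot (c := fun h => h) (h1 h)
        (hT'.smooth h)) fun p => hT'.smoothNear (h2 p)
  · intro hs
    obtain ⟨T, hT⟩ := exists_embedsIn_of_bijective (R := Q) E.bijective
    have hT' : EmbedsIn T (pi fun _ => S n) faces := by
      refine hT.of_smoothAlong (fun h => ?_) h1
      refine ((h2 (E h)).comp (hT.smooth h)).congr (Eventually.of_forall fun h' => ?_)
      exact congrArg faces (E.symm_apply_apply h')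
    refine ⟨T, EmbedsIn.isEmbeddingInProduct (φ := fun i : {i : Fin (n + 2) // i ≠ k} =>
      ⟨C.nerve _⦋n⦌, S n, fun h => SSet.yonedaEquiv (SSet.horn.ι k i.1 i.2 ≫ h)⟩) hT', ?_⟩
    refine hs.of_equiv (Equiv.refl _) E.symm (fun u => (E.symm_apply_apply _).symm)
      (fun u => smoothNear_id u) (fun u => smoothNear_id u)
      (fun p => hT.smoothNear ((smoothNear_id p).congr (Eventually.of_forall fun q => ?_)))
      fun h => hT.smooth h
    exact (E.apply_symm_apply q).symm

lemma horn_ext' {k : Fin (n + 2)} {h h' : (Λ[n + 1, k] : SSet.{u}) ⟶ C.nerve}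
    (e : ∀ i, faces h i = faces h' i) : h = h' :=
  horn_ext fun i hi => ((faces_eq h ⟨i, hi⟩).symm.trans (e ⟨i, hi⟩)).trans (faces_eq h' ⟨i, hi⟩)

lemma faces_hornRestriction {k : Fin (n + 2)} (u : Simplex C.toTwoCat (n + 1))
    (i : {i : Fin (n + 2) // i ≠ k}) : faces (SSet.hornRestriction C.nerve (n + 1) k u) i =
      u.pullback (Fin.succAboveOrderEmb i.1).toOrderHom :=
  (faces_eq _ i).trans (hornSimplex_hornRestriction (k := k) u _ (inHorn_succAbove i.2))

variable (hS : ∀ n, EmbedsIn (S n) (pi fun _ => C.ceStr) cells)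

include hS

/-- Horns of dimension one are objects, and their fillers are the arrows with a given source or
target. -/
lemma hornSubmersion_one (hC : C.CellsInvertible) (k : Fin 2) :
    SSet.HornSubmersion C.nerve S 0 k := by
  have key : (S 1).IsSurjSubmersion C.obStr fun u => u.ob k := by
    have hbij : Function.Bijective fun u : Simplex C.toTwoCat 1 => u.ar 0 1 (by decide) :=
      ⟨fun s t h => Simplex.ext_one h, fun f => Simplex.exists_one hC f⟩
    let E := Equiv.ofBijective _ hbij
    have h0 : C.arStr.IsSurjSubmersion C.obStr fun f => C.endpt f k := by
      fin_cases k
      exacts [C.src_submersion, C.tgt_submersion]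
    refine h0.of_equiv E.symm (Equiv.refl _) (fun f => ?_) (fun f => ?_) (fun u => ?_)
      (fun x => smoothNear_id x) (fun x => smoothNear_id x)
    · exact (Simplex.ob_eq_endpt _ k).trans (congrArg (C.endpt · k) (E.apply_symm_apply f))
    · refine smoothNear_simplex_one hS ((smoothNear_id f).congr (Eventually.of_forall fun g => ?_))
      exact (E.apply_symm_apply g).symm
    · exact smoothNear_ar (hS 1) _ _
  -- the face of dimension zero, and its vertex
  obtain ⟨a, ha, hk⟩ : ∃ a : {i : Fin 2 // i ≠ k}, (∀ i, i = a) ∧ a.1.succAbove 0 = k := by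
    have H : ∀ k : Fin 2, ∃ a, a ≠ k ∧ a.succAbove 0 = k ∧ ∀ i, i ≠ k → i = a := by decide
    obtain ⟨a, h, hk, ha⟩ := H k
    exact ⟨⟨a, h⟩, fun i => Subtype.ext (ha i.1 i.2), hk⟩
  have hv (u : Simplex C.toTwoCat 1) :
      (faces (SSet.hornRestriction C.nerve 1 k u) a).ob 0 = u.ob k := by
    rw [faces_hornRestriction (n := 0)]
    exact congrArg u.ob hk
  have hb : Function.Bijective fun h : (Λ[1, k] : SSet.{u}) ⟶ C.nerve =>
      (faces (n := 0) h a).ob 0 := by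
    refine ⟨fun h h' e => horn_ext' (n := 0) fun i => ?_, fun x => ?_⟩
    · rw [ha i]
      exact Simplex.ob_zero_bijective.1 e
    · obtain ⟨u, hu⟩ := key.1 x
      exact ⟨_, (hv u).trans hu⟩
  rw [hornSubmersion_iff (n := 0) (Q := C.obStr) hb (fun h => ?_) fun x => ?_]
  rotate_left
  · exact SmoothNear.comp_along (g := faces (n := 0)) (k := fun f => (f a).ob 0)
      (SmoothNear.comp (g := fun u : Simplex C.toTwoCat 0 => u.ob 0)
        (f := fun f : {i : Fin 2 // i ≠ k} → Simplex C.toTwoCat 0 => f a)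
        (smoothNear_ob (hS 0) _ _) (smoothNear_apply (T := fun _ => S 0) a _)) (smoothAlong_self h)
  · refine SmoothNear.pi fun i => ?_
    rw [ha i]
    refine smoothNear_simplex (hS 0) (fun j => ?_) (fun i j hij => ?_) fun i j k hij _ => ?_
    · have hj : j = 0 := Subsingleton.elim (α := Fin 1) j 0
      subst hj
      refine (smoothNear_id x).congr (Eventually.of_forall fun y => ?_)
      exact ((Equiv.ofBijective _ hb).apply_symm_apply y).symm
    · exact absurd (Subsingleton.elim (α := Fin 1) i j) hij.ne
    · exact absurd (Subsingleton.elim (α := Fin 1) i j) hij.ne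
  · simp only [hv, key]

end Horns

end LieTwoCat

namespace LieTwoCat

open SmoothStr TwoCat

variable {C : LieTwoCat.{u}}

/-- Two edges of a horn of dimension two have the same end point at a common vertex. -/
lemma faces_ob {k : Fin 3} (h : (Λ[2, k] : SSet.{u}) ⟶ C.nerve) (a b : {i : Fin 3 // i ≠ k})
    {x y : Fin 2} (e : a.1.succAbove x = b.1.succAbove y) :
    (faces (n := 1) h a).ob x = (faces (n := 1) h b).ob y := by
  let c (z : Fin 2) : Fin 1 →o Fin 2 := ⟨fun _ => z, fun _ _ _ => le_rfl⟩
  have key (i : {i : Fin 3 // i ≠ k}) (z : Fin 2) : (faces (n := 1) h i).ob z =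
      (hornSimplex h ((Fin.succAboveOrderEmb i.1).toOrderHom.comp (c z))
        ⟨i.1, i.2, fun _ => Fin.succAbove_ne _ _⟩).ob 0 := by
    refine Eq.trans ?_ (congrArg (fun s : Simplex C.toTwoCat 0 => s.ob 0)
      (pullback_hornSimplex h (inHorn_succAbove i.2) (c z) ⟨i.1, i.2, fun _ =>
        Fin.succAbove_ne _ _⟩))
    rw [faces_eq]
    rfl
  rw [key, key]
  congr 2
  exact OrderHom.ext _ _ (funext fun _ => e)

/-- Two arrows with matching end points are the edges of a horn of dimension two. -/
lemma exists_horn_two {k : Fin 3} (s : {i : Fin 3 // i ≠ k} → Simplex C.toTwoCat 1)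
    (hs : ∀ a b x y, a.1.succAbove x = b.1.succAbove y → (s a).ob x = (s b).ob y) :
    ∃ h : (Λ[2, k] : SSet.{u}) ⟶ C.nerve, ∀ i, faces (n := 1) h i = s i := by
  have hc : SSet.horn.IsCompatible (n := 1) (X := C.nerve) (i := k)
      fun j hj => SSet.yonedaEquiv.symm (s ⟨j, hj⟩) := by
    rw [SSet.horn.isCompatible_iff]
    intro j l hj hl hjl
    refine SSet.yonedaEquiv.injective (Simplex.ob_zero_bijective.1 ?_)
    have H : ∀ (j l : Fin 3) (hjl : j < l),
        j.succAbove ((l.pred (Fin.ne_zero_of_lt hjl)).succAbove 0) =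
          l.succAbove ((j.castPred (Fin.ne_last_of_lt hjl)).succAbove 0) := by decide
    exact hs ⟨j, hj⟩ ⟨l, hl⟩ _ _ (H j l hjl)
  obtain ⟨φ, hφ⟩ := hc.exists_desc
  exact ⟨φ, fun i => (congrArg SSet.yonedaEquiv (hφ i.1 i.2)).trans
    ((SSet.yonedaEquiv (X := C.nerve) (n := ⦋1⦌)).apply_symm_apply (s i))⟩

variable {S : ∀ n, SmoothStr (Simplex C.toTwoCat n)}
  (hS : ∀ n, EmbedsIn (S n) (pi fun _ => C.ceStr) cells)

include hS

/-- For horns of dimension two, the condition on horns may be expressed by the fibre product `P` of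
pairs of composable arrows, or of pairs of arrows with the same source or target. -/
lemma hornSubmersion_two_iff (hC : C.CellsInvertible) {k : Fin 3} (a b : {i : Fin 3 // i ≠ k})
    (hab : a ≠ b) {P : Type u} {Q : SmoothStr P} {ι : P → C.Ar × C.Ar}
    (hQ : EmbedsIn Q (C.arStr.prod C.arStr) ι)
    (hι : ∀ p, p ∈ Set.range ι ↔
      ∀ x y, a.1.succAbove x = b.1.succAbove y → C.endpt p.1 x = C.endpt p.2 y)
    {d : C.Triangle → P} (hd : ∀ u : Simplex C.toTwoCat 2, ι (d u.triangle) =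
      ((u.pullback (Fin.succAboveOrderEmb a.1).toOrderHom).ar 0 1 (by decide),
        (u.pullback (Fin.succAboveOrderEmb b.1).toOrderHom).ar 0 1 (by decide)))
    {T : SmoothStr C.Triangle} (hT : C.IsTriangleStr T) :
    SSet.HornSubmersion C.nerve S 1 k ↔ T.IsSurjSubmersion Q d := by
  have H : ∀ a b k : Fin 3, a ≠ b → a ≠ k → b ≠ k → ∀ i, i ≠ k → i = a ∨ i = b := by decide
  have hab' (i : {i : Fin 3 // i ≠ k}) : i = a ∨ i = b := by
    simp only [Subtype.ext_iff] at hab ⊢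
    exact H _ _ k (fun h => hab (Subtype.ext h)) a.2 b.2 i.1 i.2
  let edges (h : (Λ[2, k] : SSet.{u}) ⟶ C.nerve) (i : {i : Fin 3 // i ≠ k}) : C.Ar :=
    (faces (n := 1) h i).ar 0 1 (by decide)
  have hmem (h) : ∃ p, ι p = (edges h a, edges h b) := by
    refine (hι _).2 fun x y hxy => ?_
    exact ((faces (n := 1) h a).ob_eq_endpt x).symm.trans
      ((faces_ob h a b hxy).trans ((faces (n := 1) h b).ob_eq_endpt y))
  choose e he using hmem
  have hb : Function.Bijective e := by
    refine ⟨fun h h' hh => horn_ext' (n := 1) fun i => ?_, fun p => ?_⟩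
    · have h1 := (he h).symm.trans ((congrArg ι hh).trans (he h'))
      obtain rfl | rfl := hab' i
      exacts [Simplex.ext_one (congrArg Prod.fst h1), Simplex.ext_one (congrArg Prod.snd h1)]
    · obtain ⟨s, hs⟩ := Simplex.exists_one hC (ι p).1
      obtain ⟨t, ht⟩ := Simplex.exists_one hC (ι p).2
      have hp := (hι (ι p)).1 ⟨p, rfl⟩
      classical
      have hst (x y) (hxy : a.1.succAbove x = b.1.succAbove y) : s.ob x = t.ob y := by
        rw [s.ob_eq_endpt, t.ob_eq_endpt, hs, ht]
        exact hp x y hxy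
      obtain ⟨h, hh⟩ := exists_horn_two (k := k) (fun i => if i = a then s else t)
        fun i j x y hxy => by
          obtain rfl | rfl := hab' i <;> obtain rfl | rfl := hab' j
          · rw [Fin.succAbove_right_injective hxy]
          · rw [if_pos rfl, if_neg hab.symm]
            exact hst x y hxy
          · rw [if_pos rfl, if_neg hab.symm]
            exact (hst y x hxy.symm).symm
          · rw [Fin.succAbove_right_injective hxy]
      refine ⟨h, hQ.injective ((he h).trans (Prod.ext ?_ ?_))⟩
      · dsimp only [edges]
        rw [hh, if_pos rfl, hs]
      · dsimp only [edges]
        rw [hh, if_neg hab.symm, ht]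
  have hedge (h i) : SmoothAlong (pi fun _ => S 1) (faces (n := 1)) C.arStr
      (fun h => edges h i) h :=
    SmoothNear.comp_along (g := faces (n := 1)) (k := fun f => (f i).ar 0 1 (by decide))
      (SmoothNear.comp (g := fun u : Simplex C.toTwoCat 1 => u.ar 0 1 (by decide))
        (f := fun f : {i : Fin 3 // i ≠ k} → Simplex C.toTwoCat 1 => f i)
        (smoothNear_ar (hS 1) _ _) (smoothNear_apply (T := fun _ => S 1) i _)) (smoothAlong_self h)
  rw [hornSubmersion_iff (n := 1) (Q := Q) hb (fun h => ?_) fun p => ?_]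
  · have hde (u : Simplex C.toTwoCat 2) : d u.triangle = e (SSet.hornRestriction C.nerve 2 k u) := by
      refine hQ.injective ((hd u).trans (Eq.trans ?_ (he _).symm))
      dsimp only [edges]
      rw [faces_hornRestriction (n := 1), faces_hornRestriction (n := 1)]
    let E := Equiv.ofBijective _ (Simplex.triangle_bijective hC)
    constructor
    · intro h
      exact h.of_equiv E (Equiv.refl _) hde (smoothNear_triangle hS hT)
        (smoothNear_of_triangle hS hT E.apply_symm_apply) (fun p => smoothNear_id p)
        fun p => smoothNear_id p
    · intro h
      refine h.of_equiv E.symm (Equiv.refl _) (fun p => ?_)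
        (smoothNear_of_triangle hS hT E.apply_symm_apply) (smoothNear_triangle hS hT)
        (fun p => smoothNear_id p) fun p => smoothNear_id p
      exact (hde _).symm.trans (congrArg d (E.apply_symm_apply p))
  · refine hQ.smoothAlong ?_
    simp only [he]
    exact (hedge h a).prodMk (hedge h b)
  · have hp (p) : ι p = (edges ((Equiv.ofBijective e hb).symm p) a,
        edges ((Equiv.ofBijective e hb).symm p) b) :=
      (congrArg ι ((Equiv.ofBijective e hb).apply_symm_apply p)).symm.trans (he _)
    refine SmoothNear.pi fun i => smoothNear_simplex_one hS ?_
    obtain rfl | rfl := hab' i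
    · exact (SmoothNear.comp (g := Prod.fst) (smoothNear_fst _) (hQ.smooth p)).congr
        (Eventually.of_forall fun q => congrArg Prod.fst (hp q))
    · exact (SmoothNear.comp (g := Prod.snd) (smoothNear_snd _) (hQ.smooth p)).congr
        (Eventually.of_forall fun q => congrArg Prod.snd (hp q))

lemma hornSubmersion_two_zero_iff (hC : C.CellsInvertible) {T : SmoothStr C.Triangle}
    (hT : C.IsTriangleStr T) {L : SmoothStr C.LeftHorn} (hL : C.IsLeftHornStr L) :
    SSet.HornSubmersion C.nerve S 1 0 ↔ T.IsSurjSubmersion L C.toLeftHorn := by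
  refine hornSubmersion_two_iff hS hC (k := 0) ⟨2, by decide⟩ ⟨1, by decide⟩ (by decide)
    (ι := Subtype.val) (isEmbeddingInProduct_pair_iff.1 hL) (fun p => ?_) (fun u => ?_) hT
  · refine (Set.ext_iff.1 Subtype.range_coe_subtype p).trans ?_
    have H : ∀ x y : Fin 2, (2 : Fin 3).succAbove x = (1 : Fin 3).succAbove y ↔ x = 0 ∧ y = 0 := by
      decide
    simp only [H]
    exact ⟨by rintro h x y ⟨rfl, rfl⟩; exact h, fun h => h 0 0 ⟨rfl, rfl⟩⟩
  · exact Prod.ext rfl (u.dom_ce 0 1 2 _ _)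

lemma hornSubmersion_two_two_iff (hC : C.CellsInvertible) {T : SmoothStr C.Triangle}
    (hT : C.IsTriangleStr T) {R : SmoothStr C.RightHorn} (hR : C.IsRightHornStr R) :
    SSet.HornSubmersion C.nerve S 1 2 ↔ T.IsSurjSubmersion R C.toRightHorn := by
  refine hornSubmersion_two_iff hS hC (k := 2) ⟨0, by decide⟩ ⟨1, by decide⟩ (by decide)
    (ι := Subtype.val) (isEmbeddingInProduct_pair_iff.1 hR) (fun p => ?_) (fun u => ?_) hT
  · refine (Set.ext_iff.1 Subtype.range_coe_subtype p).trans ?_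
    have H : ∀ x y : Fin 2, (0 : Fin 3).succAbove x = (1 : Fin 3).succAbove y ↔ x = 1 ∧ y = 1 := by
      decide
    simp only [H]
    exact ⟨by rintro h x y ⟨rfl, rfl⟩; exact h, fun h => h 1 1 ⟨rfl, rfl⟩⟩
  · exact Prod.ext rfl (u.dom_ce 0 1 2 _ _)

omit hS in
lemma exists_isLeftHornStr : ∃ L : SmoothStr C.LeftHorn, C.IsLeftHornStr L := by
  have hs := (isSurjSubmersion_iff.1 C.src_submersion).2
  obtain ⟨L, hL, -⟩ := exists_fibreProduct (P := C.LeftHorn) C.smoothNear_src C.smoothNear_src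
    (fun f => (hs f).2) Subtype.val Subtype.val_injective fun p => Set.ext_iff.1 Subtype.range_coe_subtype p
  exact ⟨L, isEmbeddingInProduct_pair_iff.2 hL⟩

omit hS in
lemma exists_isRightHornStr : ∃ R : SmoothStr C.RightHorn, C.IsRightHornStr R := by
  have ht := (isSurjSubmersion_iff.1 C.tgt_submersion).2
  obtain ⟨R, hR, -⟩ := exists_fibreProduct (P := C.RightHorn) C.smoothNear_tgt C.smoothNear_tgt
    (fun f => (ht f).2) Subtype.val Subtype.val_injective fun p => Set.ext_iff.1 Subtype.range_coe_subtype p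
  exact ⟨R, isEmbeddingInProduct_pair_iff.2 hR⟩

/-- Inner horns of dimension two are pairs of composable arrows. Such a pair is filled by a 2-cell
with target its composition, and the target map of 2-cells is a submersion. -/
lemma hornSubmersion_two_one (hC : C.CellsInvertible) : SSet.HornSubmersion C.nerve S 1 1 := by
  have ht := (isSurjSubmersion_iff.1 C.tgt_submersion).2
  obtain ⟨Q, hQ, -⟩ := exists_fibreProduct (P := {p : C.Ar × C.Ar // C.src p.1 = C.tgt p.2})
    C.smoothNear_src C.smoothNear_tgt (fun f => (ht f).2) Subtype.val Subtype.val_injective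
    fun p => Set.ext_iff.1 Subtype.range_coe_subtype p
  obtain ⟨T, hT⟩ := exists_isTriangleStr hC
  refine (hornSubmersion_two_iff hS hC (k := 1) ⟨0, by decide⟩ ⟨2, by decide⟩ (by decide)
    (ι := Subtype.val) (d := fun p => ⟨p.1.2, p.2.1⟩) hQ (fun p => ?_) (fun u => rfl) hT).2 ?_
  · refine (Set.ext_iff.1 Subtype.range_coe_subtype p).trans ?_
    have H : ∀ x y : Fin 2, (0 : Fin 3).succAbove x = (2 : Fin 3).succAbove y ↔ x = 0 ∧ y = 1 := by
      decide
    simp only [H]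
    exact ⟨by rintro h x y ⟨rfl, rfl⟩; exact h, fun h => h 0 1 ⟨rfl, rfl⟩⟩
  · rw [isSurjSubmersion_iff]
    refine ⟨fun p => ⟨⟨(C.idc (C.comp p.1.1 p.1.2 p.2), p.1), p.2, C.cod_idc _⟩, rfl⟩,
      fun p => ⟨hQ.smoothNear ((hT.smoothNear_left p).prodMk (hT.smoothNear_right p)), ?_⟩⟩
    obtain ⟨s, hs, h0, h1⟩ := ((isSurjSubmersion_iff.1 C.cod_submersion).2 p.1.1).2
    classical
    let σ (q : {p : C.Ar × C.Ar // C.src p.1 = C.tgt p.2}) : C.Triangle :=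
      if h : C.cod (s (C.comp q.1.1 q.1.2 q.2)) = C.comp q.1.1 q.1.2 q.2 then
        ⟨(s (C.comp q.1.1 q.1.2 q.2), q.1), q.2, h⟩ else p
    let q₀ : {p : C.Ar × C.Ar // C.src p.1 = C.tgt p.2} := ⟨p.1.2, p.2.1⟩
    have hfst : SmoothNear Q C.arStr (fun q => q.1.1) q₀ :=
      SmoothNear.comp (g := Prod.fst) (smoothNear_fst _) (hQ.smooth q₀)
    have hsnd : SmoothNear Q C.arStr (fun q => q.1.2) q₀ :=
      SmoothNear.comp (g := Prod.snd) (smoothNear_snd _) (hQ.smooth q₀)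
    have hcm : SmoothNear Q C.arStr (fun q => C.comp q.1.1 q.1.2 q.2) q₀ := by
      have h : SmoothNear Q C.arStr (fun q => C.cm q.1.1 q.1.2) q₀ := by
        rw [← smoothAlong_id_iff] at *
        exact smoothAlong_cm hfst hsnd (Eventually.of_forall fun q => q.2)
      exact h.congr (Eventually.of_forall fun q => cm_eq q.2)
    have hp : C.cod p.1.1 = C.comp q₀.1.1 q₀.1.2 q₀.2 := p.2.2
    rw [hp] at hs h0 h1
    have hσ : ∀ᶠ q in Q.nhd q₀, (σ q).1 = (s (C.comp q.1.1 q.1.2 q.2), q.1) :=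
      (hcm.tendsto.eventually h1).mono fun q hq => congrArg Subtype.val (dif_pos hq)
    refine ⟨σ, hT.smoothNear ?_ ?_ ?_, Subtype.ext ?_, ?_⟩
    · exact SmoothNear.congr (SmoothNear.comp (g := s) hs hcm)
        (hσ.mono fun q hq => (congrArg (·.1) hq).symm)
    · exact hfst.congr (hσ.mono fun q hq => (congrArg (·.2.1) hq).symm)
    · exact hsnd.congr (hσ.mono fun q hq => (congrArg (·.2.2) hq).symm)
    · refine (Q.eventually_mem (p := fun q => (σ q).1 = (s (C.comp q.1.1 q.1.2 q.2), q.1)) hσ).trans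
        (Prod.ext h0 rfl)
    · exact hσ.mono fun q hq => Subtype.ext (congrArg (·.2) hq)

end LieTwoCat

namespace LieTwoCat

open SmoothStr TwoCat

/-! ### Lie 2-groupoids -/

variable {C : LieTwoCat.{u}}

section Inverses

variable {T : SmoothStr C.Triangle}

/-- A filler of the horn formed by an arrow `f` and the unit of its target is a right inverse
of `f`. -/
lemma hasSmoothRightInv_of_toRightHorn (hT : C.IsTriangleStr T) {R : SmoothStr C.RightHorn}
    (hR : C.IsRightHornStr R) (h : T.IsSurjSubmersion R C.toRightHorn) : C.HasSmoothRightInv := by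
  intro f₀
  let z (f : C.Ar) : C.RightHorn := ⟨(f, C.one (C.tgt f)), (C.tgt_one _).symm⟩
  rw [isSurjSubmersion_iff] at h
  obtain ⟨p, hp⟩ := h.1 (z f₀)
  obtain ⟨σ, hσ, -, e⟩ := (h.2 p).2
  rw [hp] at hσ e
  have hz : SmoothNear C.arStr R z f₀ := (isEmbeddingInProduct_pair_iff.1 hR).smoothNear
    ((smoothNear_id f₀).prodMk ((C.smoothNear_one _).comp (C.smoothNear_tgt f₀)))
  have hσz : SmoothNear C.arStr T (fun f => σ (z f)) f₀ := hσ.comp hz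
  refine ⟨fun f => (σ (z f)).1.2.2, fun f => (σ (z f)).1.1,
    SmoothNear.comp (g := fun p : C.Triangle => p.1.2.2) (hT.smoothNear_right _) hσz,
    SmoothNear.comp (g := fun p : C.Triangle => p.1.1) (hT.smoothNear_ce _) hσz, ?_⟩
  filter_upwards [hz.tendsto.eventually e] with f hf
  have h1 : (σ (z f)).1.2.1 = f := congrArg (·.1.1) hf
  have h2 : C.dom (σ (z f)).1.1 = C.one (C.tgt f) := congrArg (·.1.2) hf
  obtain ⟨h3, h4⟩ := (σ (z f)).2
  rw [← cm_eq] at h4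
  rw [h1] at h3 h4
  exact ⟨h3.symm, h2, h4⟩

/-- A filler of the horn formed by an arrow `f` and the unit of its source is a left inverse
of `f`. -/
lemma hasSmoothLeftInv_of_toLeftHorn (hT : C.IsTriangleStr T) {L : SmoothStr C.LeftHorn}
    (hL : C.IsLeftHornStr L) (h : T.IsSurjSubmersion L C.toLeftHorn) : C.HasSmoothLeftInv := by
  intro f₀
  let z (f : C.Ar) : C.LeftHorn := ⟨(f, C.one (C.src f)), (C.src_one _).symm⟩
  rw [isSurjSubmersion_iff] at h
  obtain ⟨p, hp⟩ := h.1 (z f₀)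
  obtain ⟨σ, hσ, -, e⟩ := (h.2 p).2
  rw [hp] at hσ e
  have hz : SmoothNear C.arStr L z f₀ := (isEmbeddingInProduct_pair_iff.1 hL).smoothNear
    ((smoothNear_id f₀).prodMk ((C.smoothNear_one _).comp (C.smoothNear_src f₀)))
  have hσz : SmoothNear C.arStr T (fun f => σ (z f)) f₀ := hσ.comp hz
  refine ⟨fun f => (σ (z f)).1.2.1, fun f => (σ (z f)).1.1,
    SmoothNear.comp (g := fun p : C.Triangle => p.1.2.1) (hT.smoothNear_left _) hσz,
    SmoothNear.comp (g := fun p : C.Triangle => p.1.1) (hT.smoothNear_ce _) hσz, ?_⟩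
  filter_upwards [hz.tendsto.eventually e] with f hf
  have h1 : (σ (z f)).1.2.2 = f := congrArg (·.1.1) hf
  have h2 : C.dom (σ (z f)).1.1 = C.one (C.src f) := congrArg (·.1.2) hf
  obtain ⟨h3, h4⟩ := (σ (z f)).2
  rw [← cm_eq] at h4
  rw [h1] at h3 h4
  exact ⟨h3, h2, h4⟩

end Inverses

variable {S : ∀ n, SmoothStr (Simplex C.toTwoCat n)}

lemma hornSubmersion_of_three_le (hS : ∀ n, EmbedsIn (S n) (pi fun _ => C.ceStr) cells)
    (hC : C.CellsInvertible) (n : ℕ) (k : Fin (n + 4)) (hR : k = 0 → C.HasSmoothRightInv)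
    (hL : k = Fin.last (n + 3) → C.HasSmoothLeftInv) :
    Function.Bijective (SSet.hornRestriction C.nerve (n + 3) k) ∧
      SSet.HornSubmersion C.nerve S (n + 2) k := by
  obtain _ | n := n
  · have H : ∀ k : Fin 4, k = 0 ∨ k = 1 ∨ k = 2 ∨ k = 3 := by decide
    obtain rfl | rfl | rfl | rfl := H k
    · exact hornSubmersion_three_zero hS hC (hR rfl)
    · exact hornSubmersion_three_one hS hC
    · exact hornSubmersion_three_two hS hC
    · exact hornSubmersion_three_three hS hC (hL rfl)
  · exact hornSubmersion_of_four_le hS hC k (fun h => (hR h).exists) fun h => (hL h).exists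

lemma isWeakLieCategory_nerve (hC : C.CellsInvertible) (hS : C.IsNerveStr S) :
    SSet.IsWeakLieCategory 2 C.nerve S := by
  have hS' := isNerveStr_iff.1 hS
  have h3 (n : ℕ) (k : Fin (n + 4)) (h0 : 0 < k) (h1 : k < Fin.last (n + 3)) :=
    hornSubmersion_of_three_le hS' hC n k (fun h => absurd h h0.ne') fun h => absurd h h1.ne
  refine ⟨isSimplicialManifold hS, fun n k h0 h1 => ?_, fun n k h0 h1 hn => ?_⟩
  · obtain _ | _ | n := n
    · exact hornSubmersion_one hS' hC k
    · have H : ∀ k : Fin 3, 0 < k → k < Fin.last 2 → k = 1 := by decide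
      obtain rfl := H k h0 h1
      exact hornSubmersion_two_one hS' hC
    · exact (h3 n k h0 h1).2
  · obtain _ | _ | n := n
    · omega
    · omega
    · exact (h3 n k h0 h1).1.1

lemma isWeakLieGroupoid_nerve_iff (hC : C.CellsInvertible) (hS : C.IsNerveStr S) :
    SSet.IsWeakLieGroupoid 2 C.nerve S ↔ C.IsLieTwoGroupoid := by
  have hS' := isNerveStr_iff.1 hS
  constructor
  · intro h
    obtain ⟨T, hT⟩ := exists_isTriangleStr hC
    obtain ⟨L, hL⟩ := exists_isLeftHornStr (C := C)
    obtain ⟨R, hR⟩ := exists_isRightHornStr (C := C)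
    have hl := (hornSubmersion_two_zero_iff hS' hC hT hL).1 (h.submersion 1 0)
    have hr := (hornSubmersion_two_two_iff hS' hC hT hR).1 (h.submersion 1 2)
    exact ⟨isTwoGroupoid_of_inverses hC (hasSmoothRightInv_of_toRightHorn hT hR hr).exists
      (hasSmoothLeftInv_of_toLeftHorn hT hL hl).exists,
      ⟨C.iv, isInverse_iv hC, isSmooth_iff.2 (smoothNear_iv hC)⟩, T, L, R, hT, hL, hR, hl, hr⟩
  · rintro ⟨-, -, T, L, R, hT, hL, hR, hl, hr⟩
    have h3 (n : ℕ) (k : Fin (n + 4)) := hornSubmersion_of_three_le hS' hC n k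
      (fun _ => hasSmoothRightInv_of_toRightHorn hT hR hr)
      fun _ => hasSmoothLeftInv_of_toLeftHorn hT hL hl
    refine ⟨isSimplicialManifold hS, fun n k => ?_, fun n k hn => ?_⟩
    · obtain _ | _ | n := n
      · exact hornSubmersion_one hS' hC k
      · have H : ∀ k : Fin 3, k = 0 ∨ k = 1 ∨ k = 2 := by decide
        obtain rfl | rfl | rfl := H k
        · exact (hornSubmersion_two_zero_iff hS' hC hT hL).2 hl
        · exact hornSubmersion_two_one hS' hC
        · exact (hornSubmersion_two_two_iff hS' hC hT hR).2 hr
      · exact (h3 n k).2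
    · obtain _ | _ | n := n
      · omega
      · omega
      · exact (h3 n k).1.1

end LieTwoCat

theorem mainTheorem5 (C : LieTwoCat.{u}) (hC : C.CellsInvertible) :
    (∃ S : ∀ n : ℕ, SmoothStr (C.nerve _⦋n⦌), C.IsNerveStr S) ∧
    ∀ S : ∀ n : ℕ, SmoothStr (C.nerve _⦋n⦌), C.IsNerveStr S →
      SSet.IsWeakLieCategory 2 C.nerve S ∧
      (SSet.IsWeakLieGroupoid 2 C.nerve S ↔ C.IsLieTwoGroupoid) :=
  ⟨LieTwoCat.exists_isNerveStr hC, fun _ hS => ⟨LieTwoCat.isWeakLieCategory_nerve hC hS,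
    LieTwoCat.isWeakLieGroupoid_nerve_iff hC hS⟩⟩
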